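/- **Setting.** Let $n\in\mathbb N_0$, let $\mathbb B$ be a compact smooth manifold with boundary of dimension $n+1$, with interior $\mathbb B^\circ$, and let $X$ be a closed smooth manifold of dimension $n$, identified with $\partial\mathbb B$ by a collar, i.e. a diffeomorphism of $[0,1)\times X$ onto an open neighbourhood of $\partial\mathbb B$ which maps $\{0\}\times X$ onto $\partial\mathbb B$; local coordinates in the collar are written $(t,x)$. Fix a measure $m$ on $\mathbb B$ with a smooth positive density on $\mathbb B^\circ$ which in the collar has the form $t^n\rho(t,x)\,dt\,dx$ with $\rho$ smooth and positive up to $t=0$ (for example the Riemannian measure of a metric of the form $dt^2+t^2h(t)$ near $\partial\mathbb B$, where $h$ is a smooth family of Riemannian metrics on $X$). A function $u$ on $\mathbb B^\circ$ is identified with the functional $\varphi\mapsto\int u\varphi\,dm$ on $C_c^\infty(\mathbb B^\circ)$. **Spaces.** Let $1<p<\infty$, $\gamma\in\mathbb R$. For $k\in\mathbb N_0$ let $$\mathcal H^{k,\gamma}_p(\mathbb B)=\Big\{u\in H^k_{p,loc}(\mathbb B^\circ): t^{\frac{n+1}2-\gamma}\,\partial_x^\alpha(t\partial_t)^ju(t,x)\,\omega(t)\in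 L^p\big(\tfrac{dx\,dt}t\big)\ \text{ for all } j+|\alpha|\le k\Big\},$$ where $\omega$ is a cut-off function: smooth, $0\le\omega\le1$, non-increasing on $[0,\infty)$, equal to $1$ near $t=0$, and supported in the collar. It is normed by the sum of the $L^p$-norms of these functions over finitely many compact pieces of charts covering $X$, and of the $L^p$-norms of the derivatives of $u$ of order $\le k$ over finitely many compact pieces of interior charts which cover the complement of a set $[0,r)\times X$ on which $\omega=1$. For negative integers, $\mathcal H^{-k,\gamma}_p(\mathbb B)$ is the dual of $\mathcal H^{k,-\gamma}_{p'}(\mathbb B)$, $1/p+1/p'=1$, with respect to the pairing $\int u\varphi\,dm$; for $s=k+\theta$, $k\in\mathbb Z$, $0<\theta<1$, let $\mathcal H^{s,\gamma}_p(\mathbb B)=[\mathcal H^{k,\gamma}_p(\mathbb B),\mathcal H^{k+1,\gamma}_p(\mathbb B)]_\theta$ (complex interpolation). **Theorem 5.4 (cone differential operators are bounded).** Let $\mu\in\mathbb N_0$ and let $A$ be a conically degenerate differential operator of order $\mu$, that is, a differential operator of order $\le\mu$ with smooth coefficients on $\mathbb B^\circ$ which close to $\partial\mathbb B$ can be written in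 the form $$A=t^{-\mu}\sum_{j=0}^{\mu}a_j(t,x,D_x)(-t\partial_t)^j,$$ where $t\mapsto a_j(t,x,D_x)$ is a family of differential operators of order $\le\mu-j$ on $X$ that is smooth up to $t=0$. Then $A:C_c^\infty(\mathbb B^\circ)\to C_c^\infty(\mathbb B^\circ)$ has a formal transpose $A^t$ on $C_c^\infty(\mathbb B^\circ)$ with respect to $m$, and, with $A$ acting on functionals on $C_c^\infty(\mathbb B^\circ)$ by $(Au)(\varphi)=u(A^t\varphi)$, for all $1<p<\infty$ and $s,\gamma\in\mathbb R$, $$A:\mathcal H^{s+\mu,\gamma+\mu}_p(\mathbb B)\longrightarrow\mathcal H^{s,\gamma}_p(\mathbb B)$$ is bounded. -/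

import Mathlib

open Set Filter Topology MeasureTheory
open scoped Manifold ContDiff NNReal ENNReal

noncomputable section

/-! ### Multi-indices, partial derivatives, weak derivatives -/

/-- The multi-indices `α ∈ ℕ^d` with `|α| ≤ k`. -/
def multiIdx (d k : ℕ) : Finset (Fin d → ℕ) :=
  (Fintype.piFinset fun _ => Finset.range (k + 1)).filter fun α => ∑ i, α i ≤ k

theorem mem_multiIdx {d k : ℕ} {α : Fin d → ℕ} : α ∈ multiIdx d k ↔ ∑ i, α i ≤ k := by
  simp only [multiIdx, Finset.mem_filter, Fintype.mem_piFinset, Finset.mem_range,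
    and_iff_right_iff_imp]
  intro h i
  have := Finset.single_le_sum (f := α) (fun j _ => Nat.zero_le _) (Finset.mem_univ i)
  omega

/-- The partial derivative `∂_i f`. -/
def partialD {d : ℕ} (i : Fin d) (f : EuclideanSpace ℝ (Fin d) → ℂ) :
    EuclideanSpace ℝ (Fin d) → ℂ :=
  fun x => fderiv ℝ f x (EuclideanSpace.single i 1)

/-- The iterated partial derivative `∂^α f`. -/
def iterD {d : ℕ} (α : Fin d → ℕ) (f : EuclideanSpace ℝ (Fin d) → ℂ) :
    EuclideanSpace ℝ (Fin d) → ℂ :=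
  (List.finRange d).foldr (fun i h => (partialD i)^[α i] h) f

/-- The operator `t ∂_t` on functions of `(t, x) ∈ ℝ × ℝⁿ`. -/
def tD {n : ℕ} (f : ℝ × EuclideanSpace ℝ (Fin n) → ℂ) : ℝ × EuclideanSpace ℝ (Fin n) → ℂ :=
  fun z => (z.1 : ℂ) * fderiv ℝ f z (1, 0)

/-- The operator `∂_{x_i}` on functions of `(t, x) ∈ ℝ × ℝⁿ`. -/
def xD {n : ℕ} (i : Fin n) (f : ℝ × EuclideanSpace ℝ (Fin n) → ℂ) :
    ℝ × EuclideanSpace ℝ (Fin n) → ℂ :=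
  fun z => fderiv ℝ f z (0, EuclideanSpace.single i 1)

/-- The operator `∂_x^α (t ∂_t)^j`. -/
def coneD {n : ℕ} (j : ℕ) (α : Fin n → ℕ) (f : ℝ × EuclideanSpace ℝ (Fin n) → ℂ) :
    ℝ × EuclideanSpace ℝ (Fin n) → ℂ :=
  (List.finRange n).foldr (fun i h => (xD i)^[α i] h) (tD^[j] f)

/-- `g` is the weak derivative `∂^α f` on the open set `Ω`. -/
def HasWeakD {d : ℕ} (Ω : Set (EuclideanSpace ℝ (Fin d))) (α : Fin d → ℕ)
    (f g : EuclideanSpace ℝ (Fin d) → ℂ) : Prop :=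
  LocallyIntegrableOn f Ω ∧ LocallyIntegrableOn g Ω ∧
    ∀ η : EuclideanSpace ℝ (Fin d) → ℂ, ContDiff ℝ ∞ η → HasCompactSupport η → tsupport η ⊆ Ω →
      ∫ x, f x * iterD α η x = (-1) ^ (∑ i, α i) * ∫ x, g x * η x

/-- `g` is the weak derivative `∂_x^α (t ∂_t)^j f` on the open set `Ω ⊆ (0, ∞) × ℝⁿ`.  The fields
`t ∂_t` and `∂_{x_i}` are antisymmetric with respect to the measure `dt dx / t`. -/
def HasWeakConeD {n : ℕ} (Ω : Set (ℝ × EuclideanSpace ℝ (Fin n))) (j : ℕ) (α : Fin n → ℕ)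
    (f g : ℝ × EuclideanSpace ℝ (Fin n) → ℂ) : Prop :=
  LocallyIntegrableOn f Ω ∧ LocallyIntegrableOn g Ω ∧
    ∀ η : ℝ × EuclideanSpace ℝ (Fin n) → ℂ,
      ContDiff ℝ ∞ η → HasCompactSupport η → tsupport η ⊆ Ω →
      ∫ z, f z * coneD j α η z / (z.1 : ℂ) = (-1) ^ (j + ∑ i, α i) * ∫ z, g z * η z / (z.1 : ℂ)

/-! ### Complex interpolation

A compatible couple is given by two (extended) norms `N₀, N₁` on one vector space `V`; the spaces
are the sets where the norms are finite. -/

/-- The norm of the sum space `X₀ + X₁`. -/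
def sumNorm {V : Type*} [AddCommGroup V] (N₀ N₁ : V → ℝ≥0∞) (v : V) : ℝ≥0∞ :=
  ⨅ a : V, N₀ a + N₁ (v - a)

/-- Calderón's space of functions on the strip `0 ≤ Re z ≤ 1`: bounded and continuous with values
in `X₀ + X₁`, holomorphic in the interior, and such that `y ↦ F (j + i y)` is continuous with values
in `X_j` and tends to zero at infinity, `j = 0, 1`. -/
structure CalderonFun {V : Type*} [AddCommGroup V] [Module ℂ V] (N₀ N₁ : V → ℝ≥0∞)
    (F : ℂ → V) : Prop where
  bounded : ∃ C : ℝ≥0, ∀ z : ℂ, 0 ≤ z.re → z.re ≤ 1 → sumNorm N₀ N₁ (F z) ≤ C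
  continuous : ∀ z : ℂ, 0 ≤ z.re → z.re ≤ 1 →
    Tendsto (fun w => sumNorm N₀ N₁ (F w - F z)) (𝓝[{w : ℂ | 0 ≤ w.re ∧ w.re ≤ 1}] z) (𝓝 0)
  holomorphic : ∀ z : ℂ, 0 < z.re → z.re < 1 → ∃ F' : V, sumNorm N₀ N₁ F' < ⊤ ∧
    Tendsto (fun w => sumNorm N₀ N₁ ((w - z)⁻¹ • (F w - F z) - F')) (𝓝[≠] z) (𝓝 0)
  left_mem : ∀ y : ℝ, N₀ (F (y * Complex.I)) < ⊤
  left_continuous : ∀ y : ℝ,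
    Tendsto (fun y' : ℝ => N₀ (F (y' * Complex.I) - F (y * Complex.I))) (𝓝 y) (𝓝 0)
  left_decay : Tendsto (fun y : ℝ => N₀ (F (y * Complex.I))) (cocompact ℝ) (𝓝 0)
  right_mem : ∀ y : ℝ, N₁ (F (1 + y * Complex.I)) < ⊤
  right_continuous : ∀ y : ℝ,
    Tendsto (fun y' : ℝ => N₁ (F (1 + y' * Complex.I) - F (1 + y * Complex.I))) (𝓝 y) (𝓝 0)
  right_decay : Tendsto (fun y : ℝ => N₁ (F (1 + y * Complex.I))) (cocompact ℝ) (𝓝 0)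

/-- The norm of the complex interpolation space `[X₀, X₁]_θ`. -/
def interpNorm {V : Type*} [AddCommGroup V] [Module ℂ V] (N₀ N₁ : V → ℝ≥0∞) (θ : ℝ) (v : V) :
    ℝ≥0∞ :=
  ⨅ (F : ℂ → V) (_ : CalderonFun N₀ N₁ F) (_ : F (θ : ℂ) = v),
    max (⨆ y : ℝ, N₀ (F (y * Complex.I))) (⨆ y : ℝ, N₁ (F (1 + y * Complex.I)))

/-! ### The blown-up manifold with its collar

`B` is the blown-up manifold, a manifold with boundary of dimension `n + 1`, and `X` is the
cross-section, a closed manifold of dimension `n` that is identified with `∂B` by the collar. -/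

/-- A collar neighbourhood: a diffeomorphism of `[0, 1) × X` onto an open neighbourhood of the
boundary of `B`, which maps `{0} × X` onto the boundary. -/
structure Collar (n : ℕ) (B X : Type*) [TopologicalSpace B]
    [ChartedSpace (EuclideanHalfSpace (n + 1)) B] [TopologicalSpace X]
    [ChartedSpace (EuclideanSpace ℝ (Fin n)) X] extends PartialEquiv (ℝ × X) B where
  source_eq : source = Ico (0 : ℝ) 1 ×ˢ (univ : Set X)
  open_target : IsOpen target
  image_zero : toFun '' ({(0 : ℝ)} ×ˢ (univ : Set X)) = (𝓡∂ (n + 1)).boundary B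
  smooth : ContMDiffOn (𝓘(ℝ, ℝ).prod (𝓡 n)) (𝓡∂ (n + 1)) ∞ toFun source
  smooth_symm : ContMDiffOn (𝓡∂ (n + 1)) (𝓘(ℝ, ℝ).prod (𝓡 n)) ∞ invFun target

section Manifold

variable {n : ℕ} {B X : Type*} [TopologicalSpace B]
  [ChartedSpace (EuclideanHalfSpace (n + 1)) B] [TopologicalSpace X]
  [ChartedSpace (EuclideanSpace ℝ (Fin n)) X]

/-- The (open) set of coordinate vectors in the range of a chart that belong to interior points. -/
def chartDom (e : OpenPartialHomeomorph B (EuclideanHalfSpace (n + 1))) :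
    Set (EuclideanSpace ℝ (Fin (n + 1))) :=
  (e.extend (𝓡∂ (n + 1))).target ∩ interior (range (𝓡∂ (n + 1)))

/-- A function on `B` in the coordinates of the chart `e`. -/
def inChart (e : OpenPartialHomeomorph B (EuclideanHalfSpace (n + 1))) (f : B → ℂ) :
    EuclideanSpace ℝ (Fin (n + 1)) → ℂ :=
  f ∘ (e.extend (𝓡∂ (n + 1))).symm

/-- The local coordinates `(t, x)` near the boundary, for a chart `ψ` of the cross-section. -/
def collarCoord (c : Collar n B X) (ψ : OpenPartialHomeomorph X (EuclideanSpace ℝ (Fin n))) :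
    ℝ × EuclideanSpace ℝ (Fin n) → B :=
  fun z => c.toFun (z.1, ψ.symm z.2)

variable (n B) in
/-- The test functions: smooth functions with compact support in the interior of `B`. -/
def testFun : Submodule ℂ (B → ℂ) where
  carrier := {φ | ContMDiff (𝓡∂ (n + 1)) 𝓘(ℝ, ℂ) ∞ φ ∧ HasCompactSupport φ ∧
    tsupport φ ⊆ (𝓡∂ (n + 1)).interior B}
  zero_mem' := by
    refine ⟨contMDiff_const, HasCompactSupport.zero, ?_⟩
    have h : tsupport (0 : B → ℂ) = ∅ := tsupport_eq_empty_iff.2 rfl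
    rw [h]
    exact empty_subset _
  add_mem' := by
    rintro φ ψ ⟨h1, h2, h3⟩ ⟨h1', h2', h3'⟩
    exact ⟨h1.add h1', h2.add h2', (tsupport_add φ ψ).trans (union_subset h3 h3')⟩
  smul_mem' := by
    rintro a φ ⟨h1, h2, h3⟩
    exact ⟨(contDiff_const_smul a).contMDiff.comp h1, h2.smul_left (f := fun _ => a),
      (tsupport_smul_subset_right (fun _ => a) φ).trans h3⟩

variable (n B) in
/-- Linear functionals on the test functions, as the ambient space for generalised functions.  The
spaces below consist of functionals of finite norm, and these are distributions. -/
abbrev GenFun : Type _ := Module.Dual ℂ (testFun n B)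

/-- `m` is the measure of a smooth positive density in the interior which near the boundary is of
the form `tⁿ ρ(t, x) dt dx` with `ρ` smooth and positive up to `t = 0`.  The Riemannian measure of a
metric `dt² + t² h(t)` is of this kind, with `ρ = √(det h(t))`. -/
structure IsConeMeasure [MeasurableSpace B] (c : Collar n B X) (m : Measure B) : Prop where
  interior : ∀ e ∈ IsManifold.maximalAtlas (𝓡∂ (n + 1)) ∞ B,
    ∃ ρ : EuclideanSpace ℝ (Fin (n + 1)) → ℝ, ContDiffOn ℝ ∞ ρ (chartDom e) ∧
      (∀ x ∈ chartDom e, 0 < ρ x) ∧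
      ∀ s, MeasurableSet s → s ⊆ chartDom e →
        m ((e.extend (𝓡∂ (n + 1))).symm '' s) = ∫⁻ x in s, ENNReal.ofReal (ρ x)
  collar : ∀ ψ ∈ IsManifold.maximalAtlas (𝓡 n) ∞ X,
    ∃ ρ : ℝ × EuclideanSpace ℝ (Fin n) → ℝ, ContDiffOn ℝ ∞ ρ (Ico 0 1 ×ˢ ψ.target) ∧
      (∀ z ∈ Ico (0 : ℝ) 1 ×ˢ ψ.target, 0 < ρ z) ∧
      ∀ s, MeasurableSet s → s ⊆ Ioo 0 1 ×ˢ ψ.target →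
        m (collarCoord c ψ '' s) = ∫⁻ z in s, ENNReal.ofReal (z.1 ^ n * ρ z)

/-! ### Cone differential operators -/

/-- `A` is a conically degenerate differential operator of order `μ`: in local coordinates in the
interior it is a differential operator of order at most `μ` with smooth coefficients, and close to
the boundary it is `t^{-μ} ∑_{j ≤ μ} a_j(t, x, D_x) (-t ∂_t)^j`, where
`a_j(t, x, D_x) = ∑_{|α| ≤ μ - j} a_{j,α}(t, x) ∂_x^α` has coefficients that are smooth up to
`t = 0` (the factors `(-i)^{|α|}` of `D_x^α` are part of the coefficients). -/
structure IsConeDiffOp (c : Collar n B X) (μ : ℕ) (A : testFun n B →ₗ[ℂ] testFun n B) : Prop where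
  interior : ∀ e ∈ IsManifold.maximalAtlas (𝓡∂ (n + 1)) ∞ B,
    ∃ a : (Fin (n + 1) → ℕ) → EuclideanSpace ℝ (Fin (n + 1)) → ℂ,
      (∀ α ∈ multiIdx (n + 1) μ, ContDiffOn ℝ ∞ (a α) (chartDom e)) ∧
      ∀ φ : testFun n B, ∀ x ∈ chartDom e,
        inChart e (A φ) x = ∑ α ∈ multiIdx (n + 1) μ, a α x * iterD α (inChart e φ) x
  collar : ∃ ε : ℝ, 0 < ε ∧ ε ≤ 1 ∧ ∀ ψ ∈ IsManifold.maximalAtlas (𝓡 n) ∞ X,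
    ∃ a : ℕ → (Fin n → ℕ) → ℝ × EuclideanSpace ℝ (Fin n) → ℂ,
      (∀ j ≤ μ, ∀ α ∈ multiIdx n (μ - j), ContDiffOn ℝ ∞ (a j α) (Ico 0 ε ×ˢ ψ.target)) ∧
      ∀ φ : testFun n B, ∀ z ∈ Ioo 0 ε ×ˢ ψ.target,
        (A φ : B → ℂ) (collarCoord c ψ z) = ((z.1 : ℂ) ^ μ)⁻¹ *
          ∑ j ∈ Finset.range (μ + 1), ∑ α ∈ multiIdx n (μ - j),
            a j α z * ((-1) ^ j * coneD j α ((φ : B → ℂ) ∘ collarCoord c ψ) z)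

/-- `At` is the formal transpose of `A` for the pairing `∫ φ ψ dm`.  By duality `A` then acts on
generalised functions by `(A u)(ψ) = u (At ψ)`, that is, as `At.dualMap`; on test functions, embedded
by `φ ↦ (ψ ↦ ∫ φ ψ dm)`, this is the given operator. -/
def IsFormalTranspose [MeasurableSpace B] (m : Measure B) (A At : testFun n B →ₗ[ℂ] testFun n B) :
    Prop :=
  ∀ φ ψ : testFun n B,
    ∫ y, (A φ : B → ℂ) y * (ψ : B → ℂ) y ∂m = ∫ y, (φ : B → ℂ) y * (At ψ : B → ℂ) y ∂m

/-! ### Cone Sobolev spaces -/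

/-- The choices that enter in the norms: compact pieces of interior charts, compact pieces of charts
of the cross-section, and a cut-off function supported in the collar. -/
structure NormData (c : Collar n B X) where
  N : ℕ
  chart : Fin N → OpenPartialHomeomorph B (EuclideanHalfSpace (n + 1))
  chart_mem : ∀ i, chart i ∈ IsManifold.maximalAtlas (𝓡∂ (n + 1)) ∞ B
  piece : Fin N → Set B
  piece_compact : ∀ i, IsCompact (piece i)
  piece_subset : ∀ i, piece i ⊆ (chart i).source ∩ (𝓡∂ (n + 1)).interior B
  M : ℕ
  xchart : Fin M → OpenPartialHomeomorph X (EuclideanSpace ℝ (Fin n))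
  xchart_mem : ∀ j, xchart j ∈ IsManifold.maximalAtlas (𝓡 n) ∞ X
  xpiece : Fin M → Set X
  xpiece_compact : ∀ j, IsCompact (xpiece j)
  xpiece_subset : ∀ j, xpiece j ⊆ (xchart j).source
  xpiece_cover : ⋃ j, xpiece j = univ
  cutoff : ℝ → ℝ
  cutoff_smooth : ContDiff ℝ ∞ cutoff
  cutoff_mem : ∀ t, cutoff t ∈ Icc (0 : ℝ) 1
  cutoff_antitone : AntitoneOn cutoff (Ici 0)
  r : ℝ
  r_pos : 0 < r
  cutoff_one : ∀ t ∈ Icc 0 r, cutoff t = 1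
  R : ℝ
  R_lt_one : R < 1
  cutoff_zero : ∀ t, R ≤ t → cutoff t = 0
  piece_cover : univ ⊆ (⋃ i, piece i) ∪ c.toFun '' (Ico 0 r ×ˢ univ)

/-- `f ∈ H^k_{p,loc}` on the interior of `B`. -/
def SobolevLoc (n : ℕ) {B : Type*} [TopologicalSpace B]
    [ChartedSpace (EuclideanHalfSpace (n + 1)) B] (k : ℕ) (p : ℝ) (f : B → ℂ) : Prop :=
  ∀ e ∈ IsManifold.maximalAtlas (𝓡∂ (n + 1)) ∞ B, ∀ α ∈ multiIdx (n + 1) k,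
    ∃ g, HasWeakD (chartDom e) α (inChart e f) g ∧
      ∀ K ⊆ chartDom e, IsCompact K → MemLp g (ENNReal.ofReal p) (volume.restrict K)

/-- The norm of `∂^α f` in `L^p(piece i)`, in the coordinates of the `i`-th chart. -/
def interiorTerm {c : Collar n B X} (D : NormData c) (p : ℝ) (f : B → ℂ) (i : Fin D.N)
    (α : Fin (n + 1) → ℕ) : ℝ≥0∞ :=
  ⨅ (g) (_ : HasWeakD (chartDom (D.chart i)) α (inChart (D.chart i) f) g),
    eLpNorm g (ENNReal.ofReal p)
      (volume.restrict ((D.chart i).extend (𝓡∂ (n + 1)) '' D.piece i))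

/-- The norm of `t^{(n+1)/2-γ} ∂_x^α (t ∂_t)^l f · cutoff(t)` in `L^p((0, 1) × xpiece j; dt dx / t)`, in the
coordinates of the `j`-th chart of the cross-section. -/
def collarTerm {c : Collar n B X} (D : NormData c) (γ p : ℝ) (f : B → ℂ) (j : Fin D.M) (l : ℕ)
    (α : Fin n → ℕ) : ℝ≥0∞ :=
  ⨅ (g) (_ : HasWeakConeD (Ioo 0 1 ×ˢ (D.xchart j).target) l α (f ∘ collarCoord c (D.xchart j)) g),
    eLpNorm (fun z => ((z.1 ^ (((n : ℝ) + 1) / 2 - γ) : ℝ) : ℂ) * g z * (D.cutoff z.1 : ℂ))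
      (ENNReal.ofReal p)
      ((volume.restrict (Ioo 0 1 ×ˢ (D.xchart j '' D.xpiece j))).withDensity
        fun z => ENNReal.ofReal z.1⁻¹)

/-- The norm of a function in `H^{k,γ}_p(B)`, `k ∈ ℕ`; it is infinite if `f` is not in the space. -/
def funNorm {c : Collar n B X} (D : NormData c) (k : ℕ) (γ p : ℝ) (f : B → ℂ) : ℝ≥0∞ :=
  ⨅ _ : SobolevLoc n k p f,
    (∑ i, ∑ α ∈ multiIdx (n + 1) k, interiorTerm D p f i α) +
      ∑ j, ∑ l ∈ Finset.range (k + 1), ∑ α ∈ multiIdx n (k - l), collarTerm D γ p f j l α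

/-- The generalised function `u` is given by the function `f`, with respect to the measure `m`. -/
def IsGivenBy [MeasurableSpace B] (m : Measure B) (u : GenFun n B) (f : B → ℂ) : Prop :=
  ∀ φ : testFun n B, u φ = ∫ y, f y * (φ : B → ℂ) y ∂m

/-- The norm of `H^{k,γ}_p(B)` for integers `k`.  For `k < 0` it is the dual of
`H^{-k,-γ}_{p'}(B)`, `1/p + 1/p' = 1`, in which the test functions are dense. -/
def intNorm [MeasurableSpace B] {c : Collar n B X} (m : Measure B) (D : NormData c) :
    ℤ → ℝ → ℝ → GenFun n B → ℝ≥0∞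
  | .ofNat k, γ, p, u => ⨅ (f : B → ℂ) (_ : IsGivenBy m u f), funNorm D k γ p f
  | .negSucc k, γ, p, u =>
      ⨆ (φ : testFun n B) (_ : funNorm D (k + 1) (-γ) p.conjExponent φ ≤ 1), ‖u φ‖ₑ

/-- The norm of `H^{s,γ}_p(B)` for real `s`: by complex interpolation between the neighbouring
integers, `H^{k+θ,γ}_p = [H^{k,γ}_p, H^{k+1,γ}_p]_θ` for `0 < θ < 1`. -/
def sobNorm [MeasurableSpace B] {c : Collar n B X} (m : Measure B) (D : NormData c) (s γ p : ℝ)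
    (u : GenFun n B) : ℝ≥0∞ :=
  open scoped Classical in
  if Int.fract s = 0 then intNorm m D ⌊s⌋ γ p u
  else interpNorm (intNorm m D ⌊s⌋ γ p) (intNorm m D (⌊s⌋ + 1) γ p) (Int.fract s) u

/-- The cone Sobolev space `H^{s,γ}_p(B)`. -/
def coneSobolev [MeasurableSpace B] {c : Collar n B X} (m : Measure B) (D : NormData c)
    (s γ p : ℝ) : Set (GenFun n B) :=
  {u | sobNorm m D s γ p u < ⊤}

end Manifold

end

set_option linter.unusedSectionVars false

noncomputable section

/-! The two kinds of coordinates are handled together. The fields ∂_i with density 1 in an interior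
chart, and t∂_t, ∂_{x_i} with density 1/t in the collar, commute and are antisymmetric for their
density (`Frame`, `Patch`). The cone norms are weighted L^p-norms of weak derivatives along these
fields, and a cone operator is a polynomial in them whose coefficients in the collar are t^{-μ}
times functions smooth up to t = 0.

Call a collar coefficient c admissible of weight w if t^w c is smooth up to t = 0. This class is
stable under the fields (`ConeAdm.X`), and multiplication by c turns the weight γ + w into γ
(`exists_bound_col`). With the Leibniz rule for weak derivatives (`exists_comb_hasW`), an operator
of order μ and weight w is estimated from H^{k+μ,γ+w}_p to H^{k,γ}_p for k ≥ 0
(`exists_funNorm_le_of_actsAs`). This concerns functions; that the functional u ∘ Aᵗ is given by the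
function formed from the weak derivatives of f is shown in a patch by `integral_mul_transpose` and
globally, by gluing, in `exists_apply`.

For k + μ < 0 the same estimate is applied to the transpose on test functions and dualised. For k <
0 = k + μ one also needs that H^{0,γ}_p and H^{0,-γ}_{p'} are paired continuously, which is Hölder's
inequality. Neither argument covers k < 0 < k + μ, but for μ ≤ 1 this range is empty
(`isBddOp_of_isLocOp`).

Higher order is therefore reached by factorisation. By a partition of unity A is a finite sum of
operators χA, and each χA is a sum of terms b ∘ P, with b a multiplication operator and P a product
of at most μ cut-off vector fields, so that boundedness follows by composing through the
intermediate spaces. The multiplications carry the whole weight t^{-μ}; every field costs one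
derivative and no weight. A multiplication is its own transpose. The transpose of a cut-off field is
minus the field minus multiplication by a divergence term, which is smooth up to the boundary
because the density contributes the factor t^{n+1}, an eigenfunction of every field
(`hasBdd_fieldOp_col`). The transpose of A is thus constructed along with the bounds, and one
operator serves all p, s, γ.

Since μ is an integer, s and s + μ have the same fractional part, and non-integer s follows from the
bounds at ⌊s⌋ and ⌊s⌋ + 1 by the interpolation property of the complex method (`interpNorm_map_le`).
-/

theorem two_le_infty : (2 : WithTop ℕ∞) ≤ ((⊤ : ℕ∞) : WithTop ℕ∞) :=
  WithTop.coe_le_coe.2 (le_top : (2 : ℕ∞) ≤ ⊤)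

/-! ### Smooth functions on an open set and test functions -/

theorem MeasureTheory.LocallyIntegrableOn.integrable_mul_test {E : Type*} [TopologicalSpace E]
    [T2Space E] [MeasurableSpace E] [BorelSpace E] {ν : Measure E} {Ω : Set E} {f η : E → ℂ} (hf : LocallyIntegrableOn f Ω ν)
    (hc : Continuous η) (hη : HasCompactSupport η) (hs : tsupport η ⊆ Ω) :
    Integrable (fun z => f z * η z) ν := by
  have h1 : IntegrableOn f (tsupport η) ν := hf.integrableOn_compact_subset hs hη
  have h2 : IntegrableOn (fun z => f z * η z) (tsupport η) ν :=
    h1.mul_continuousOn hc.continuousOn hη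
  refine (integrableOn_iff_integrable_of_support_subset ?_).1 h2
  intro z hz
  by_contra h
  exact hz (by simp [image_eq_zero_of_notMem_tsupport h])

section Smooth

variable {E : Type*} [NormedAddCommGroup E]

variable [NormedSpace ℝ E]

/-- Smooth compactly supported functions with support in `Ω`. -/
structure IsTest (Ω : Set E) (η : E → ℂ) : Prop where
  smooth : ContDiff ℝ ∞ η
  compact : HasCompactSupport η
  support : tsupport η ⊆ Ω

theorem IsTest.zero (Ω : Set E) : IsTest Ω (0 : E → ℂ) :=
  ⟨contDiff_const, HasCompactSupport.zero, by
    rw [tsupport_eq_empty_iff.2 rfl]; exact empty_subset _⟩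

theorem IsTest.add {Ω : Set E} {η ξ : E → ℂ} (h : IsTest Ω η) (h' : IsTest Ω ξ) :
    IsTest Ω (fun z => η z + ξ z) :=
  ⟨h.smooth.add h'.smooth, h.compact.add h'.compact,
    (tsupport_add η ξ).trans (union_subset h.support h'.support)⟩

theorem contDiff_of_contDiffOn_of_tsupport {Ω : Set E} (hΩ : IsOpen Ω) {f : E → ℂ}
    (hf : ContDiffOn ℝ ∞ f Ω) (hs : tsupport f ⊆ Ω) : ContDiff ℝ ∞ f := by
  rw [contDiff_iff_contDiffAt]
  intro z
  by_cases hz : z ∈ tsupport f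
  · exact hf.contDiffAt (hΩ.mem_nhds (hs hz))
  · have : f =ᶠ[𝓝 z] fun _ => 0 := by
      filter_upwards [(isClosed_tsupport f).isOpen_compl.mem_nhds hz] with y hy
      exact image_eq_zero_of_notMem_tsupport hy
    exact contDiffAt_const.congr_of_eventuallyEq this

theorem IsTest.mul_left {Ω : Set E} (hΩ : IsOpen Ω) {a η : E → ℂ} (ha : ContDiffOn ℝ ∞ a Ω)
    (h : IsTest Ω η) : IsTest Ω (fun z => a z * η z) := by
  have hs : tsupport (fun z => a z * η z) ⊆ tsupport η := tsupport_mul_subset_right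
  exact ⟨contDiff_of_contDiffOn_of_tsupport hΩ (ha.mul h.smooth.contDiffOn) (hs.trans h.support),
    h.compact.mul_left, hs.trans h.support⟩

theorem IsTest.const_mul {Ω : Set E} {η : E → ℂ} (a : ℂ) (h : IsTest Ω η) :
    IsTest Ω (fun z => a * η z) :=
  ⟨contDiff_const.mul h.smooth, h.compact.mul_left, tsupport_mul_subset_right.trans h.support⟩

end Smooth

/-! ### Frames of commuting vector fields -/

/-- Commuting vector fields `wt i • ∂_{vec i}` on an open subset of a vector space, which are
antisymmetric with respect to the density `q`. -/
structure Frame (E ι : Type*) [NormedAddCommGroup E] [NormedSpace ℝ E] where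
  dom : Set E
  isOpen_dom : IsOpen dom
  vec : ι → E
  wt : ι → E → ℂ
  q : E → ℂ
  idx : List ι
  idx_nodup : idx.Nodup
  idx_mem : ∀ i, i ∈ idx
  wt_smooth : ∀ i, ContDiff ℝ ∞ (wt i)
  q_smooth : ContDiffOn ℝ ∞ q dom
  q_ne : ∀ z ∈ dom, q z ≠ 0
  -- The coefficient of one field is constant in the direction of any other, so the fields commute.
  -- The case i = j is excluded because t∂_t does differentiate its own coefficient t.
  wt_comm : ∀ i j z, i ≠ j → fderiv ℝ (wt j) z (vec i) = 0
  div_free : ∀ i, ∀ z ∈ dom, fderiv ℝ (fun y => wt i y * q y) z (vec i) = 0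

namespace Frame

variable {E ι : Type*} [NormedAddCommGroup E] [NormedSpace ℝ E]
  (P : Frame E ι)

/-- The derivative along the `i`-th vector field. -/
def X (i : ι) (f : E → ℂ) : E → ℂ := fun z => P.wt i z * fderiv ℝ f z (P.vec i)

/-- The iterated derivatives along a list of fields. -/
def DL (l : List ι) (m : ι → ℕ) (f : E → ℂ) : E → ℂ :=
  l.foldr (fun i h => (P.X i)^[m i] h) f

/-- The iterated derivatives with respect to a multi-index. -/
def D (m : ι → ℕ) (f : E → ℂ) : E → ℂ := P.DL P.idx m f

variable {P}

theorem X_smooth (i : ι) {f : E → ℂ} (hf : ContDiffOn ℝ ∞ f P.dom) :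
    ContDiffOn ℝ ∞ (P.X i f) P.dom :=
  (P.wt_smooth i).contDiffOn.mul
    ((hf.fderiv_of_isOpen P.isOpen_dom (by simp)).clm_apply contDiffOn_const)

theorem X_congr (i : ι) {f g : E → ℂ} {U : Set E} (hU : IsOpen U) (h : EqOn f g U) :
    EqOn (P.X i f) (P.X i g) U := by
  intro z hz
  have : f =ᶠ[𝓝 z] g := h.eventuallyEq_of_mem (hU.mem_nhds hz)
  simp only [X, this.fderiv_eq]

theorem X_iter_smooth (i : ι) (k : ℕ) {f : E → ℂ} (hf : ContDiffOn ℝ ∞ f P.dom) :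
    ContDiffOn ℝ ∞ ((P.X i)^[k] f) P.dom := by
  induction k with
  | zero => exact hf
  | succ k ih => rw [Function.iterate_succ_apply']; exact X_smooth i ih

theorem X_iter_congr (i : ι) (k : ℕ) {f g : E → ℂ} {U : Set E} (hU : IsOpen U) (h : EqOn f g U) :
    EqOn ((P.X i)^[k] f) ((P.X i)^[k] g) U := by
  induction k with
  | zero => exact h
  | succ k ih => rw [Function.iterate_succ_apply', Function.iterate_succ_apply']
                 exact X_congr i hU ih

theorem DL_smooth (l : List ι) (m : ι → ℕ) {f : E → ℂ} (hf : ContDiffOn ℝ ∞ f P.dom) :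
    ContDiffOn ℝ ∞ (P.DL l m f) P.dom := by
  induction l with
  | nil => exact hf
  | cons i l ih => exact X_iter_smooth i _ ih

theorem DL_congr (l : List ι) (m : ι → ℕ) {f g : E → ℂ} {U : Set E} (hU : IsOpen U)
    (h : EqOn f g U) : EqOn (P.DL l m f) (P.DL l m g) U := by
  induction l with
  | nil => exact h
  | cons i l ih => exact X_iter_congr i _ hU ih

theorem D_smooth (m : ι → ℕ) {f : E → ℂ} (hf : ContDiffOn ℝ ∞ f P.dom) :
    ContDiffOn ℝ ∞ (P.D m f) P.dom := DL_smooth _ _ hf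

theorem D_congr (m : ι → ℕ) {f g : E → ℂ} {U : Set E} (hU : IsOpen U) (h : EqOn f g U) :
    EqOn (P.D m f) (P.D m g) U := DL_congr _ _ hU h

theorem D_zero (f : E → ℂ) : P.D 0 f = f := by
  unfold D
  induction P.idx with
  | nil => rfl
  | cons i l ih => exact ih

/-- By `wt_comm` no first-order terms arise for i ≠ j, and the second derivative of a smooth
function is symmetric. -/
theorem X_comm (i j : ι) {f : E → ℂ} (hf : ContDiffOn ℝ ∞ f P.dom) :
    EqOn (P.X i (P.X j f)) (P.X j (P.X i f)) P.dom := by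
  by_cases hij : i = j
  · subst hij; intro z _; rfl
  intro z hz
  have hfd : ContDiffAt ℝ ∞ f z := hf.contDiffAt (P.isOpen_dom.mem_nhds hz)
  have h2 : DifferentiableAt ℝ (fderiv ℝ f) z :=
    (hfd.fderiv_right (m := 1) (by norm_num; first | done | exact two_le_infty)).differentiableAt (by simp)
  have key : ∀ a b : ι, a ≠ b → P.X a (P.X b f) z =
      P.wt a z * (P.wt b z * fderiv ℝ (fderiv ℝ f) z (P.vec a) (P.vec b)) := by
    intro a b hab
    have hw : DifferentiableAt ℝ (P.wt b) z := (P.wt_smooth b).differentiable (by simp) z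
    have hg : DifferentiableAt ℝ (fun y => fderiv ℝ f y (P.vec b)) z :=
      h2.clm_apply (differentiableAt_const _)
    change P.wt a z * fderiv ℝ (fun y => P.wt b y * fderiv ℝ f y (P.vec b)) z (P.vec a) = _
    rw [fderiv_fun_mul hw hg, fderiv_clm_apply h2 (differentiableAt_const _)]
    simp [P.wt_comm a b z hab]
  rw [key i j hij, key j i (Ne.symm hij)]
  have hs : IsSymmSndFDerivAt ℝ f z := hfd.isSymmSndFDerivAt (by simpa using two_le_infty)
  rw [hs.eq]
  ring

theorem X_iter_comm (i j : ι) (k : ℕ) {f : E → ℂ} (hf : ContDiffOn ℝ ∞ f P.dom) :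
    EqOn ((P.X i)^[k] (P.X j f)) (P.X j ((P.X i)^[k] f)) P.dom := by
  induction k with
  | zero => intro z _; rfl
  | succ k ih =>
    rw [Function.iterate_succ_apply', Function.iterate_succ_apply']
    exact (X_congr i P.isOpen_dom ih).trans (X_comm i j (X_iter_smooth i k hf))

theorem DL_comm (l : List ι) (m : ι → ℕ) (j : ι) {f : E → ℂ} (hf : ContDiffOn ℝ ∞ f P.dom) :
    EqOn (P.DL l m (P.X j f)) (P.X j (P.DL l m f)) P.dom := by
  induction l with
  | nil => intro z _; rfl
  | cons i l ih =>
    exact (X_iter_congr i _ P.isOpen_dom ih).trans (X_iter_comm i j _ (DL_smooth l m hf))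

theorem D_comm (m : ι → ℕ) (j : ι) {f : E → ℂ} (hf : ContDiffOn ℝ ∞ f P.dom) :
    EqOn (P.D m (P.X j f)) (P.X j (P.D m f)) P.dom := DL_comm _ _ _ hf

section DecEq

variable [DecidableEq ι]

theorem DL_succ_of_notMem (l : List ι) (m : ι → ℕ) (j : ι) (hj : j ∉ l) (f : E → ℂ) :
    P.DL l (m + Pi.single j 1) f = P.DL l m f := by
  induction l with
  | nil => rfl
  | cons i l ih =>
    simp only [List.mem_cons, not_or] at hj
    have hij : i ≠ j := fun h => hj.1 h.symm
    change (P.X i)^[(m + Pi.single j 1 : ι → ℕ) i] (P.DL l (m + Pi.single j 1) f) =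
      (P.X i)^[m i] (P.DL l m f)
    rw [ih hj.2]
    simp [hij]

/-- The list fixes the order in which the fields are applied. The additional field is created at the
only place where j occurs and is then commuted to the outside. -/
theorem DL_succ (l : List ι) (hl : l.Nodup) (m : ι → ℕ) (j : ι) (hj : j ∈ l) {f : E → ℂ}
    (hf : ContDiffOn ℝ ∞ f P.dom) :
    EqOn (P.DL l (m + Pi.single j 1) f) (P.X j (P.DL l m f)) P.dom := by
  induction l with
  | nil => simp at hj
  | cons i l ih =>
    rw [List.nodup_cons] at hl
    change EqOn ((P.X i)^[(m + Pi.single j 1 : ι → ℕ) i] (P.DL l (m + Pi.single j 1) f))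
      (P.X j ((P.X i)^[m i] (P.DL l m f))) P.dom
    by_cases hij : i = j
    · subst hij
      rw [DL_succ_of_notMem l m i hl.1]
      have : (m + Pi.single i 1 : ι → ℕ) i = m i + 1 := by simp
      rw [this, Function.iterate_succ_apply']
      exact fun _ _ => rfl
    · have hj' : j ∈ l := by simpa [Ne.symm hij] using hj
      have : (m + Pi.single j 1 : ι → ℕ) i = m i := by simp [hij]
      rw [this]
      exact (X_iter_congr i _ P.isOpen_dom (ih hl.2 hj')).trans
        (X_iter_comm i j _ (DL_smooth l m hf))

theorem D_succ (m : ι → ℕ) (j : ι) {f : E → ℂ} (hf : ContDiffOn ℝ ∞ f P.dom) :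
    EqOn (P.D (m + Pi.single j 1) f) (P.X j (P.D m f)) P.dom :=
  DL_succ _ P.idx_nodup m j (P.idx_mem j) hf

end DecEq

theorem X_support (i : ι) (f : E → ℂ) : tsupport (P.X i f) ⊆ tsupport f := by
  refine closure_minimal ?_ (isClosed_tsupport f)
  intro z hz
  by_contra h
  apply hz
  have : f =ᶠ[𝓝 z] fun _ => 0 := by
    filter_upwards [(isClosed_tsupport f).isOpen_compl.mem_nhds h] with y hy
    exact image_eq_zero_of_notMem_tsupport hy
  simp [X, this.fderiv_eq]

theorem X_mul (i : ι) {f g : E → ℂ} (hf : ContDiffOn ℝ ∞ f P.dom) (hg : ContDiffOn ℝ ∞ g P.dom)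
    {z : E} (hz : z ∈ P.dom) :
    P.X i (fun y => f y * g y) z = P.X i f z * g z + f z * P.X i g z := by
  have h1 := (hf.contDiffAt (P.isOpen_dom.mem_nhds hz)).differentiableAt (by simp)
  have h2 := (hg.contDiffAt (P.isOpen_dom.mem_nhds hz)).differentiableAt (by simp)
  simp only [X, fderiv_fun_mul h1 h2]
  simp
  ring

theorem X_iter_support (i : ι) (k : ℕ) (f : E → ℂ) : tsupport ((P.X i)^[k] f) ⊆ tsupport f := by
  induction k with
  | zero => exact subset_rfl
  | succ k ih => rw [Function.iterate_succ_apply']; exact (X_support i _).trans ih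

theorem D_support (m : ι → ℕ) (f : E → ℂ) : tsupport (P.D m f) ⊆ tsupport f := by
  unfold D
  induction P.idx with
  | nil => exact subset_rfl
  | cons i l ih => exact (X_iter_support i _ _).trans ih

theorem D_test (m : ι → ℕ) {η : E → ℂ} (hη : IsTest P.dom η) : IsTest P.dom (P.D m η) := by
  have hs := D_support (P := P) m η
  exact ⟨contDiff_of_contDiffOn_of_tsupport P.isOpen_dom (D_smooth m hη.smooth.contDiffOn)
    (hs.trans hη.support), hη.compact.mono' (subset_closure.trans hs), hs.trans hη.support⟩

theorem X_test (i : ι) {η : E → ℂ} (hη : IsTest P.dom η) : IsTest P.dom (P.X i η) := by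
  have hs := X_support (P := P) i η
  exact ⟨contDiff_of_contDiffOn_of_tsupport P.isOpen_dom (X_smooth i hη.smooth.contDiffOn)
    (hs.trans hη.support), hη.compact.mono' (subset_closure.trans hs), hs.trans hη.support⟩

end Frame

theorem IsTest.eq_zero {E : Type*} [NormedAddCommGroup E] [NormedSpace ℝ E] {Ω : Set E}
    {η : E → ℂ} (h : IsTest Ω η) {z : E} (hz : z ∉ Ω) : η z = 0 :=
  image_eq_zero_of_notMem_tsupport fun hh => hz (h.support hh)

/-! ### Weak derivatives -/

theorem IsTest.integrable {E : Type*} [NormedAddCommGroup E] [NormedSpace ℝ E] [MeasureSpace E]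
    [BorelSpace E] [IsFiniteMeasureOnCompacts (volume : Measure E)] {Ω : Set E} {η : E → ℂ}
    (h : IsTest Ω η) : Integrable η :=
  h.smooth.continuous.integrable_of_hasCompactSupport h.compact

namespace Frame

variable {E ι : Type*} [NormedAddCommGroup E] [NormedSpace ℝ E] [FiniteDimensional ℝ E]
  [MeasureSpace E] [BorelSpace E] [(volume : Measure E).IsAddHaarMeasure]
  {P : Frame E ι}

/-- Integration by parts for F = f · wt · q. Because wt · q has zero derivative in the direction of
the field, only the derivative falling on f remains. -/
theorem integral_mul_X (i : ι) {f η : E → ℂ} (hf : ContDiffOn ℝ ∞ f P.dom)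
    (hη : IsTest P.dom η) :
    ∫ z, f z * P.X i η z * P.q z = - ∫ z, P.X i f z * η z * P.q z := by
  set F : E → ℂ := fun z => f z * (P.wt i z * P.q z) with hF
  have hwq : ContDiffOn ℝ ∞ (fun z => P.wt i z * P.q z) P.dom :=
    (P.wt_smooth i).contDiffOn.mul P.q_smooth
  have hFs : ContDiffOn ℝ ∞ F P.dom := hf.mul hwq
  have hFd : ∀ z ∈ P.dom, fderiv ℝ F z (P.vec i) =
      fderiv ℝ f z (P.vec i) * (P.wt i z * P.q z) := by
    intro z hz
    have h1 := (hf.contDiffAt (P.isOpen_dom.mem_nhds hz)).differentiableAt (by simp)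
    have h2 := (hwq.contDiffAt (P.isOpen_dom.mem_nhds hz)).differentiableAt (by simp)
    rw [hF, fderiv_fun_mul h1 h2]
    simp only [_root_.add_apply, _root_.smul_apply, P.div_free i z hz]
    simp
    ring
  have hη' : ContDiff ℝ ∞ (fun z => fderiv ℝ η z (P.vec i)) :=
    (hη.smooth.fderiv_right (m := ∞) (by simp)).clm_apply contDiff_const
  have hs : tsupport (fun z => fderiv ℝ η z (P.vec i)) ⊆ tsupport η :=
    tsupport_fderiv_apply_subset ℝ (P.vec i)
  have t1 : IsTest P.dom (fun z => fderiv ℝ η z (P.vec i)) :=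
    ⟨hη', hη.compact.mono' (subset_closure.trans hs), hs.trans hη.support⟩
  have key := integral_mul_fderiv_eq_neg_fderiv_mul_of_integrable (μ := (volume : Measure E))
    (f := F) (g := η) (v := P.vec i)
    (hη.mul_left P.isOpen_dom (hFs.fderiv_of_isOpen P.isOpen_dom (m := ∞) (by simp)
      |>.clm_apply contDiffOn_const)).integrable
    (t1.mul_left P.isOpen_dom hFs).integrable (hη.mul_left P.isOpen_dom hFs).integrable
    (fun z hz => (hFs.contDiffAt (P.isOpen_dom.mem_nhds (hη.support hz))).differentiableAt
      (by simp)) (fun z _ => hη.smooth.differentiable (by simp) z)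
  have e1 : (fun z => f z * P.X i η z * P.q z) = fun z => F z * fderiv ℝ η z (P.vec i) := by
    funext z; simp only [hF, X]; ring
  have e2 : (fun z => P.X i f z * η z * P.q z) = fun z => fderiv ℝ F z (P.vec i) * η z := by
    funext z
    by_cases hz : z ∈ P.dom
    · rw [hFd z hz]; simp only [X]; ring
    · simp [hη.eq_zero hz]
  rw [e1, e2, key]

variable [Fintype ι]

variable (P) in
/-- `g` is the weak derivative `D^m f`. -/
def HasW (m : ι → ℕ) (f g : E → ℂ) : Prop :=
  LocallyIntegrableOn f P.dom ∧ LocallyIntegrableOn g P.dom ∧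
    ∀ η, IsTest P.dom η →
      ∫ z, f z * P.D m η z * P.q z = (-1) ^ (∑ i, m i) * ∫ z, g z * η z * P.q z

theorem integrable_mul_mul_q {f η : E → ℂ} (hf : LocallyIntegrableOn f P.dom)
    (hη : IsTest P.dom η) : Integrable (fun z => f z * η z * P.q z) := by
  have t := hη.mul_left P.isOpen_dom P.q_smooth
  have := hf.integrable_mul_test t.smooth.continuous t.compact t.support
  refine this.congr (ae_of_all _ fun z => ?_)
  simp only; ring

theorem _root_.ContDiffOn.mul_locallyIntegrableOn {Ω : Set E} (hΩ : IsOpen Ω) {c g : E → ℂ}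
    (hc : ContDiffOn ℝ ∞ c Ω) (hg : LocallyIntegrableOn g Ω) :
    LocallyIntegrableOn (fun z => c z * g z) Ω :=
  hg.continuousOn_mul hc.continuousOn hΩ.isLocallyClosed

/-- Splits off one derivative; this drives all inductions on the order. -/
theorem exists_eq_add_single [DecidableEq ι] {m : ι → ℕ} {N : ℕ} (h : ∑ i, m i = N + 1) :
    ∃ (i : ι) (m' : ι → ℕ), m = m' + Pi.single i 1 ∧ ∑ i, m' i = N := by
  obtain ⟨i, -, hi⟩ : ∃ i ∈ Finset.univ, m i ≠ 0 := by
    by_contra! hh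
    rw [Finset.sum_eq_zero hh] at h
    omega
  have hm : m = (m - Pi.single i 1) + Pi.single i 1 := by
    funext j
    by_cases hj : j = i
    · subst hj; simp; omega
    · simp [hj]
  refine ⟨i, m - Pi.single i 1, hm, ?_⟩
  have : ∑ j, m j = ∑ j, ((m - Pi.single i 1 : ι → ℕ) j + (Pi.single i 1 : ι → ℕ) j) := by
    conv_lhs => rw [hm]
    rfl
  rw [Finset.sum_add_distrib, Finset.sum_pi_single'] at this
  simp at this
  simp only [Pi.sub_apply]
  omega

theorem sum_add_single [DecidableEq ι] (m : ι → ℕ) (i : ι) :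
    ∑ j, (m + Pi.single i 1 : ι → ℕ) j = ∑ j, m j + 1 := by
  simp [Finset.sum_add_distrib]

/-- For a test function both sides vanish off the domain, so the identity holds everywhere and can
be rewritten under an integral. -/
theorem D_succ_test [DecidableEq ι] (m : ι → ℕ) (j : ι) {η : E → ℂ} (hη : IsTest P.dom η) :
    P.D (m + Pi.single j 1) η = P.X j (P.D m η) := by
  funext z
  by_cases hz : z ∈ P.dom
  · exact D_succ m j hη.smooth.contDiffOn hz
  · rw [(D_test _ hη).eq_zero hz, (X_test j (D_test _ hη)).eq_zero hz]

theorem D_succ_test' [DecidableEq ι] (m : ι → ℕ) (j : ι) {η : E → ℂ} (hη : IsTest P.dom η) :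
    P.D (m + Pi.single j 1) η = P.D m (P.X j η) := by
  funext z
  by_cases hz : z ∈ P.dom
  · rw [D_succ m j hη.smooth.contDiffOn hz, D_comm m j hη.smooth.contDiffOn hz]
  · rw [(D_test _ hη).eq_zero hz, (D_test _ (X_test j hη)).eq_zero hz]

/-- Classical derivatives are weak derivatives. -/
theorem hasW_of_smooth (m : ι → ℕ) {f : E → ℂ} (hf : ContDiffOn ℝ ∞ f P.dom) :
    P.HasW m f (P.D m f) := by
  classical
  have li : ∀ {h : E → ℂ}, ContDiffOn ℝ ∞ h P.dom → LocallyIntegrableOn h P.dom := fun hh =>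
    hh.continuousOn.locallyIntegrableOn P.isOpen_dom.measurableSet
  obtain ⟨N, hN⟩ : ∃ N, ∑ i, m i = N := ⟨_, rfl⟩
  refine ⟨li hf, li (D_smooth m hf), fun η hη => ?_⟩
  rw [hN]
  induction N generalizing m f with
  | zero =>
    have : m = 0 := by
      funext i
      have := (Finset.sum_eq_zero_iff.1 hN) i (Finset.mem_univ i)
      simpa using this
    subst this
    simp [D_zero]
  | succ N ih =>
    obtain ⟨i, m', rfl, hm'⟩ := exists_eq_add_single hN
    rw [D_succ_test m' i hη, integral_mul_X i hf (D_test m' hη), ih m' (X_smooth i hf) hm', pow_succ]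
    have : ∀ z, P.D m' (P.X i f) z * η z * P.q z
        = P.D (m' + Pi.single i 1) f z * η z * P.q z := by
      intro z
      by_cases hz : z ∈ P.dom
      · rw [D_succ m' i hf hz, D_comm m' i hf hz]
      · simp [hη.eq_zero hz]
    simp_rw [this]
    ring

/-- The fundamental lemma of the calculus of variations. Real test functions, regarded as complex
ones, already suffice. -/
theorem _root_.ae_eq_of_integral_test_eq {U : Set E} (hU : IsOpen U) {f g : E → ℂ}
    (hf : LocallyIntegrableOn f U) (hg : LocallyIntegrableOn g U)
    (h : ∀ η, IsTest U η → ∫ z, f z * η z = ∫ z, g z * η z) :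
    f =ᵐ[volume.restrict U] g := by
  have key := hU.ae_eq_zero_of_integral_contDiff_smul_eq_zero (μ := (volume : Measure E))
    (f := fun z => f z - g z) (hf.sub hg) ?_
  · rw [Filter.EventuallyEq, ae_restrict_iff' hU.measurableSet]
    filter_upwards [key] with z hz hzU
    exact sub_eq_zero.1 (hz hzU)
  · intro η h1 h2 h3
    have e : tsupport (fun z => (η z : ℂ)) = tsupport η := by
      simp [tsupport, Function.support]
    have ht : IsTest U (fun z => (η z : ℂ)) :=
      ⟨Complex.ofRealCLM.contDiff.comp h1, h2.comp_left (g := fun x : ℝ => (x : ℂ)) (by simp),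
        e ▸ h3⟩
    have := h _ ht
    rw [← sub_eq_zero, ← integral_sub
      (hf.integrable_mul_test ht.smooth.continuous ht.compact ht.support)
      (hg.integrable_mul_test ht.smooth.continuous ht.compact ht.support)] at this
    rw [← this]
    congr 1
    funext z
    simp only [Complex.real_smul]
    ring

/-- Testing against η / q instead of η removes the density and leaves the fundamental lemma for
Lebesgue measure. -/
theorem HasW.unique {m : ι → ℕ} {f g g' : E → ℂ} (h : P.HasW m f g) (h' : P.HasW m f g') :
    g =ᵐ[volume.restrict P.dom] g' := by
  refine ae_eq_of_integral_test_eq P.isOpen_dom h.2.1 h'.2.1 fun η hη => ?_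
  have t : IsTest P.dom (fun z => (P.q z)⁻¹ * η z) :=
    hη.mul_left P.isOpen_dom (P.q_smooth.inv P.q_ne)
  have h1 := (h.2.2 _ t).symm.trans (h'.2.2 _ t)
  have h2 := mul_left_cancel₀ (pow_ne_zero _ (by norm_num)) h1
  have e : ∀ f : E → ℂ, (fun z => f z * ((P.q z)⁻¹ * η z) * P.q z) = fun z => f z * η z := by
    intro f
    funext z
    by_cases hz : z ∈ P.dom
    · field_simp [P.q_ne z hz]
    · simp [hη.eq_zero hz]
  rwa [e, e] at h2

theorem _root_.MeasureTheory.LocallyIntegrableOn.congr_restrict {U : Set E} (hU : IsOpen U) {f g : E → ℂ}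
    (hf : LocallyIntegrableOn f U) (h : f =ᵐ[volume.restrict U] g) : LocallyIntegrableOn g U := by
  rw [locallyIntegrableOn_iff hU.isLocallyClosed] at hf ⊢
  intro k hk hkc
  exact (hf k hk hkc).congr (h.filter_mono (ae_mono (Measure.restrict_mono_set _ hk)))

theorem integral_congr_test {f f' η : E → ℂ} {U : Set E} (hU : IsOpen U)
    (h : f =ᵐ[volume.restrict U] f') (hη : ∀ z, z ∉ U → η z = 0) :
    ∫ z, f z * η z = ∫ z, f' z * η z := by
  refine integral_congr_ae ?_
  rw [Filter.EventuallyEq, ae_restrict_iff' hU.measurableSet] at h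
  filter_upwards [h] with z hz
  by_cases hzU : z ∈ U
  · rw [hz hzU]
  · simp [hη z hzU]

theorem HasW.congr {m : ι → ℕ} {f f' g g' : E → ℂ} (h : P.HasW m f g)
    (hf : f =ᵐ[volume.restrict P.dom] f') (hg : g =ᵐ[volume.restrict P.dom] g') :
    P.HasW m f' g' := by
  refine ⟨h.1.congr_restrict P.isOpen_dom hf, h.2.1.congr_restrict P.isOpen_dom hg,
    fun η hη => ?_⟩
  have := h.2.2 η hη
  simp only [mul_assoc] at this ⊢
  rwa [integral_congr_test P.isOpen_dom hf fun z hz => by simp [(D_test m hη).eq_zero hz],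
    integral_congr_test P.isOpen_dom hg fun z hz => by simp [hη.eq_zero hz]] at this

/-! ### Combinations of weak derivatives with smooth coefficients -/

/-- The combination `∑ c g_m` over a list of pairs `(c, m)`. -/
def comb (L : List ((E → ℂ) × (ι → ℕ))) (g : (ι → ℕ) → E → ℂ) : E → ℂ :=
  fun z => (L.map fun x => x.1 z * g x.2 z).sum

theorem comb_cons (x : (E → ℂ) × (ι → ℕ)) (L : List ((E → ℂ) × (ι → ℕ)))
    (g : (ι → ℕ) → E → ℂ) : comb (x :: L) g = fun z => x.1 z * g x.2 z + comb L g z := rfl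

variable (P) in
/-- The family `g` consists of the weak derivatives of `f` of order at most `K`. -/
def IsFam (K : ℕ) (f : E → ℂ) (g : (ι → ℕ) → E → ℂ) : Prop :=
  ∀ m, ∑ i, m i ≤ K → P.HasW m f (g m)

theorem comb_locallyIntegrableOn {L : List ((E → ℂ) × (ι → ℕ))} {K : ℕ} {f : E → ℂ}
    {g : (ι → ℕ) → E → ℂ} (hg : P.IsFam K f g)
    (hL : ∀ x ∈ L, ContDiffOn ℝ ∞ x.1 P.dom ∧ ∑ i, x.2 i ≤ K) :
    LocallyIntegrableOn (comb L g) P.dom := by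
  induction L with
  | nil => exact locallyIntegrableOn_zero
  | cons x L ih =>
    rw [comb_cons]
    have hx := hL x (by simp)
    exact (hx.1.mul_locallyIntegrableOn P.isOpen_dom (hg _ hx.2).2.1).add
      (ih fun y hy => hL y (by simp [hy]))

section Step

variable [DecidableEq ι]

variable (P) in
/-- The effect of the `i`-th field on a combination of derivatives. -/
def stepList (i : ι) (L : List ((E → ℂ) × (ι → ℕ))) : List ((E → ℂ) × (ι → ℕ)) :=
  L.flatMap fun x => [(P.X i x.1, x.2), (x.1, x.2 + Pi.single i 1)]

/-- The Leibniz rule in weak form: the coefficient is moved onto the test function, where c · Xη =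
X(cη) − (Xc)η, and the two weak derivatives of f are compared by testing both with cη. -/
theorem integral_mul_X_of_hasW (i : ι) {m : ι → ℕ} {f g g' c η : E → ℂ} (h : P.HasW m f g)
    (h' : P.HasW (m + Pi.single i 1) f g') (hc : ContDiffOn ℝ ∞ c P.dom) (hη : IsTest P.dom η) :
    ∫ z, (c z * g z) * P.X i η z * P.q z =
      - ∫ z, (P.X i c z * g z + c z * g' z) * η z * P.q z := by
  have tc := hη.mul_left P.isOpen_dom hc
  have tX := hη.mul_left P.isOpen_dom (X_smooth i hc)
  have e1 := h.2.2 _ (X_test i tc)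
  have e2 := h'.2.2 _ tc
  rw [D_succ_test' m i tc, e1, sum_add_single, pow_succ] at e2
  have e3 : ∫ z, g z * P.X i (fun z => c z * η z) z * P.q z =
      - ∫ z, g' z * (c z * η z) * P.q z := by
    refine mul_left_cancel₀ (pow_ne_zero (∑ i, m i) (by norm_num : (-1 : ℂ) ≠ 0)) ?_
    rw [e2]; ring
  have e4 : (fun z => (c z * g z) * P.X i η z * P.q z) = fun z =>
      g z * P.X i (fun z => c z * η z) z * P.q z - g z * (P.X i c z * η z) * P.q z := by
    funext z
    by_cases hz : z ∈ P.dom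
    · rw [X_mul i hc hη.smooth.contDiffOn hz]; ring
    · simp [(X_test i tc).eq_zero hz, (X_test i hη).eq_zero hz, hη.eq_zero hz]
  rw [e4, integral_sub (integrable_mul_mul_q h.2.1 (X_test i tc))
    (integrable_mul_mul_q h.2.1 tX), e3, ← neg_add', ← integral_add
    (integrable_mul_mul_q h'.2.1 tc) (integrable_mul_mul_q h.2.1 tX)]
  congr 2
  funext z
  ring

theorem integral_comb_mul_X (i : ι) {L : List ((E → ℂ) × (ι → ℕ))} {K : ℕ} {f : E → ℂ}
    {g : (ι → ℕ) → E → ℂ} (hg : P.IsFam K f g)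
    (hL : ∀ x ∈ L, ContDiffOn ℝ ∞ x.1 P.dom ∧ ∑ i, x.2 i + 1 ≤ K) {η : E → ℂ}
    (hη : IsTest P.dom η) :
    ∫ z, comb L g z * P.X i η z * P.q z = - ∫ z, comb (P.stepList i L) g z * η z * P.q z := by
  induction L with
  | nil => simp [comb, stepList]
  | cons x L ih =>
    have hx := hL x (by simp)
    have hL' : ∀ y ∈ L, ContDiffOn ℝ ∞ y.1 P.dom ∧ ∑ i, y.2 i + 1 ≤ K :=
      fun y hy => hL y (by simp [hy])
    have hxw := hg x.2 (by omega)
    have hxw' := hg (x.2 + Pi.single i 1) (by rw [sum_add_single]; exact hx.2)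
    have l1 : LocallyIntegrableOn (comb L g) P.dom :=
      comb_locallyIntegrableOn hg fun y hy => ⟨(hL' y hy).1, by have := (hL' y hy).2; omega⟩
    have l2 : LocallyIntegrableOn (comb (P.stepList i L) g) P.dom := by
      refine comb_locallyIntegrableOn hg fun y hy => ?_
      simp only [stepList, List.mem_flatMap, List.mem_cons, List.not_mem_nil, or_false] at hy
      obtain ⟨y', hy', rfl | rfl⟩ := hy
      · exact ⟨X_smooth i (hL' y' hy').1, by have := (hL' y' hy').2; simp only; omega⟩
      · exact ⟨(hL' y' hy').1, by simp only [sum_add_single]; exact (hL' y' hy').2⟩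
    have e1 : (fun z => comb (x :: L) g z * P.X i η z * P.q z) = fun z =>
        (x.1 z * g x.2 z) * P.X i η z * P.q z + comb L g z * P.X i η z * P.q z := by
      funext z; rw [comb_cons]; ring
    have e2 : (fun z => comb (P.stepList i (x :: L)) g z * η z * P.q z) = fun z =>
        (P.X i x.1 z * g x.2 z + x.1 z * g (x.2 + Pi.single i 1) z) * η z * P.q z +
          comb (P.stepList i L) g z * η z * P.q z := by
      funext z
      have : P.stepList i (x :: L) =
        (P.X i x.1, x.2) :: (x.1, x.2 + Pi.single i 1) :: P.stepList i L := rfl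
      rw [this, comb_cons, comb_cons]; ring
    have lx := hx.1.mul_locallyIntegrableOn P.isOpen_dom hxw.2.1
    have lx' : LocallyIntegrableOn (fun z => P.X i x.1 z * g x.2 z +
        x.1 z * g (x.2 + Pi.single i 1) z) P.dom := ((X_smooth i hx.1).mul_locallyIntegrableOn P.isOpen_dom hxw.2.1).add
      (hx.1.mul_locallyIntegrableOn P.isOpen_dom hxw'.2.1)
    rw [e1, e2, integral_add (integrable_mul_mul_q lx (X_test i hη))
      (integrable_mul_mul_q l1 (X_test i hη)), ih hL',
      integral_add (integrable_mul_mul_q lx' hη) (integrable_mul_mul_q l2 hη),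
      integral_mul_X_of_hasW i hxw hxw' hx.1 hη]
    ring

end Step

/-- The weak derivatives of a combination of weak derivatives are such combinations. -/
theorem exists_comb_hasW {Adm : (E → ℂ) → Prop} (hsm : ∀ c, Adm c → ContDiffOn ℝ ∞ c P.dom)
    (hX : ∀ i c, Adm c → Adm (P.X i c)) (N : ℕ) (m : ι → ℕ) (hm : ∑ i, m i = N)
    (L : List ((E → ℂ) × (ι → ℕ))) (k : ℕ) (hL : ∀ x ∈ L, Adm x.1 ∧ ∑ i, x.2 i ≤ k) :
    ∃ L' : List ((E → ℂ) × (ι → ℕ)), (∀ x ∈ L', Adm x.1 ∧ ∑ i, x.2 i ≤ k + N) ∧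
      ∀ f g, P.IsFam (k + N) f g → P.HasW m (comb L g) (comb L' g) := by
  classical
  -- One field is integrated by parts onto the combination, which replaces `L` by its `stepList`;
  -- the remaining derivatives are handled by the induction hypothesis. The resulting list depends
  -- on `L` and `m` but not on `f`, and its coefficients stay in the class `Adm`, so later constants
  -- are uniform in `f`.
  induction N generalizing m L k with
  | zero =>
    have : m = 0 := by
      funext i
      have := (Finset.sum_eq_zero_iff.1 hm) i (Finset.mem_univ i)
      simpa using this
    subst this
    refine ⟨L, hL, fun f g hg => ?_⟩
    have := comb_locallyIntegrableOn hg fun x hx => ⟨hsm _ (hL x hx).1, (hL x hx).2⟩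
    exact ⟨this, this, fun η hη => by simp [D_zero]⟩
  | succ N ih =>
    obtain ⟨i, m', rfl, hm'⟩ := exists_eq_add_single hm
    obtain ⟨L', hL', h⟩ := ih m' hm' (P.stepList i L) (k + 1) (by
      intro y hy
      simp only [stepList, List.mem_flatMap, List.mem_cons, List.not_mem_nil, or_false] at hy
      obtain ⟨y', hy', rfl | rfl⟩ := hy
      · exact ⟨hX i _ (hL y' hy').1, by have := (hL y' hy').2; simp only; omega⟩
      · exact ⟨(hL y' hy').1, by simp only [sum_add_single]; have := (hL y' hy').2; omega⟩)
    refine ⟨L', fun x hx => ⟨(hL' x hx).1, by have := (hL' x hx).2; omega⟩, fun f g hg => ?_⟩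
    have hw := h f g (by rwa [show k + 1 + N = k + (N + 1) by ring])
    refine ⟨comb_locallyIntegrableOn hg fun x hx => ⟨hsm _ (hL x hx).1, ?_⟩, hw.2.1,
      fun η hη => ?_⟩
    · have := (hL x hx).2; omega
    rw [D_succ_test m' i hη, integral_comb_mul_X i hg (fun x hx => ⟨hsm _ (hL x hx).1, by
      have := (hL x hx).2; omega⟩) (D_test m' hη), hw.2.2 η hη, hm, hm', pow_succ]
    ring

variable (P) in
/-- The formal adjoint of the differential operator with coefficient list `L`. -/
def adjList (L : List ((E → ℂ) × (ι → ℕ))) (η : E → ℂ) : E → ℂ :=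
  fun z => (L.map fun x => (-1) ^ (∑ i, x.2 i) * P.D x.2 (fun y => x.1 y * η y) z).sum

theorem adjList_test {L : List ((E → ℂ) × (ι → ℕ))} (hL : ∀ x ∈ L, ContDiffOn ℝ ∞ x.1 P.dom)
    {η : E → ℂ} (hη : IsTest P.dom η) : IsTest P.dom (P.adjList L η) := by
  induction L with
  | nil => exact IsTest.zero _
  | cons x L ih =>
    exact ((D_test x.2 (hη.mul_left P.isOpen_dom (hL x (by simp)))).const_mul _).add
      (ih fun y hy => hL y (by simp [hy]))

/-- A summand c · g_m tested with η is g_m tested with cη, and the definition of the weak derivative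
moves D^m onto cη. -/
theorem integral_comb_mul {L : List ((E → ℂ) × (ι → ℕ))} {K : ℕ} {f : E → ℂ}
    {g : (ι → ℕ) → E → ℂ} (hg : P.IsFam K f g)
    (hL : ∀ x ∈ L, ContDiffOn ℝ ∞ x.1 P.dom ∧ ∑ i, x.2 i ≤ K) {η : E → ℂ}
    (hη : IsTest P.dom η) :
    ∫ z, comb L g z * η z * P.q z = ∫ z, f z * P.adjList L η z * P.q z := by
  induction L with
  | nil => simp [comb, adjList]
  | cons x L ih =>
    have hx := hL x (by simp)
    have hL' : ∀ y ∈ L, ContDiffOn ℝ ∞ y.1 P.dom ∧ ∑ i, y.2 i ≤ K :=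
      fun y hy => hL y (by simp [hy])
    have hw := hg x.2 hx.2
    have tx := hη.mul_left P.isOpen_dom hx.1
    have e1 : (fun z => comb (x :: L) g z * η z * P.q z) = fun z =>
        g x.2 z * (x.1 z * η z) * P.q z + comb L g z * η z * P.q z := by
      funext z; rw [comb_cons]; ring
    have e2 : (fun z => f z * P.adjList (x :: L) η z * P.q z) = fun z =>
        (-1) ^ (∑ i, x.2 i) * (f z * P.D x.2 (fun y => x.1 y * η y) z * P.q z) +
          f z * P.adjList L η z * P.q z := by
      funext z
      have : P.adjList (x :: L) η z =
        (-1) ^ (∑ i, x.2 i) * P.D x.2 (fun y => x.1 y * η y) z + P.adjList L η z := rfl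
      rw [this]; ring
    rw [e1, e2, integral_add (integrable_mul_mul_q hw.2.1 tx)
      (integrable_mul_mul_q (comb_locallyIntegrableOn hg hL') hη),
      integral_add ((integrable_mul_mul_q hw.1 (D_test _ tx)).const_mul _)
        (integrable_mul_mul_q hw.1 (adjList_test (fun y hy => (hL' y hy).1) hη)),
      ih hL', integral_const_mul, hw.2.2 _ tx, ← mul_assoc, ← mul_pow]
    simp

end Frame

/-! ### Coordinate patches in the interior -/

/-- A coordinate patch in the interior of `B` with a frame of vector fields. -/
structure Patch (n : ℕ) (B E ι : Type*) [TopologicalSpace B]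
    [ChartedSpace (EuclideanHalfSpace (n + 1)) B] [NormedAddCommGroup E] [NormedSpace ℝ E]
    extends Frame E ι where
  κ : E → B
  inv : B → E
  left_inv : ∀ z ∈ dom, inv (κ z) = z
  image_open : IsOpen (κ '' dom)
  image_sub : κ '' dom ⊆ (𝓡∂ (n + 1)).interior B
  smooth : ContMDiffOn 𝓘(ℝ, E) (𝓡∂ (n + 1)) ∞ κ dom
  smooth_inv : ContMDiffOn (𝓡∂ (n + 1)) 𝓘(ℝ, E) ∞ inv (κ '' dom)

namespace Patch

variable {n : ℕ} {B E ι : Type*} [TopologicalSpace B]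
  [ChartedSpace (EuclideanHalfSpace (n + 1)) B] [NormedAddCommGroup E] [NormedSpace ℝ E]

/-- The region of `B` covered by the patch. -/
def reg (Q : Patch n B E ι) : Set B := Q.κ '' Q.dom

variable {Q : Patch n B E ι}

theorem κ_mem {z : E} (hz : z ∈ Q.dom) : Q.κ z ∈ Q.reg := mem_image_of_mem _ hz

theorem inv_mem {y : B} (hy : y ∈ Q.reg) : Q.inv y ∈ Q.dom := by
  obtain ⟨z, hz, rfl⟩ := hy
  rwa [Q.left_inv z hz]

theorem right_inv {y : B} (hy : y ∈ Q.reg) : Q.κ (Q.inv y) = y := by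
  obtain ⟨z, hz, rfl⟩ := hy
  rw [Q.left_inv z hz]

theorem isOpen_reg : IsOpen Q.reg := Q.image_open

theorem pull_smooth {f : B → ℂ} (hf : ContMDiffOn (𝓡∂ (n + 1)) 𝓘(ℝ, ℂ) ∞ f Q.reg) :
    ContDiffOn ℝ ∞ (f ∘ Q.κ) Q.dom :=
  (hf.comp Q.smooth fun _ hz => κ_mem hz).contDiffOn

theorem push_smoothOn {f : E → ℂ} (hf : ContDiffOn ℝ ∞ f Q.dom) :
    ContMDiffOn (𝓡∂ (n + 1)) 𝓘(ℝ, ℂ) ∞ (f ∘ Q.inv) Q.reg :=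
  hf.contMDiffOn.comp Q.smooth_inv fun _ hy => inv_mem hy

theorem testFun_pull (φ : testFun n B) : ContDiffOn ℝ ∞ ((φ : B → ℂ) ∘ Q.κ) Q.dom :=
  pull_smooth φ.2.1.contMDiffOn

/-- Functions which vanish near every point outside a region and are smooth in the region. -/
theorem _root_.contMDiff_of_region {f : B → ℂ} {U K : Set B} (hU : IsOpen U) (hK : IsClosed K)
    (hKU : K ⊆ U) (hf : ContMDiffOn (𝓡∂ (n + 1)) 𝓘(ℝ, ℂ) ∞ f U) (h0 : ∀ y ∉ K, f y = 0) :
    ContMDiff (𝓡∂ (n + 1)) 𝓘(ℝ, ℂ) ∞ f := by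
  intro y
  by_cases hy : y ∈ K
  · exact hf.contMDiffAt (hU.mem_nhds (hKU hy))
  · have : f =ᶠ[𝓝 y] fun _ => 0 := by
      filter_upwards [hK.isOpen_compl.mem_nhds hy] with x hx
      exact h0 x hx
    exact contMDiffAt_const.congr_of_eventuallyEq this

theorem tsupport_subset_of {f : B → ℂ} {K : Set B} (hK : IsClosed K) (h0 : ∀ y ∉ K, f y = 0) :
    tsupport f ⊆ K :=
  closure_minimal (fun y hy => by_contra fun h => hy (h0 y h)) hK

/-! ### Transport of test functions between a patch and the manifold -/

section Push

variable [T2Space B] [CompactSpace B]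

/-- A smooth function on a region with compact support in it, as a test function. -/
def mkTest (f : B → ℂ) (U K : Set B) (hU : IsOpen U) (hK : IsClosed K)
    (hKU : K ⊆ U) (hUi : K ⊆ (𝓡∂ (n + 1)).interior B)
    (hf : ContMDiffOn (𝓡∂ (n + 1)) 𝓘(ℝ, ℂ) ∞ f U) (h0 : ∀ y ∉ K, f y = 0) : testFun n B :=
  ⟨f, contMDiff_of_region hU hK hKU hf h0, (isClosed_tsupport f).isCompact,
    (tsupport_subset_of hK h0).trans hUi⟩

open Classical in
variable (Q) in
/-- The function on `B` given by `f` in the coordinates of the patch, extended by zero. -/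
def ext (f : E → ℂ) : B → ℂ := fun y => if y ∈ Q.reg then f (Q.inv y) else 0

theorem ext_κ (f : E → ℂ) {z : E} (hz : z ∈ Q.dom) : Q.ext f (Q.κ z) = f z := by
  simp [ext, κ_mem hz, Q.left_inv z hz]

theorem ext_of_mem (f : E → ℂ) {y : B} (hy : y ∈ Q.reg) : Q.ext f y = f (Q.inv y) := by
  simp [ext, hy]

theorem ext_of_notMem (f : E → ℂ) {y : B} (hy : y ∉ Q.reg) : Q.ext f y = 0 := by
  simp [ext, hy]

theorem ext_smooth {f : E → ℂ} (hf : ContDiffOn ℝ ∞ f Q.dom) :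
    ContMDiffOn (𝓡∂ (n + 1)) 𝓘(ℝ, ℂ) ∞ (Q.ext f) Q.reg :=
  (push_smoothOn hf).congr fun _ hy => ext_of_mem f hy

variable (Q) in
/-- The push-forward of a test function in a patch. -/
def push (η : E → ℂ) (hη : IsTest Q.dom η) : testFun n B :=
  mkTest (Q.ext η) Q.reg (Q.κ '' tsupport η) isOpen_reg
    ((hη.compact.isCompact.image_of_continuousOn
      (Q.smooth.continuousOn.mono hη.support)).isClosed)
    (image_mono hη.support) ((image_mono hη.support).trans Q.image_sub)
    (ext_smooth hη.smooth.contDiffOn) (by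
      intro y hy
      by_cases h : y ∈ Q.reg
      · rw [ext_of_mem _ h]
        refine image_eq_zero_of_notMem_tsupport fun hh => hy ⟨_, hh, right_inv h⟩
      · exact ext_of_notMem _ h)

theorem push_coe (η : E → ℂ) (hη : IsTest Q.dom η) : (Q.push η hη : B → ℂ) = Q.ext η := rfl

/-- The pull-back of a function with support in the patch. -/
theorem pull_test {φ : testFun n B} (h : tsupport (φ : B → ℂ) ⊆ Q.reg) :
    IsTest Q.dom (Q.dom.indicator ((φ : B → ℂ) ∘ Q.κ)) := by
  have hcomp : IsCompact (Q.inv '' tsupport (φ : B → ℂ)) :=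
    (isClosed_tsupport _).isCompact.image_of_continuousOn (Q.smooth_inv.continuousOn.mono h)
  have hsub : Q.inv '' tsupport (φ : B → ℂ) ⊆ Q.dom := by
    rintro _ ⟨y, hy, rfl⟩; exact inv_mem (h hy)
  have hs : tsupport (Q.dom.indicator ((φ : B → ℂ) ∘ Q.κ)) ⊆ Q.inv '' tsupport (φ : B → ℂ) := by
    refine closure_minimal ?_ hcomp.isClosed
    intro z hz
    have hzd : z ∈ Q.dom := by
      by_contra hh; exact hz (by simp [hh])
    refine ⟨Q.κ z, ?_, Q.left_inv z hzd⟩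
    by_contra hh
    apply hz
    rw [indicator_of_mem hzd]
    exact image_eq_zero_of_notMem_tsupport (f := (φ : B → ℂ)) hh
  refine ⟨contDiff_of_contDiffOn_of_tsupport Q.isOpen_dom
    ((testFun_pull φ).congr fun z hz => by simp [hz]) (hs.trans hsub),
    hcomp.of_isClosed_subset (isClosed_tsupport _) hs, hs.trans hsub⟩

end Push

/-! ### Change of variables -/

/-- `ρ` is the smooth positive density of the measure `m` in the coordinates of the patch. -/
structure IsDens [MeasurableSpace B] [MeasureSpace E] (Q : Patch n B E ι) (m : Measure B)
    (ρ : E → ℝ) : Prop where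
  smooth : ContDiffOn ℝ ∞ ρ Q.dom
  pos : ∀ z ∈ Q.dom, 0 < ρ z
  meas : ∀ s, MeasurableSet s → s ⊆ Q.dom → m (Q.κ '' s) = ∫⁻ z in s, ENNReal.ofReal (ρ z)

variable [MeasurableSpace B] [BorelSpace B] [MeasureSpace E] [BorelSpace E]
  {m : Measure B} {ρ : E → ℝ}

/-- Openness comes from the continuity of `inv` on the open image. Nothing is known about `κ`
outside `dom`, hence the subtype. -/
theorem isOpenEmbedding_restrict : IsOpenEmbedding (fun z : Q.dom => Q.κ z) := by
  refine .of_continuous_injective_isOpenMap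
    (continuousOn_iff_continuous_domRestrict.1 Q.smooth.continuousOn) ?_ ?_
  · intro a b h
    apply Subtype.ext
    rw [← Q.left_inv a a.2, ← Q.left_inv b b.2]
    exact congrArg Q.inv h
  · intro U hU
    have h1 : IsOpen ((↑) '' U : Set E) := Q.isOpen_dom.isOpenMap_subtype_val U hU
    have h2 := Q.smooth_inv.continuousOn.isOpen_inter_preimage Q.image_open h1
    convert h2 using 1
    ext y
    constructor
    · rintro ⟨z, hz, rfl⟩
      exact ⟨κ_mem z.2, ⟨z, hz, (Q.left_inv z z.2).symm⟩⟩
    · rintro ⟨hy, z, hz, hzy⟩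
      exact ⟨z, hz, by simp only [hzy]; exact right_inv hy⟩

/-- Injectivity of `κ` is available only on `dom`, so m on the region and ρ dz on `dom` are both
written as push-forwards of one measure on the subtype. Every change of variables below goes through
this measure. -/
theorem exists_common (h : IsDens Q m ρ) : ∃ ν : Measure Q.dom,
    m.restrict Q.reg = ν.map (fun z : Q.dom => Q.κ z) ∧
    (volume.restrict Q.dom).withDensity (fun z => ENNReal.ofReal (ρ z)) =
      ν.map (fun z : Q.dom => (z : E)) := by
  have hj := (isOpenEmbedding_restrict (Q := Q)).measurableEmbedding
  have hi : MeasurableEmbedding (fun z : Q.dom => (z : E)) :=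
    MeasurableEmbedding.subtype_coe Q.isOpen_dom.measurableSet
  set W := (volume.restrict Q.dom).withDensity (fun z => ENNReal.ofReal (ρ z)) with hW
  refine ⟨W.comap (↑), ?_, ?_⟩
  · refine Measure.ext fun s hs => ?_
    rw [hj.map_apply, hi.comap_apply, Measure.restrict_apply hs]
    have hms : MeasurableSet ((↑) '' ((fun z : Q.dom => Q.κ z) ⁻¹' s) : Set E) :=
      hi.measurableSet_image.2 (hj.measurable hs)
    have hsub : ((↑) '' ((fun z : Q.dom => Q.κ z) ⁻¹' s) : Set E) ⊆ Q.dom := by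
      rintro _ ⟨z, -, rfl⟩; exact z.2
    rw [hW, withDensity_apply _ hms, Measure.restrict_restrict hms, inter_eq_left.2 hsub,
      ← h.meas _ hms hsub]
    congr 1
    ext y
    constructor
    · rintro ⟨hy, z, hz, rfl⟩
      exact ⟨z, ⟨⟨z, hz⟩, hy, rfl⟩, rfl⟩
    · rintro ⟨_, ⟨z, hz, rfl⟩, rfl⟩
      exact ⟨hz, κ_mem z.2⟩
  · rw [hi.map_comap, Subtype.range_coe, hW,
      restrict_withDensity Q.isOpen_dom.measurableSet, Measure.restrict_restrict
      Q.isOpen_dom.measurableSet, inter_self]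

theorem IsDens.aemeasurable (h : IsDens Q m ρ) : AEMeasurable ρ (volume.restrict Q.dom) :=
  h.smooth.continuousOn.aemeasurable Q.isOpen_dom.measurableSet

theorem IsDens.setIntegral_reg (h : IsDens Q m ρ) (G : B → ℂ) :
    ∫ y in Q.reg, G y ∂m = ∫ z in Q.dom, (ρ z : ℂ) * G (Q.κ z) := by
  obtain ⟨ν, h1, h2⟩ := exists_common h
  have hj := (isOpenEmbedding_restrict (Q := Q)).measurableEmbedding
  have hi : MeasurableEmbedding (fun z : Q.dom => (z : E)) :=
    MeasurableEmbedding.subtype_coe Q.isOpen_dom.measurableSet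
  have e := hi.integral_map (μ := ν) (fun z => G (Q.κ z))
  rw [h1, hj.integral_map, ← e, ← h2,
    integral_withDensity_eq_integral_toReal_smul₀ h.aemeasurable.ennreal_ofReal
      (ae_of_all _ fun _ => ENNReal.ofReal_lt_top)]
  refine setIntegral_congr_fun Q.isOpen_dom.measurableSet fun z hz => ?_
  simp [ENNReal.toReal_ofReal (h.pos z hz).le]

theorem IsDens.integrableOn_reg (h : IsDens Q m ρ) {G : B → ℂ}
    (hG : IntegrableOn (fun z => (ρ z : ℂ) * G (Q.κ z)) Q.dom) : IntegrableOn G Q.reg m := by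
  obtain ⟨ν, h1, h2⟩ := exists_common h
  have hj := (isOpenEmbedding_restrict (Q := Q)).measurableEmbedding
  have hi : MeasurableEmbedding (fun z : Q.dom => (z : E)) :=
    MeasurableEmbedding.subtype_coe Q.isOpen_dom.measurableSet
  have e := hi.integrable_map_iff (μ := ν) (g := fun z : E => G (Q.κ z))
  rw [IntegrableOn, h1, hj.integrable_map_iff]
  refine e.1 ?_
  rw [← h2, integrable_withDensity_iff_integrable_smul₀' h.aemeasurable.ennreal_ofReal
      (ae_of_all _ fun _ => ENNReal.ofReal_lt_top)]
  refine hG.congr_fun (fun z hz => ?_) Q.isOpen_dom.measurableSet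
  simp [ENNReal.toReal_ofReal (h.pos z hz).le]

theorem IsDens.lintegral_image (h : IsDens Q m ρ) {s : Set E} (hs : MeasurableSet s)
    (hsub : s ⊆ Q.dom) (F : B → ℝ≥0∞) :
    ∫⁻ y in Q.κ '' s, F y ∂m = ∫⁻ z in s, ENNReal.ofReal (ρ z) * F (Q.κ z) := by
  obtain ⟨ν, h1, h2⟩ := exists_common h
  have hj := (isOpenEmbedding_restrict (Q := Q)).measurableEmbedding
  have hi : MeasurableEmbedding (fun z : Q.dom => (z : E)) :=
    MeasurableEmbedding.subtype_coe Q.isOpen_dom.measurableSet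
  have himg : Q.κ '' s = (fun z : Q.dom => Q.κ z) '' ((↑) ⁻¹' s) := by
    ext y
    constructor
    · rintro ⟨z, hz, rfl⟩; exact ⟨⟨z, hsub hz⟩, hz, rfl⟩
    · rintro ⟨z, hz, rfl⟩; exact ⟨z, hz, rfl⟩
  have hmi : MeasurableSet (Q.κ '' s) := by
    rw [himg]; exact hj.measurableSet_image.2 (hi.measurable hs)
  have e := hi.lintegral_map (μ := ν) (s.indicator fun z => F (Q.κ z))
  have hr : Q.κ '' s ⊆ Q.reg := image_mono hsub
  rw [← inter_eq_left.2 hr, ← Measure.restrict_restrict hmi, ← lintegral_indicator hmi, h1,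
    hj.lintegral_map]
  have e1 : ∀ z : Q.dom, (Q.κ '' s).indicator F (Q.κ z) =
      s.indicator (fun z => F (Q.κ z)) (z : E) := by
    intro z
    by_cases hz : (z : E) ∈ s
    · rw [indicator_of_mem hz, indicator_of_mem (mem_image_of_mem _ hz)]
    · rw [indicator_of_notMem hz, indicator_of_notMem]
      rintro ⟨z', hz', he⟩
      apply hz
      rw [← Q.left_inv z z.2, ← he, Q.left_inv z' (hsub hz')]
      exact hz'
  simp_rw [e1]
  rw [← e, ← h2, lintegral_withDensity_eq_lintegral_mul_non_measurable₀ _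
    h.aemeasurable.ennreal_ofReal (ae_of_all _ fun _ => ENNReal.ofReal_lt_top)]
  rw [← inter_eq_left.2 hsub, ← Measure.restrict_restrict hs, ← lintegral_indicator hs,
    inter_eq_left.2 hsub]
  congr 1
  funext z
  by_cases hz : z ∈ s <;> simp [hz]

theorem IsDens.ae_reg (h : IsDens Q m ρ) {p : B → Prop} :
    (∀ᵐ y ∂m.restrict Q.reg, p y) ↔ ∀ᵐ z ∂volume.restrict Q.dom, p (Q.κ z) := by
  obtain ⟨ν, h1, h2⟩ := exists_common h
  have hj := (isOpenEmbedding_restrict (Q := Q)).measurableEmbedding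
  have hi : MeasurableEmbedding (fun z : Q.dom => (z : E)) :=
    MeasurableEmbedding.subtype_coe Q.isOpen_dom.measurableSet
  have e := hi.ae_map_iff (μ := ν) (p := fun z => p (Q.κ z))
  rw [h1, hj.ae_map_iff, ← e, ← h2]
  have hpos : ∀ᵐ z ∂volume.restrict Q.dom, ENNReal.ofReal (ρ z) ≠ 0 := by
    rw [ae_restrict_iff' Q.isOpen_dom.measurableSet]
    exact ae_of_all _ fun z hz => by simpa using h.pos z hz
  constructor
  · intro hp
    exact (withDensity_absolutelyContinuous' h.aemeasurable.ennreal_ofReal hpos).ae_le hp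
  · intro hp
    exact (withDensity_absolutelyContinuous _ _).ae_le hp

theorem IsDens.locallyIntegrableOn [T2Space B] [CompactSpace B] (h : IsDens Q m ρ) {G : B → ℂ}
    (hG : LocallyIntegrableOn (G ∘ Q.κ) Q.dom) : LocallyIntegrableOn G Q.reg m := by
  rw [locallyIntegrableOn_iff isOpen_reg.isLocallyClosed]
  intro K hK hKc
  have hcK : IsCompact (Q.inv '' K) :=
    hKc.image_of_continuousOn (Q.smooth_inv.continuousOn.mono hK)
  have hsub : Q.inv '' K ⊆ Q.dom := by rintro _ ⟨y, hy, rfl⟩; exact inv_mem (hK hy)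
  have h1 : IntegrableOn (G ∘ Q.κ) (Q.inv '' K) := hG.integrableOn_compact_subset hsub hcK
  have hρ : ContinuousOn (fun z => (ρ z : ℂ)) Q.dom :=
    Complex.continuous_ofReal.comp_continuousOn h.smooth.continuousOn
  have h2 : IntegrableOn (fun z => (ρ z : ℂ) * (G ∘ Q.κ) z) (Q.inv '' K) :=
    h1.continuousOn_mul (hρ.mono hsub) hcK
  have h3 : IntegrableOn (K.indicator G) Q.reg m := by
    refine h.integrableOn_reg ?_
    have : (fun z => (ρ z : ℂ) * (K.indicator G) (Q.κ z)) =ᵐ[volume.restrict Q.dom]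
        (Q.inv '' K).indicator (fun z => (ρ z : ℂ) * (G ∘ Q.κ) z) := by
      refine (ae_restrict_iff' Q.isOpen_dom.measurableSet).2 (ae_of_all _ fun z hz => ?_)
      simp only
      by_cases hzK : Q.κ z ∈ K
      · rw [indicator_of_mem hzK, indicator_of_mem (show z ∈ Q.inv '' K from ⟨_, hzK, Q.left_inv z hz⟩)]; rfl
      · rw [indicator_of_notMem hzK, indicator_of_notMem, mul_zero]
        rintro ⟨y, hy, rfl⟩
        exact hzK (by rwa [right_inv (hK hy)])
    rw [IntegrableOn, integrable_congr this]
    exact ((integrable_indicator_iff hcK.measurableSet).2 h2).integrableOn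
  have h4 := h3.mono_set hK
  rwa [integrableOn_congr_fun (g := G) (fun y hy => indicator_of_mem hy G)
    hKc.measurableSet] at h4

theorem integral_eq_setIntegral_reg {G : B → ℂ} (h : ∀ y ∉ Q.reg, G y = 0) :
    ∫ y in Q.reg, G y ∂m = ∫ y, G y ∂m :=
  setIntegral_eq_integral_of_forall_compl_eq_zero h

/-! ### Operators in a patch -/

section Op

variable [FiniteDimensional ℝ E] [(volume : Measure E).IsAddHaarMeasure] [Fintype ι]
  [T2Space B] [CompactSpace B]

variable (Q) in
/-- In the patch, `A` is the differential operator with coefficient list `L`. -/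
def IsOpList (A : testFun n B →ₗ[ℂ] testFun n B) (L : List ((E → ℂ) × (ι → ℕ))) : Prop :=
  ∀ φ : testFun n B, ∀ z ∈ Q.dom,
    (A φ : B → ℂ) (Q.κ z) = Frame.comb L (fun m => Q.D m ((φ : B → ℂ) ∘ Q.κ)) z

theorem comb_congr {L : List ((E → ℂ) × (ι → ℕ))} {g g' : (ι → ℕ) → E → ℂ} {z : E}
    (h : ∀ m, g m z = g' m z) : Frame.comb L g z = Frame.comb L g' z := by
  simp only [Frame.comb, h]

/-- `At` is known only through its pairing with test functions. Testing with functions pushed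
forward from the patch identifies it there, almost everywhere, with the explicit formal adjoint of
`L`; and that adjoint can be moved back onto a non-smooth f by the definition of its weak
derivatives. Locality of `At` confines all integrals to the patch. -/
theorem integral_mul_transpose (h : IsDens Q m ρ) {A At : testFun n B →ₗ[ℂ] testFun n B}
    (hAt : IsFormalTranspose m A At)
    (hloc : ∀ φ, tsupport (At φ : B → ℂ) ⊆ tsupport (φ : B → ℂ))
    {L : List ((E → ℂ) × (ι → ℕ))} {K : ℕ} (hA : Q.IsOpList A L)
    (hL : ∀ x ∈ L, ContDiffOn ℝ ∞ x.1 Q.dom ∧ ∑ i, x.2 i ≤ K) {f : B → ℂ}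
    {g : (ι → ℕ) → E → ℂ} (hg : Q.IsFam K (f ∘ Q.κ) g)
    {φ : testFun n B} (hφ : tsupport (φ : B → ℂ) ⊆ Q.reg) :
    ∫ y, Q.ext (Frame.comb L g) y * (φ : B → ℂ) y ∂m = ∫ y, f y * (At φ : B → ℂ) y ∂m := by
  have hρ : ContDiffOn ℝ ∞ (fun z => (ρ z : ℂ)) Q.dom :=
    Complex.ofRealCLM.contDiff.comp_contDiffOn h.smooth
  set φ' := Q.dom.indicator ((φ : B → ℂ) ∘ Q.κ) with hφ'
  have tφ : IsTest Q.dom φ' := pull_test hφ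
  -- Chosen so that ξ q dz = φ ρ dz, which exchanges the measure m for the density of the frame.
  set ξ : E → ℂ := fun z => (ρ z * (Q.q z)⁻¹) * φ' z with hξ
  have tξ : IsTest Q.dom ξ :=
    tφ.mul_left Q.isOpen_dom (hρ.mul (Q.q_smooth.inv Q.q_ne))
  have eξ : ∀ z, ξ z * Q.q z = ρ z * φ' z := by
    intro z
    by_cases hz : z ∈ Q.dom
    · rw [hξ]; field_simp [Q.q_ne z hz]
    · simp [hξ, tφ.eq_zero hz]
  have φ0 : ∀ y ∉ Q.reg, (φ : B → ℂ) y = 0 := fun y hy =>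
    image_eq_zero_of_notMem_tsupport fun hh => hy (hφ hh)
  have A0 : ∀ y ∉ Q.reg, (At φ : B → ℂ) y = 0 := fun y hy =>
    image_eq_zero_of_notMem_tsupport fun hh => hy (hφ (hloc φ hh))
  have φ'0 : ∀ z ∉ Q.dom, φ' z = 0 := fun z hz => indicator_of_notMem hz _
  have tadj : IsTest Q.dom (Q.adjList L ξ) := Frame.adjList_test (fun x hx => (hL x hx).1) tξ
  -- integrals against functions supported in the patch
  have hint : ∀ G : B → ℂ, ∫ y, G y * (φ : B → ℂ) y ∂m = ∫ z, G (Q.κ z) * ξ z * Q.q z := by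
    intro G
    rw [← integral_eq_setIntegral_reg (Q := Q) (fun y hy => by simp [φ0 y hy]),
      h.setIntegral_reg, ← setIntegral_eq_integral_of_forall_compl_eq_zero (s := Q.dom)
        (f := fun z => G (Q.κ z) * ξ z * Q.q z) (fun z hz => by simp [tξ.eq_zero hz])]
    refine setIntegral_congr_fun Q.isOpen_dom.measurableSet fun z hz => ?_
    rw [mul_assoc, eξ, hφ', indicator_of_mem hz]
    simp only [Function.comp]
    ring
  -- the transpose in coordinates
  have hAtκ : (fun z => (ρ z : ℂ) * (At φ : B → ℂ) (Q.κ z)) =ᵐ[volume.restrict Q.dom]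
      fun z => Q.adjList L ξ z * Q.q z := by
    refine ae_eq_of_integral_test_eq Q.isOpen_dom ?_ ?_ fun η hη => ?_
    · exact (hρ.mul (testFun_pull (At φ))).continuousOn.locallyIntegrableOn
        Q.isOpen_dom.measurableSet
    · exact (tadj.smooth.contDiffOn.mul Q.q_smooth).continuousOn.locallyIntegrableOn
        Q.isOpen_dom.measurableSet
    -- For smooth η the operator and its formal adjoint are classical; comparing the two ways of
    -- transposing gives the identity tested with η.
    · have e1 := hAt (Q.push η hη) φ
      rw [hint] at e1
      have e2 := Frame.integral_comb_mul (P := Q.toFrame) (L := L) (K := K) (f := η)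
        (g := fun m => Q.D m η)
        (fun m _ => Frame.hasW_of_smooth m hη.smooth.contDiffOn) hL tξ
      have e3 : ∫ z, (A (Q.push η hη) : B → ℂ) (Q.κ z) * ξ z * Q.q z =
          ∫ z, Frame.comb L (fun m => Q.D m η) z * ξ z * Q.q z := by
        congr 1
        funext z
        by_cases hz : z ∈ Q.dom
        · rw [hA _ z hz]
          congr 2
          refine comb_congr fun m => ?_
          exact Frame.D_congr m Q.isOpen_dom (fun w hw => ext_κ η hw) hz
        · simp [tξ.eq_zero hz]
      rw [e3, e2, ← integral_eq_setIntegral_reg (Q := Q) (fun y hy => by simp [A0 y hy]),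
        h.setIntegral_reg] at e1
      rw [← setIntegral_eq_integral_of_forall_compl_eq_zero (s := Q.dom)
        (fun z hz => by simp [hη.eq_zero hz])]
      calc ∫ z in Q.dom, (ρ z : ℂ) * (At φ : B → ℂ) (Q.κ z) * η z
          = ∫ z in Q.dom, (ρ z : ℂ) *
            ((Q.push η hη : B → ℂ) (Q.κ z) * (At φ : B → ℂ) (Q.κ z)) := by
              refine setIntegral_congr_fun Q.isOpen_dom.measurableSet fun z hz => ?_
              simp only [push_coe, ext_κ η hz]
              ring
        _ = ∫ z, η z * Q.adjList L ξ z * Q.q z := e1.symm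
        _ = _ := by congr 1; funext z; ring
  have e2 := Frame.integral_comb_mul hg hL tξ
  rw [hint, ← integral_eq_setIntegral_reg (Q := Q) (fun y hy => by simp [A0 y hy]),
    h.setIntegral_reg]
  have e3 : ∫ z, Q.ext (Frame.comb L g) (Q.κ z) * ξ z * Q.q z =
      ∫ z, Frame.comb L g z * ξ z * Q.q z := by
    congr 1
    funext z
    by_cases hz : z ∈ Q.dom
    · rw [ext_κ _ hz]
    · simp [tξ.eq_zero hz]
  rw [e3, e2, ← setIntegral_eq_integral_of_forall_compl_eq_zero (s := Q.dom)
        (fun z hz => by simp [tadj.eq_zero hz])]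
  refine integral_congr_ae ?_
  filter_upwards [hAtκ] with z hz
  rw [mul_assoc, ← hz]
  simp only [Function.comp]
  ring

end Op

end Patch

/-! ### The patches given by interior charts -/

section Interior

variable {n : ℕ} {B : Type*} [TopologicalSpace B]
  [ChartedSpace (EuclideanHalfSpace (n + 1)) B]

theorem isOpen_chartDom (e : OpenPartialHomeomorph B (EuclideanHalfSpace (n + 1))) :
    IsOpen (chartDom e) := by
  have : chartDom e =
      (𝓡∂ (n + 1)).symm ⁻¹' e.target ∩ interior (range (𝓡∂ (n + 1))) := by
    unfold chartDom
    rw [OpenPartialHomeomorph.extend_target]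
    ext z
    constructor
    · rintro ⟨⟨h1, -⟩, h2⟩; exact ⟨h1, h2⟩
    · rintro ⟨h1, h2⟩; exact ⟨⟨h1, interior_subset h2⟩, h2⟩
  rw [this]
  exact (e.open_target.preimage (𝓡∂ (n + 1)).continuous_symm).inter isOpen_interior

/-- The coordinate change has an invertible differential and takes values in the closed convex range
of the model. A map into such a set whose derivative at a point is surjective sends that point to
the interior. -/
theorem mem_interior_range_of_maximalAtlas {E H M : Type*} [NormedAddCommGroup E]
    [NormedSpace ℝ E] [TopologicalSpace H] {I : ModelWithCorners ℝ E H} [TopologicalSpace M]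
    [ChartedSpace H M] {e e' : OpenPartialHomeomorph M H}
    (he : e ∈ IsManifold.maximalAtlas I ∞ M) (he' : e' ∈ IsManifold.maximalAtlas I ∞ M) {x : M}
    (hex : x ∈ e.source) (hex' : x ∈ e'.source) (hx : e.extend I x ∈ interior (range I)) :
    e'.extend I x ∈ interior (range I) := by
  let φ := I.extendCoordChange e e'
  have hφ : ContDiffOn ℝ ∞ φ φ.source := ModelWithCorners.contDiffOn_extendCoordChange he he'
  have hs : Function.Surjective (fderivWithin ℝ φ φ.source (e.extend I x)) :=
    (ModelWithCorners.isInvertible_fderivWithin_extendCoordChange (by simp) he he'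
      (by simp [ModelWithCorners.extendCoordChange, hex, hex'])).surjective
  have hx' : e.extend I x ∈ interior (e.extend I).target :=
    e.mem_interior_extend_target (by simp [hex]) hx
  have hφx : φ.source ∈ 𝓝 (e.extend I x) := by
    simp_rw [φ, ModelWithCorners.extendCoordChange, PartialEquiv.trans_source,
      PartialEquiv.symm_source, Filter.inter_mem_iff, mem_interior_iff_mem_nhds.1 hx', true_and,
      e'.extend_source]
    exact e.extend_preimage_mem_nhds hex <| e'.open_source.mem_nhds hex'
  rw [fderivWithin_of_mem_nhds hφx] at hs
  have hd := (hφ.differentiableOn (by simp)).differentiableAt hφx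
  rw [show e'.extend I x = φ (e.extend I x) by
    simp [φ, ModelWithCorners.extendCoordChange, hex]]
  exact hd.mem_interior_convex_of_surjective_fderiv hφx I.convex_range I.isClosed_range
    I.nonempty_interior
    (φ.mapsTo.mono_right <| by simp [φ, ModelWithCorners.extendCoordChange, inter_assoc]) hs

variable [IsManifold (𝓡∂ (n + 1)) ∞ B]

theorem mem_interior_iff_of_maximalAtlas
    {e : OpenPartialHomeomorph B (EuclideanHalfSpace (n + 1))}
    (he : e ∈ IsManifold.maximalAtlas (𝓡∂ (n + 1)) ∞ B) {x : B} (hx : x ∈ e.source) :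
    x ∈ (𝓡∂ (n + 1)).interior B ↔ e.extend (𝓡∂ (n + 1)) x ∈ chartDom e := by
  have h0 : x ∈ (𝓡∂ (n + 1)).interior B ↔
      (chartAt (EuclideanHalfSpace (n + 1)) x).extend (𝓡∂ (n + 1)) x ∈
        interior (range (𝓡∂ (n + 1))) := Iff.rfl
  have hc := IsManifold.chart_mem_maximalAtlas (I := 𝓡∂ (n + 1)) (n := ∞) x
  rw [h0]
  constructor
  · intro h
    exact ⟨(e.extend _).map_source (by simpa using hx),
      mem_interior_range_of_maximalAtlas hc he (mem_chart_source _ x) hx h⟩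
  · intro h
    exact mem_interior_range_of_maximalAtlas he hc hx (mem_chart_source _ x) h.2

theorem image_chartDom {e : OpenPartialHomeomorph B (EuclideanHalfSpace (n + 1))}
    (he : e ∈ IsManifold.maximalAtlas (𝓡∂ (n + 1)) ∞ B) :
    (e.extend (𝓡∂ (n + 1))).symm '' chartDom e = e.source ∩ (𝓡∂ (n + 1)).interior B := by
  ext y
  constructor
  · rintro ⟨z, hz, rfl⟩
    have h1 : (e.extend (𝓡∂ (n + 1))).symm z ∈ e.source := by
      have := (e.extend (𝓡∂ (n + 1))).map_target hz.1
      rwa [e.extend_source] at this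
    refine ⟨h1, (mem_interior_iff_of_maximalAtlas he h1).2 ?_⟩
    rwa [(e.extend (𝓡∂ (n + 1))).right_inv hz.1]
  · rintro ⟨h1, h2⟩
    exact ⟨_, (mem_interior_iff_of_maximalAtlas he h1).1 h2,
      (e.extend (𝓡∂ (n + 1))).left_inv (by simpa using h1)⟩

variable (n) in
/-- The coordinate vector fields. -/
def coordFrame (U : Set (EuclideanSpace ℝ (Fin n))) (hU : IsOpen U) :
    Frame (EuclideanSpace ℝ (Fin n)) (Fin n) where
  dom := U
  isOpen_dom := hU
  vec i := EuclideanSpace.single i 1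
  wt _ _ := 1
  q _ := 1
  idx := List.finRange n
  idx_nodup := List.nodup_finRange n
  idx_mem := List.mem_finRange
  wt_smooth _ := contDiff_const
  q_smooth := contDiffOn_const
  q_ne := by simp
  wt_comm := by simp
  div_free := by simp

/-- The patch given by a chart. -/
def intPatch (e : OpenPartialHomeomorph B (EuclideanHalfSpace (n + 1)))
    (he : e ∈ IsManifold.maximalAtlas (𝓡∂ (n + 1)) ∞ B) :
    Patch n B (EuclideanSpace ℝ (Fin (n + 1))) (Fin (n + 1)) where
  toFrame := coordFrame (n + 1) (chartDom e) (isOpen_chartDom e)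
  κ := (e.extend (𝓡∂ (n + 1))).symm
  inv := e.extend (𝓡∂ (n + 1))
  left_inv z hz := (e.extend (𝓡∂ (n + 1))).right_inv hz.1
  image_open := by
    change IsOpen ((e.extend (𝓡∂ (n + 1))).symm '' chartDom e)
    rw [image_chartDom he]
    exact e.open_source.inter ((𝓡∂ (n + 1)).isOpen_interior (n := ∞) (by simp))
  image_sub := by
    change (e.extend (𝓡∂ (n + 1))).symm '' chartDom e ⊆ _
    rw [image_chartDom he]
    exact inter_subset_right
  smooth := by
    refine (contMDiffOn_extend_symm he).mono ?_
    intro z hz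
    have := hz.1
    rw [OpenPartialHomeomorph.extend_target] at this
    exact ⟨(𝓡∂ (n + 1)).symm z, this.1, (𝓡∂ (n + 1)).right_inv this.2⟩
  smooth_inv := by
    refine (OpenPartialHomeomorph.contMDiffOn_extend he).mono ?_
    change (e.extend (𝓡∂ (n + 1))).symm '' chartDom e ⊆ _
    rw [image_chartDom he]
    exact inter_subset_left

theorem reg_intPatch {e : OpenPartialHomeomorph B (EuclideanHalfSpace (n + 1))}
    (he : e ∈ IsManifold.maximalAtlas (𝓡∂ (n + 1)) ∞ B) :
    (intPatch e he).reg = e.source ∩ (𝓡∂ (n + 1)).interior B := image_chartDom he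

theorem coordFrame_D {n : ℕ} {U : Set (EuclideanSpace ℝ (Fin n))} (hU : IsOpen U)
    (m : Fin n → ℕ) (f : EuclideanSpace ℝ (Fin n) → ℂ) :
    (coordFrame n U hU).D m f = iterD m f := by
  have : ∀ i, (coordFrame n U hU).X i = partialD i := by
    intro i; funext f z; simp [Frame.X, coordFrame, partialD]
  simp only [Frame.D, Frame.DL, iterD, this]
  rfl

theorem hasWeakD_iff {n : ℕ} {U : Set (EuclideanSpace ℝ (Fin n))} (hU : IsOpen U)
    (m : Fin n → ℕ) (f g : EuclideanSpace ℝ (Fin n) → ℂ) :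
    HasWeakD U m f g ↔ (coordFrame n U hU).HasW m f g := by
  unfold HasWeakD Frame.HasW
  simp only [coordFrame_D]
  simp only [coordFrame, mul_one]
  constructor
  · rintro ⟨h1, h2, h3⟩
    exact ⟨h1, h2, fun η hη => h3 η hη.1 hη.2 hη.3⟩
  · rintro ⟨h1, h2, h3⟩
    exact ⟨h1, h2, fun η a b c => h3 η ⟨a, b, c⟩⟩

end Interior

/-! ### The patches in the collar -/

section Collar

/-- The vector fields `t ∂_t` (for the index `none`) and `∂_{x_i}`, with the density `1 / t`. -/
def coneFrame (n : ℕ) (U : Set (EuclideanSpace ℝ (Fin n))) (hU : IsOpen U) :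
    Frame (ℝ × EuclideanSpace ℝ (Fin n)) (Option (Fin n)) where
  dom := Ioo 0 1 ×ˢ U
  isOpen_dom := isOpen_Ioo.prod hU
  vec o := o.elim (1, 0) fun i => (0, EuclideanSpace.single i 1)
  wt o := o.elim (fun z => (z.1 : ℂ)) fun _ _ => 1
  q z := (z.1 : ℂ)⁻¹
  -- The fold applies the last entry first, so with `none` at the end t∂_t acts before the ∂_{x_i},
  -- as in `coneD`.
  idx := (List.finRange n).map some ++ [none]
  idx_nodup := by
    refine List.nodup_append.2 ⟨(List.nodup_finRange n).map (Option.some_injective _), by simp, ?_⟩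
    simp
  idx_mem := by
    intro i
    cases i <;> simp
  wt_smooth := by
    rintro (_ | i)
    · exact Complex.ofRealCLM.contDiff.comp contDiff_fst
    · exact contDiff_const
  q_smooth := by
    refine ContDiffOn.inv (Complex.ofRealCLM.contDiff.comp contDiff_fst).contDiffOn ?_
    intro z hz
    have := hz.1.1
    exact Complex.ofReal_ne_zero.2 this.ne'
  q_ne := by
    intro z hz
    have := hz.1.1
    simp [this.ne']
  wt_comm := by
    have h : ∀ z : ℝ × EuclideanSpace ℝ (Fin n),
        fderiv ℝ (fun z : ℝ × EuclideanSpace ℝ (Fin n) => (z.1 : ℂ)) z =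
          Complex.ofRealCLM.comp (ContinuousLinearMap.fst ℝ ℝ _) := by
      intro z
      exact (Complex.ofRealCLM.comp
        (ContinuousLinearMap.fst ℝ ℝ (EuclideanSpace ℝ (Fin n)))).hasFDerivAt.fderiv
    rintro (_ | i) (_ | j) z hij
    · exact absurd rfl hij
    · simp
    · simp [h]
    · simp
  div_free := by
    rintro (_ | i) z hz
    · have : (fun y : ℝ × EuclideanSpace ℝ (Fin n) => (y.1 : ℂ) * (y.1 : ℂ)⁻¹) =ᶠ[𝓝 z]
          fun _ => 1 := by
        filter_upwards [(isOpen_Ioo.prod hU).mem_nhds hz] with y hy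
        have := hy.1.1
        exact mul_inv_cancel₀ (Complex.ofReal_ne_zero.2 this.ne')
      simp [this.fderiv_eq]
    · have h1 : (fun y : ℝ × EuclideanSpace ℝ (Fin n) => (1 : ℂ) * (y.1 : ℂ)⁻¹) =
          (fun t : ℝ => (t : ℂ)⁻¹) ∘ Prod.fst := by
        funext y; simp
      have hz0 : ((z.1 : ℝ) : ℂ) ≠ 0 := Complex.ofReal_ne_zero.2 (ne_of_gt hz.1.1)
      have hd : DifferentiableAt ℝ (fun t : ℝ => (t : ℂ)⁻¹) z.1 :=
        (Complex.ofRealCLM.differentiableAt).inv hz0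
      simp only [Option.elim]
      rw [h1, fderiv_comp z hd differentiableAt_fst]
      simp [fderiv_fst]

theorem coneFrame_D {n : ℕ} {U : Set (EuclideanSpace ℝ (Fin n))} (hU : IsOpen U)
    (m : Option (Fin n) → ℕ) (f : ℝ × EuclideanSpace ℝ (Fin n) → ℂ) :
    (coneFrame n U hU).D m f = coneD (m none) (fun i => m (some i)) f := by
  have h1 : ∀ i, (coneFrame n U hU).X (some i) = xD i := by
    intro i; funext f z; simp [Frame.X, coneFrame, xD]
  have h2 : (coneFrame n U hU).X none = tD := by
    funext f z; simp [Frame.X, coneFrame, tD]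
  have h3 : (coneFrame n U hU).idx = (List.finRange n).map some ++ [none] := rfl
  simp only [Frame.D, Frame.DL, coneD, h3, List.foldr_append, List.foldr_map, h1, List.foldr_cons,
    List.foldr_nil, h2]

theorem hasWeakConeD_iff {n : ℕ} {U : Set (EuclideanSpace ℝ (Fin n))} (hU : IsOpen U)
    (m : Option (Fin n) → ℕ) (f g : ℝ × EuclideanSpace ℝ (Fin n) → ℂ) :
    HasWeakConeD (Ioo 0 1 ×ˢ U) (m none) (fun i => m (some i)) f g ↔
      (coneFrame n U hU).HasW m f g := by
  unfold HasWeakConeD Frame.HasW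
  simp only [coneFrame_D, Fintype.sum_option]
  simp only [coneFrame, div_eq_mul_inv]
  constructor
  · rintro ⟨h1, h2, h3⟩
    exact ⟨h1, h2, fun η hη => h3 η hη.1 hη.2 hη.3⟩
  · rintro ⟨h1, h2, h3⟩
    exact ⟨h1, h2, fun η a b c => h3 η ⟨a, b, c⟩⟩

variable {n : ℕ} {B X : Type*} [TopologicalSpace B]
  [ChartedSpace (EuclideanHalfSpace (n + 1)) B] [TopologicalSpace X]
  [ChartedSpace (EuclideanSpace ℝ (Fin n)) X]

/-- The coordinates `(t, x)` in the collar. -/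
def collarInv (c : Collar n B X) (ψ : OpenPartialHomeomorph X (EuclideanSpace ℝ (Fin n))) :
    B → ℝ × EuclideanSpace ℝ (Fin n) :=
  fun y => ((c.invFun y).1, ψ (c.invFun y).2)

/-- The part of the collar over the chart `ψ`, where `t` is in `J`. -/
def collarReg (c : Collar n B X) (ψ : OpenPartialHomeomorph X (EuclideanSpace ℝ (Fin n)))
    (J : Set ℝ) : Set B := c.target ∩ c.invFun ⁻¹' (J ×ˢ ψ.source)

theorem isOpen_collarReg (c : Collar n B X)
    (ψ : OpenPartialHomeomorph X (EuclideanSpace ℝ (Fin n))) {J : Set ℝ} (hJ : IsOpen J) :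
    IsOpen (collarReg c ψ J) :=
  c.smooth_symm.continuousOn.isOpen_inter_preimage c.open_target (hJ.prod ψ.open_source)

theorem Collar.mem_source (c : Collar n B X) {t : ℝ} (ht : t ∈ Ico (0 : ℝ) 1) (x : X) :
    (t, x) ∈ c.source := by
  rw [c.source_eq]; exact ⟨ht, mem_univ _⟩

theorem Collar.inv_mem (c : Collar n B X) {y : B} (hy : y ∈ c.target) :
    (c.invFun y).1 ∈ Ico (0 : ℝ) 1 := by
  have := c.toPartialEquiv.map_target hy
  change c.invFun y ∈ c.source at this
  rw [c.source_eq] at this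
  exact this.1

theorem Collar.left_inv_apply (c : Collar n B X) {t : ℝ} (ht : t ∈ Ico (0 : ℝ) 1) (x : X) :
    c.invFun (c.toFun (t, x)) = (t, x) := c.toPartialEquiv.left_inv (c.mem_source ht x)

theorem Collar.right_inv_apply (c : Collar n B X) {y : B} (hy : y ∈ c.target) :
    c.toFun (c.invFun y) = y := c.toPartialEquiv.right_inv hy

theorem Collar.map_mem (c : Collar n B X) {t : ℝ} (ht : t ∈ Ico (0 : ℝ) 1) (x : X) :
    c.toFun (t, x) ∈ c.target := c.toPartialEquiv.map_source (c.mem_source ht x)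

/-- The collar maps {0} × X onto the boundary and is injective, so t = 0 characterises boundary
points inside it. -/
theorem Collar.mem_interior_iff (c : Collar n B X) {y : B} (hy : y ∈ c.target) :
    y ∈ (𝓡∂ (n + 1)).interior B ↔ 0 < (c.invFun y).1 := by
  rw [← (𝓡∂ (n + 1)).compl_boundary, ← c.image_zero, mem_compl_iff]
  have h0 := c.inv_mem hy
  constructor
  · intro h
    refine lt_of_le_of_ne h0.1 fun hh => h ⟨c.invFun y, ⟨hh.symm, mem_univ _⟩, ?_⟩
    exact c.right_inv_apply hy
  · rintro h ⟨⟨t, x⟩, ⟨ht, -⟩, rfl⟩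
    have ht : t = 0 := ht
    subst ht
    rw [c.left_inv_apply (by simp) x] at h
    exact lt_irrefl _ h

theorem collarInv_coord (c : Collar n B X)
    (ψ : OpenPartialHomeomorph X (EuclideanSpace ℝ (Fin n))) {z : ℝ × EuclideanSpace ℝ (Fin n)}
    (hz : z ∈ Ico (0 : ℝ) 1 ×ˢ ψ.target) : collarInv c ψ (collarCoord c ψ z) = z := by
  unfold collarInv collarCoord
  rw [c.left_inv_apply hz.1]
  simp [ψ.right_inv hz.2]

theorem collarCoord_inv (c : Collar n B X)
    (ψ : OpenPartialHomeomorph X (EuclideanSpace ℝ (Fin n))) {y : B} {J : Set ℝ}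
    (hy : y ∈ collarReg c ψ J) : collarCoord c ψ (collarInv c ψ y) = y := by
  unfold collarInv collarCoord
  have : (c.invFun y).2 ∈ ψ.source := hy.2.2
  simp only [ψ.left_inv this]
  exact c.right_inv_apply hy.1

theorem image_collarCoord (c : Collar n B X)
    (ψ : OpenPartialHomeomorph X (EuclideanSpace ℝ (Fin n))) {J : Set ℝ} (hJ : J ⊆ Ico 0 1) :
    collarCoord c ψ '' (J ×ˢ ψ.target) = collarReg c ψ J := by
  ext y
  constructor
  · rintro ⟨z, hz, rfl⟩
    refine ⟨c.map_mem (hJ hz.1) _, ?_⟩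
    change c.invFun (c.toFun (z.1, ψ.symm z.2)) ∈ J ×ˢ ψ.source
    rw [c.left_inv_apply (hJ hz.1)]
    exact ⟨hz.1, ψ.map_target hz.2⟩
  · intro hy
    exact ⟨_, ⟨hy.2.1, ψ.map_source hy.2.2⟩, collarCoord_inv c ψ hy⟩

theorem contMDiffOn_collarCoord (c : Collar n B X) [IsManifold (𝓡 n) ∞ X]
    {ψ : OpenPartialHomeomorph X (EuclideanSpace ℝ (Fin n))}
    (hψ : ψ ∈ IsManifold.maximalAtlas (𝓡 n) ∞ X) :
    ContMDiffOn 𝓘(ℝ, ℝ × EuclideanSpace ℝ (Fin n)) (𝓡∂ (n + 1)) ∞ (collarCoord c ψ)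
      (Ico 0 1 ×ˢ ψ.target) := by
  refine c.smooth.comp (ContMDiffOn.prodMk (contDiff_fst.contMDiff.contMDiffOn)
    ((contMDiffOn_symm_of_mem_maximalAtlas hψ).comp contDiff_snd.contMDiff.contMDiffOn
      fun z hz => hz.2)) ?_
  intro z hz
  exact c.mem_source hz.1 _

theorem contMDiffOn_collarInv (c : Collar n B X) [IsManifold (𝓡 n) ∞ X]
    {ψ : OpenPartialHomeomorph X (EuclideanSpace ℝ (Fin n))}
    (hψ : ψ ∈ IsManifold.maximalAtlas (𝓡 n) ∞ X) (J : Set ℝ) :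
    ContMDiffOn (𝓡∂ (n + 1)) 𝓘(ℝ, ℝ × EuclideanSpace ℝ (Fin n)) ∞ (collarInv c ψ)
      (collarReg c ψ J) := by
  have h := c.smooth_symm.mono (inter_subset_left : collarReg c ψ J ⊆ _)
  refine ContMDiffOn.prodMk_space (contMDiff_fst.comp_contMDiffOn h) ?_
  exact (contMDiffOn_of_mem_maximalAtlas hψ).comp (contMDiff_snd.comp_contMDiffOn h)
    fun y hy => hy.2.2

/-- The patch in the collar over a chart of the cross-section. -/
def colPatch [IsManifold (𝓡 n) ∞ X] (c : Collar n B X)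
    (ψ : OpenPartialHomeomorph X (EuclideanSpace ℝ (Fin n)))
    (hψ : ψ ∈ IsManifold.maximalAtlas (𝓡 n) ∞ X) :
    Patch n B (ℝ × EuclideanSpace ℝ (Fin n)) (Option (Fin n)) where
  toFrame := coneFrame n ψ.target ψ.open_target
  κ := collarCoord c ψ
  inv := collarInv c ψ
  left_inv z hz := collarInv_coord c ψ ⟨Ioo_subset_Ico_self hz.1, hz.2⟩
  image_open := by
    change IsOpen (collarCoord c ψ '' (Ioo 0 1 ×ˢ ψ.target))
    rw [image_collarCoord c ψ Ioo_subset_Ico_self]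
    exact isOpen_collarReg c ψ isOpen_Ioo
  image_sub := by
    change collarCoord c ψ '' (Ioo 0 1 ×ˢ ψ.target) ⊆ _
    rw [image_collarCoord c ψ Ioo_subset_Ico_self]
    intro y hy
    exact (c.mem_interior_iff hy.1).2 hy.2.1.1
  smooth := (contMDiffOn_collarCoord c hψ).mono (prod_mono Ioo_subset_Ico_self subset_rfl)
  smooth_inv := by
    change ContMDiffOn _ _ _ _ (collarCoord c ψ '' (Ioo 0 1 ×ˢ ψ.target))
    rw [image_collarCoord c ψ Ioo_subset_Ico_self]
    exact contMDiffOn_collarInv c hψ _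

theorem reg_colPatch [IsManifold (𝓡 n) ∞ X] (c : Collar n B X)
    {ψ : OpenPartialHomeomorph X (EuclideanSpace ℝ (Fin n))}
    (hψ : ψ ∈ IsManifold.maximalAtlas (𝓡 n) ∞ X) :
    (colPatch c ψ hψ).reg = collarReg c ψ (Ioo 0 1) :=
  image_collarCoord c ψ Ioo_subset_Ico_self

end Collar

instance volume_prod_isAddHaarMeasure {n : ℕ} :
    (volume : Measure (ℝ × EuclideanSpace ℝ (Fin n))).IsAddHaarMeasure :=
  Measure.prod.instIsAddHaarMeasure _ _

/-! ### Densities -/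

section Dens

variable {n : ℕ} {B X : Type*} [TopologicalSpace B]
  [ChartedSpace (EuclideanHalfSpace (n + 1)) B] [IsManifold (𝓡∂ (n + 1)) ∞ B] [TopologicalSpace X]
  [ChartedSpace (EuclideanSpace ℝ (Fin n)) X] [IsManifold (𝓡 n) ∞ X]
  [MeasurableSpace B] [BorelSpace B] {c : Collar n B X} {m : Measure B}

theorem IsConeMeasure.exists_isDens_int (hm : IsConeMeasure c m)
    {e : OpenPartialHomeomorph B (EuclideanHalfSpace (n + 1))}
    (he : e ∈ IsManifold.maximalAtlas (𝓡∂ (n + 1)) ∞ B) :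
    ∃ ρ, Patch.IsDens (intPatch e he) m ρ := by
  obtain ⟨ρ, h1, h2, h3⟩ := hm.interior e he
  exact ⟨ρ, h1, h2, h3⟩

/-- The factor ρ is kept apart from t^n because its smoothness and positivity up to t = 0 are needed
for the pairing and for the transposes of the collar fields. -/
theorem IsConeMeasure.exists_isDens_col (hm : IsConeMeasure c m)
    {ψ : OpenPartialHomeomorph X (EuclideanSpace ℝ (Fin n))}
    (hψ : ψ ∈ IsManifold.maximalAtlas (𝓡 n) ∞ X) :
    ∃ ρ, ContDiffOn ℝ ∞ ρ (Ico 0 1 ×ˢ ψ.target) ∧ (∀ z ∈ Ico (0 : ℝ) 1 ×ˢ ψ.target, 0 < ρ z) ∧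
      Patch.IsDens (colPatch c ψ hψ) m fun z => z.1 ^ n * ρ z := by
  obtain ⟨ρ, h1, h2, h3⟩ := hm.collar ψ hψ
  have hs : Ioo (0 : ℝ) 1 ×ˢ ψ.target ⊆ Ico (0 : ℝ) 1 ×ˢ ψ.target :=
    prod_mono Ioo_subset_Ico_self subset_rfl
  refine ⟨ρ, h1, h2, ?_, ?_, h3⟩
  · exact (contDiff_fst.pow n).contDiffOn.mul (h1.mono hs)
  · intro z hz
    exact mul_pos (pow_pos hz.1.1 n) (h2 z (hs hz))

end Dens

/-! ### Partitions of unity -/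

theorem exists_chart_partition {E H M : Type*} [NormedAddCommGroup E] [NormedSpace ℝ E]
    [FiniteDimensional ℝ E] [TopologicalSpace H] (I : ModelWithCorners ℝ E H) [TopologicalSpace M]
    [ChartedSpace H M] [IsManifold I ∞ M] [T2Space M] [CompactSpace M] :
    ∃ (t : Finset M) (χ : t → M → ℝ), (∀ i, ContMDiff I 𝓘(ℝ, ℝ) ∞ (χ i)) ∧
      (∀ i, tsupport (χ i) ⊆ (chartAt H (i : M)).source) ∧ ∀ x, ∑ i, χ i x = 1 := by
  obtain ⟨t, ht⟩ := isCompact_univ.elim_finite_subcover (fun x : M => (chartAt H x).source)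
    (fun x => (chartAt H x).open_source) (fun x _ => mem_iUnion.2 ⟨x, mem_chart_source H x⟩)
  obtain ⟨f, hf⟩ := SmoothPartitionOfUnity.exists_isSubordinate I isClosed_univ
    (fun i : t => (chartAt H (i : M)).source) (fun i => (chartAt H _).open_source) (by
      intro x hx
      obtain ⟨i, hi, hx⟩ := mem_iUnion₂.1 (ht hx)
      exact mem_iUnion.2 ⟨⟨i, hi⟩, hx⟩)
  refine ⟨t, fun i => f i, fun i => (f i).contMDiff, hf, fun x => ?_⟩
  have := f.sum_eq_one (mem_univ x)
  rwa [finsum_eq_sum_of_fintype] at this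

/-! ### Multiplication operators on test functions -/

section

variable {n : ℕ} {B : Type*} [TopologicalSpace B]
  [ChartedSpace (EuclideanHalfSpace (n + 1)) B]

theorem ContMDiff.ofReal_comp {χ : B → ℝ} (h : ContMDiff (𝓡∂ (n + 1)) 𝓘(ℝ, ℝ) ∞ χ) :
    ContMDiff (𝓡∂ (n + 1)) 𝓘(ℝ, ℂ) ∞ (fun y => (χ y : ℂ)) :=
  Complex.ofRealCLM.contDiff.contMDiff.comp h

theorem tsupport_ofReal {X : Type*} [TopologicalSpace X] (χ : X → ℝ) :
    tsupport (fun y => (χ y : ℂ)) = tsupport χ := by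
  simp [tsupport, Function.support]

theorem ContMDiffOn.mul_complex {f g : B → ℂ} {U : Set B}
    (hf : ContMDiffOn (𝓡∂ (n + 1)) 𝓘(ℝ, ℂ) ∞ f U) (hg : ContMDiffOn (𝓡∂ (n + 1)) 𝓘(ℝ, ℂ) ∞ g U) :
    ContMDiffOn (𝓡∂ (n + 1)) 𝓘(ℝ, ℂ) ∞ (fun y => f y * g y) U :=
  (contDiff_mul (𝕜 := ℝ) (𝔸 := ℂ)).contMDiff.comp_contMDiffOn (hf.prodMk_space hg)

variable [IsManifold (𝓡∂ (n + 1)) ∞ B]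

theorem isOpen_interior_manifold : IsOpen ((𝓡∂ (n + 1)).interior B) :=
  (𝓡∂ (n + 1)).isOpen_interior (n := ∞) (by simp)

/-- Multiplication by a function which is smooth in the interior. -/
def mulOp (a : B → ℂ) (ha : ContMDiffOn (𝓡∂ (n + 1)) 𝓘(ℝ, ℂ) ∞ a ((𝓡∂ (n + 1)).interior B)) :
    testFun n B →ₗ[ℂ] testFun n B where
  toFun φ := ⟨fun y => a y * (φ : B → ℂ) y,
    contMDiff_of_region isOpen_interior_manifold (isClosed_tsupport (φ : B → ℂ)) φ.2.2.2
      (ha.mul_complex φ.2.1.contMDiffOn)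
      (fun y hy => by simp [image_eq_zero_of_notMem_tsupport hy]),
    φ.2.2.1.mul_left, tsupport_mul_subset_right.trans φ.2.2.2⟩
  map_add' φ ψ := by
    apply Subtype.ext; funext y
    change a y * ((φ : B → ℂ) y + (ψ : B → ℂ) y) = a y * (φ : B → ℂ) y + a y * (ψ : B → ℂ) y
    ring
  map_smul' r φ := by
    apply Subtype.ext; funext y
    change a y * (r * (φ : B → ℂ) y) = r * (a y * (φ : B → ℂ) y)
    ring

theorem mulOp_apply (a : B → ℂ) (ha) (φ : testFun n B) (y : B) :
    (mulOp a ha φ : B → ℂ) y = a y * (φ : B → ℂ) y := rfl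

theorem tsupport_mulOp_left (a : B → ℂ) (ha) (φ : testFun n B) :
    tsupport (mulOp a ha φ : B → ℂ) ⊆ tsupport a := tsupport_mul_subset_left

theorem tsupport_mulOp_right (a : B → ℂ) (ha) (φ : testFun n B) :
    tsupport (mulOp a ha φ : B → ℂ) ⊆ tsupport (φ : B → ℂ) := tsupport_mul_subset_right

theorem testFun_eq_zero (φ : testFun n B) {y : B} (hy : y ∉ (𝓡∂ (n + 1)).interior B) :
    (φ : B → ℂ) y = 0 :=
  image_eq_zero_of_notMem_tsupport fun h => hy (φ.2.2.2 h)

theorem testFun_sum_apply {κ : Type*} (s : Finset κ) (φ : κ → testFun n B) (y : B) :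
    ((∑ i ∈ s, φ i : testFun n B) : B → ℂ) y = ∑ i ∈ s, (φ i : B → ℂ) y := by
  rw [Submodule.coe_sum, Finset.sum_apply]

end

/-! ### Operators with admissible coefficients in all patches -/

section LocOp

variable {n : ℕ}

/-- `t^w c` is smooth up to `t = 0`. -/
def ConeAdm (U : Set (EuclideanSpace ℝ (Fin n))) (w : ℕ)
    (c : ℝ × EuclideanSpace ℝ (Fin n) → ℂ) : Prop :=
  ∃ F : ℝ × EuclideanSpace ℝ (Fin n) → ℂ, ContDiffOn ℝ ∞ F (Ico 0 1 ×ˢ U) ∧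
    ∀ z ∈ Ioo (0 : ℝ) 1 ×ˢ U, (z.1 : ℂ) ^ w * c z = F z

theorem prod_Ioo_subset {β : Type*} (U : Set β) : Ioo (0 : ℝ) 1 ×ˢ U ⊆ Ico (0 : ℝ) 1 ×ˢ U :=
  prod_mono Ioo_subset_Ico_self subset_rfl

theorem contDiff_fst_pow (w : ℕ) : ContDiff ℝ ∞
    (fun z : ℝ × EuclideanSpace ℝ (Fin n) => (z.1 : ℂ) ^ w) :=
  (Complex.ofRealCLM.contDiff.comp contDiff_fst).pow w

theorem fst_ne_zero {U : Set (EuclideanSpace ℝ (Fin n))} {z : ℝ × EuclideanSpace ℝ (Fin n)}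
    (hz : z ∈ Ioo (0 : ℝ) 1 ×ˢ U) : (z.1 : ℂ) ≠ 0 :=
  Complex.ofReal_ne_zero.2 (ne_of_gt hz.1.1)

theorem ConeAdm.smooth {U : Set (EuclideanSpace ℝ (Fin n))} {w : ℕ}
    {c : ℝ × EuclideanSpace ℝ (Fin n) → ℂ} (h : ConeAdm U w c) :
    ContDiffOn ℝ ∞ c (Ioo 0 1 ×ˢ U) := by
  obtain ⟨F, hF, hc⟩ := h
  have h1 : ContDiffOn ℝ ∞ (fun z : ℝ × EuclideanSpace ℝ (Fin n) => ((z.1 : ℂ) ^ w)⁻¹)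
      (Ioo 0 1 ×ˢ U) :=
    (contDiff_fst_pow w).contDiffOn.inv fun z hz => pow_ne_zero _ (fst_ne_zero hz)
  refine (h1.mul (hF.mono (prod_Ioo_subset U))).congr fun z hz => ?_
  have := pow_ne_zero w (fst_ne_zero hz)
  rw [← hc z hz]
  field_simp

/-- t^w is an eigenfunction of every field: t∂_t t^w = w t^w and ∂_{x_i} t^w = 0. This is why the
fields preserve powers of t in coefficients and densities. -/
theorem coneFrame_X_pow {U : Set (EuclideanSpace ℝ (Fin n))} (hU : IsOpen U) (w : ℕ)
    (i : Option (Fin n)) : ∃ r : ℂ, ∀ z,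
      (coneFrame n U hU).X i (fun z => (z.1 : ℂ) ^ w) z = r * (z.1 : ℂ) ^ w := by
  have hf : ∀ z v : ℝ × EuclideanSpace ℝ (Fin n),
      fderiv ℝ (fun z : ℝ × EuclideanSpace ℝ (Fin n) => (z.1 : ℂ) ^ w) z v =
        w * (z.1 : ℂ) ^ (w - 1) * v.1 := by
    intro z v
    have hd : HasDerivAt (fun t : ℝ => (t : ℂ) ^ w) (w * (z.1 : ℂ) ^ (w - 1)) z.1 :=
      (hasDerivAt_pow w (z.1 : ℂ)).comp_ofReal
    have := (hd.hasFDerivAt.comp z hasFDerivAt_fst).fderiv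
    change fderiv ℝ ((fun t : ℝ => (t : ℂ) ^ w) ∘ Prod.fst) z v = _
    rw [this]
    simp
    ring
  rcases i with _ | i
  · refine ⟨w, fun z => ?_⟩
    simp only [Frame.X, hf]
    rcases Nat.eq_zero_or_pos w with rfl | hw
    · simp
    · obtain ⟨w, rfl⟩ : ∃ v, w = v + 1 := ⟨w - 1, by omega⟩
      simp [coneFrame, pow_succ]
      ring
  · refine ⟨0, fun z => ?_⟩
    simp only [Frame.X, hf]
    simp [coneFrame]

/-- If t^w c = F, then X F = r t^w c + t^w X c with the eigenvalue r of t^w, so t^w X c = X F − r F.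
Derivatives of F within [0,1) × U are again smooth up to t = 0, since that set has unique
differentials. -/
theorem ConeAdm.X {U : Set (EuclideanSpace ℝ (Fin n))} (hU : IsOpen U) {w : ℕ}
    {c : ℝ × EuclideanSpace ℝ (Fin n) → ℂ} (h : ConeAdm U w c) (i : Option (Fin n)) :
    ConeAdm U w ((coneFrame n U hU).X i c) := by
  have hcs := h.smooth
  obtain ⟨F, hF, hc⟩ := h
  obtain ⟨r, hr⟩ := coneFrame_X_pow hU w i
  have hu : UniqueDiffOn ℝ (Ico (0 : ℝ) 1 ×ˢ U) := (uniqueDiffOn_Ico 0 1).prod hU.uniqueDiffOn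
  refine ⟨fun z => (coneFrame n U hU).wt i z *
    fderivWithin ℝ F (Ico (0 : ℝ) 1 ×ˢ U) z ((coneFrame n U hU).vec i) - r * F z, ?_, ?_⟩
  · refine ContDiffOn.sub ?_ (contDiffOn_const.mul hF)
    exact ((coneFrame n U hU).wt_smooth i).contDiffOn.mul
      ((hF.fderivWithin hu (by simp)).clm_apply contDiffOn_const)
  · intro z hz
    have hz' : z ∈ (coneFrame n U hU).dom := hz
    have hO : IsOpen (Ioo (0 : ℝ) 1 ×ˢ U) := isOpen_Ioo.prod hU
    have e1 := Frame.X_mul (P := coneFrame n U hU) i (contDiff_fst_pow w).contDiffOn hcs hz'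
    have e2 : (coneFrame n U hU).X i (fun y => (y.1 : ℂ) ^ w * c y) z =
        (coneFrame n U hU).X i F z :=
      Frame.X_congr (P := coneFrame n U hU) i hO (fun y hy => hc y hy) hz
    have e3 : fderivWithin ℝ F (Ico (0 : ℝ) 1 ×ˢ U) z = fderiv ℝ F z :=
      fderivWithin_of_mem_nhds (mem_of_superset (hO.mem_nhds hz) (prod_Ioo_subset U))
    rw [e2, hr] at e1
    simp only [e3]
    rw [← hc z hz]
    have e4 : (coneFrame n U hU).X i F z = (coneFrame n U hU).wt i z *
      fderiv ℝ F z ((coneFrame n U hU).vec i) := rfl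
    rw [← e4, e1]
    ring

variable {B X : Type*} [TopologicalSpace B]
  [ChartedSpace (EuclideanHalfSpace (n + 1)) B] [IsManifold (𝓡∂ (n + 1)) ∞ B] [TopologicalSpace X]
  [ChartedSpace (EuclideanSpace ℝ (Fin n)) X] [IsManifold (𝓡 n) ∞ X]

/-- In all interior charts and in the collar, `A` is a differential operator of order `μ`, where
in the collar the coefficients with respect to `t ∂_t` and `∂_x` are `t^{-w}` times functions which
are smooth up to `t = 0`. -/
structure IsLocOp (c : Collar n B X) (μ w : ℕ) (A : testFun n B →ₗ[ℂ] testFun n B) : Prop where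
  int : ∀ e (he : e ∈ IsManifold.maximalAtlas (𝓡∂ (n + 1)) ∞ B),
    ∃ L : List ((EuclideanSpace ℝ (Fin (n + 1)) → ℂ) × (Fin (n + 1) → ℕ)),
      (∀ x ∈ L, ContDiffOn ℝ ∞ x.1 (chartDom e) ∧ ∑ i, x.2 i ≤ μ) ∧ (intPatch e he).IsOpList A L
  col : ∀ ψ (hψ : ψ ∈ IsManifold.maximalAtlas (𝓡 n) ∞ X),
    ∃ L : List ((ℝ × EuclideanSpace ℝ (Fin n) → ℂ) × (Option (Fin n) → ℕ)),
      (∀ x ∈ L, ConeAdm ψ.target w x.1 ∧ ∑ i, x.2 i ≤ μ) ∧ (colPatch c ψ hψ).IsOpList A L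

theorem Frame.D_fun_zero {E ι : Type*} [NormedAddCommGroup E] [NormedSpace ℝ E] (P : Frame E ι)
    (m : ι → ℕ) (z : E) : P.D m (fun _ => 0) z = 0 := by
  refine image_eq_zero_of_notMem_tsupport fun h => ?_
  have h1 := Frame.D_support m _ h
  have : tsupport (fun _ : E => (0 : ℂ)) = ∅ := tsupport_eq_empty_iff.2 rfl
  rw [this] at h1
  exact h1

theorem Patch.isOpList_eq_zero {E ι : Type*} [NormedAddCommGroup E] [NormedSpace ℝ E]
    {Q : Patch n B E ι} {A : testFun n B →ₗ[ℂ] testFun n B} {L : List ((E → ℂ) × (ι → ℕ))}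
    (hA : Q.IsOpList A L) (φ : testFun n B) {y : B} (hy : y ∈ Q.reg)
    (hφ : y ∉ tsupport (φ : B → ℂ)) : (A φ : B → ℂ) y = 0 := by
  obtain ⟨z, hz, rfl⟩ := hy
  rw [hA φ z hz]
  have hU : IsOpen (Q.dom ∩ Q.κ ⁻¹' (tsupport (φ : B → ℂ))ᶜ) :=
    Q.smooth.continuousOn.isOpen_inter_preimage Q.isOpen_dom (isClosed_tsupport _).isOpen_compl
  have : ∀ m, Q.D m ((φ : B → ℂ) ∘ Q.κ) z = 0 := by
    intro m
    rw [Frame.D_congr (P := Q.toFrame) m hU (g := fun _ => 0) (fun w hw => ?_) ⟨hz, hφ⟩,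
      Frame.D_fun_zero]
    exact image_eq_zero_of_notMem_tsupport (f := (φ : B → ℂ)) hw.2
  simp [Frame.comb, this]

/-- Differential operators do not enlarge supports. Interior charts suffice, because test functions
vanish at boundary points. -/
theorem IsLocOp.tsupport_subset {c : Collar n B X} {μ w : ℕ}
    {A : testFun n B →ₗ[ℂ] testFun n B} (hA : IsLocOp c μ w A) (φ : testFun n B) :
    tsupport (A φ : B → ℂ) ⊆ tsupport (φ : B → ℂ) := by
  refine Patch.tsupport_subset_of (isClosed_tsupport _) fun y hy => ?_
  by_cases hi : y ∈ (𝓡∂ (n + 1)).interior B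
  · have hc := IsManifold.chart_mem_maximalAtlas (I := 𝓡∂ (n + 1)) (n := ∞) y
    obtain ⟨L, -, hL⟩ := hA.int _ hc
    exact Patch.isOpList_eq_zero hL φ (by rw [reg_intPatch]; exact ⟨mem_chart_source _ y, hi⟩) hy
  · exact testFun_eq_zero _ hi

theorem SobolevLoc.exists_fam {K : ℕ} {p : ℝ} {f : B → ℂ} (hf : SobolevLoc n K p f)
    {e : OpenPartialHomeomorph B (EuclideanHalfSpace (n + 1))}
    (he : e ∈ IsManifold.maximalAtlas (𝓡∂ (n + 1)) ∞ B) :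
    ∃ g, (intPatch e he).IsFam K (f ∘ (intPatch e he).κ) g ∧
      ∀ α, ∑ i, α i ≤ K → ∀ S ⊆ chartDom e, IsCompact S →
        MemLp (g α) (ENNReal.ofReal p) (volume.restrict S) := by
  have h := hf e he
  choose! g hg hg' using h
  refine ⟨g, fun α hα => ?_, fun α hα => hg' α (mem_multiIdx.2 hα)⟩
  exact (hasWeakD_iff (isOpen_chartDom e) α _ _).1 (hg α (mem_multiIdx.2 hα))

end LocOp

/-! ### The action of an operator on functions -/

section Glue

variable {n : ℕ} {B X : Type*} [TopologicalSpace B] [T2Space B] [CompactSpace B]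
  [ChartedSpace (EuclideanHalfSpace (n + 1)) B] [IsManifold (𝓡∂ (n + 1)) ∞ B]
  [MeasurableSpace B] [BorelSpace B] {m : Measure B}

theorem locallyIntegrableOn_mul_of_tsupport {G χ : B → ℂ} {U I : Set B}
    (hI : IsOpen I) (hG : LocallyIntegrableOn G (U ∩ I) m) (hχ : Continuous χ)
    (hs : tsupport χ ⊆ U) : LocallyIntegrableOn (fun y => χ y * G y) I m := by
  rw [locallyIntegrableOn_iff hI.isLocallyClosed]
  intro K hK hKc
  have hc : IsCompact (K ∩ tsupport χ) := hKc.inter_right (isClosed_tsupport χ)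
  have h1 : IntegrableOn G (K ∩ tsupport χ) m :=
    hG.integrableOn_compact_subset (fun y hy => ⟨hs hy.2, hK hy.1⟩) hc
  have h2 : IntegrableOn (fun y => χ y * G y) (K ∩ tsupport χ) m :=
    h1.continuousOn_mul hχ.continuousOn hc
  refine h2.of_forall_sdiff_eq_zero hKc.measurableSet fun y hy => ?_
  have : y ∉ tsupport χ := fun h => hy.2 ⟨hy.1, h⟩
  simp [image_eq_zero_of_notMem_tsupport this]

theorem integrable_mul_testFun {f : B → ℂ}
    (hf : LocallyIntegrableOn f ((𝓡∂ (n + 1)).interior B) m) (φ : testFun n B) :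
    Integrable (fun y => f y * (φ : B → ℂ) y) m :=
  hf.integrable_mul_test φ.2.1.continuous φ.2.2.1 φ.2.2.2

/-- The weak derivative of order zero includes local integrability in a chart, which the smooth
density transfers to m. -/
theorem SobolevLoc.locallyIntegrableOn [TopologicalSpace X]
    [ChartedSpace (EuclideanSpace ℝ (Fin n)) X] [IsManifold (𝓡 n) ∞ X] {c : Collar n B X}
    (hm : IsConeMeasure c m) {K : ℕ} {p : ℝ} {f : B → ℂ} (hf : SobolevLoc n K p f) :
    LocallyIntegrableOn f ((𝓡∂ (n + 1)).interior B) m := by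
  intro y hy
  have hc := IsManifold.chart_mem_maximalAtlas (I := 𝓡∂ (n + 1)) (n := ∞) y
  obtain ⟨g, hg, -⟩ := hf.exists_fam hc
  obtain ⟨ρ, hρ⟩ := hm.exists_isDens_int hc
  have h1 := hρ.locallyIntegrableOn (hg 0 (by simp)).1
  have hyr : y ∈ (intPatch _ hc).reg := by rw [reg_intPatch]; exact ⟨mem_chart_source _ y, hy⟩
  have h2 := h1 y hyr
  rw [Patch.isOpen_reg.nhdsWithin_eq hyr] at h2
  exact h2.filter_mono nhdsWithin_le_nhds

variable [TopologicalSpace X] [ChartedSpace (EuclideanSpace ℝ (Fin n)) X]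
  [IsManifold (𝓡 n) ∞ X] {c : Collar n B X}

/-- In each chart of a finite atlas the image of f is a combination h_i of weak derivatives of f.
With a subordinate partition of unity χ_i put f' = ∑ χ_i h_i; decomposing φ = ∑ χ_i φ reduces the
claim to `integral_mul_transpose`. That the h_i agree on overlaps need not be checked. -/
theorem exists_apply (hm : IsConeMeasure c m) {μ w w' K : ℕ} (hμ : μ ≤ K) {p : ℝ}
    {A At : testFun n B →ₗ[ℂ] testFun n B} (hA : IsLocOp c μ w A) (hAt : IsLocOp c μ w' At)
    (hT : IsFormalTranspose m A At) {f : B → ℂ} (hf : SobolevLoc n K p f) :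
    ∃ f' : B → ℂ, LocallyIntegrableOn f' ((𝓡∂ (n + 1)).interior B) m ∧
      ∀ φ : testFun n B, ∫ y, f' y * (φ : B → ℂ) y ∂m = ∫ y, f y * (At φ : B → ℂ) y ∂m := by
  obtain ⟨t, χ, hχ1, hχ2, hχ3⟩ := exists_chart_partition (𝓡∂ (n + 1)) (M := B)
  have hc : ∀ i : t, chartAt (EuclideanHalfSpace (n + 1)) (i : B) ∈
      IsManifold.maximalAtlas (𝓡∂ (n + 1)) ∞ B := fun i =>
    IsManifold.chart_mem_maximalAtlas (I := 𝓡∂ (n + 1)) (n := ∞) (i : B)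
  choose g hg hg' using fun i => hf.exists_fam (hc i)
  choose L hL hL' using fun i => hA.int _ (hc i)
  choose ρ hρ using fun i => hm.exists_isDens_int (hc i)
  set h : t → B → ℂ := fun i => (intPatch _ (hc i)).ext (Frame.comb (L i) (g i)) with hh
  have hLI : ∀ i, LocallyIntegrableOn (h i)
      ((chartAt (EuclideanHalfSpace (n + 1)) (i : B)).source ∩ (𝓡∂ (n + 1)).interior B) m := by
    intro i
    rw [← reg_intPatch (hc i)]
    refine (hρ i).locallyIntegrableOn ?_
    have := Frame.comb_locallyIntegrableOn (hg i) (L := L i) fun x hx =>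
      ⟨(hL i x hx).1, (hL i x hx).2.trans hμ⟩
    refine this.congr_restrict (intPatch _ (hc i)).isOpen_dom ?_
    refine (ae_restrict_iff' (intPatch _ (hc i)).isOpen_dom.measurableSet).2
      (ae_of_all _ fun z hz => ?_)
    exact (Patch.ext_κ _ hz).symm
  have hχc : ∀ i, ContMDiff (𝓡∂ (n + 1)) 𝓘(ℝ, ℂ) ∞ (fun y => (χ i y : ℂ)) :=
    fun i => (hχ1 i).ofReal_comp
  have hχs : ∀ i, tsupport (fun y => (χ i y : ℂ)) ⊆
      (chartAt (EuclideanHalfSpace (n + 1)) (i : B)).source := fun i => by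
    rw [tsupport_ofReal]; exact hχ2 i
  have hLI' : ∀ i, LocallyIntegrableOn (fun y => (χ i y : ℂ) * h i y)
      ((𝓡∂ (n + 1)).interior B) m := fun i =>
    locallyIntegrableOn_mul_of_tsupport isOpen_interior_manifold (hLI i)
      (hχc i).continuous (hχs i)
  have hfI := hf.locallyIntegrableOn hm
  refine ⟨fun y => ∑ i, (χ i y : ℂ) * h i y, ?_, fun φ => ?_⟩
  · have : ∀ s : Finset t, LocallyIntegrableOn (fun y => ∑ i ∈ s, (χ i y : ℂ) * h i y)
        ((𝓡∂ (n + 1)).interior B) m := by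
      classical
      intro s
      induction s using Finset.induction_on with
      | empty => simp only [Finset.sum_empty]; exact locallyIntegrableOn_zero
      | insert i s hi ih =>
        simp only [Finset.sum_insert hi]
        exact (hLI' i).add ih
    exact this _
  · set φi : t → testFun n B := fun i => mulOp _ (hχc i).contMDiffOn φ with hφi
    have hsum : φ = ∑ i, φi i := by
      apply Subtype.ext
      funext y
      rw [testFun_sum_apply]
      simp only [hφi, mulOp_apply]
      rw [← Finset.sum_mul, ← Complex.ofReal_sum, hχ3 y]
      simp
    have e1 : ∀ i, ∫ y, h i y * (φi i : B → ℂ) y ∂m = ∫ y, f y * (At (φi i) : B → ℂ) y ∂m := by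
      intro i
      refine Patch.integral_mul_transpose (hρ i) hT hAt.tsupport_subset (K := K) (hL' i)
        (fun x hx => ⟨(hL i x hx).1, (hL i x hx).2.trans hμ⟩) (hg i) ?_
      rw [reg_intPatch]
      exact subset_inter ((tsupport_mulOp_left _ _ _).trans (hχs i)) (φi i).2.2.2
    have e2 : ∀ y, (∑ i, (χ i y : ℂ) * h i y) * (φ : B → ℂ) y =
        ∑ i, h i y * (φi i : B → ℂ) y := by
      intro y
      simp only [hφi, mulOp_apply, Finset.sum_mul]
      refine Finset.sum_congr rfl fun i _ => ?_
      ring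
    have e3 : ∀ y, f y * (At φ : B → ℂ) y = ∑ i, f y * (At (φi i) : B → ℂ) y := by
      intro y
      conv_lhs => rw [hsum, map_sum, testFun_sum_apply, Finset.mul_sum]
    simp_rw [e2, e3]
    rw [integral_finsetSum _ fun i _ => ?_, integral_finsetSum _ fun i _ =>
      integrable_mul_testFun hfI _]
    · exact Finset.sum_congr rfl fun i _ => e1 i
    · refine (integrable_mul_testFun (hLI' i) φ).congr (ae_of_all _ fun y => ?_)
      simp only [hφi, mulOp_apply]
      ring

/-- In every patch, the operator acts on functions through their weak derivatives. -/
theorem Patch.IsDens.apply_ae_eq {E ι : Type*} [NormedAddCommGroup E] [NormedSpace ℝ E]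
    [FiniteDimensional ℝ E] [MeasureSpace E] [BorelSpace E]
    [(volume : Measure E).IsAddHaarMeasure] [Fintype ι] {Q : Patch n B E ι} {ρ : E → ℝ}
    (hρ : Q.IsDens m ρ) {A At : testFun n B →ₗ[ℂ] testFun n B}
    (hloc : ∀ φ, tsupport (At φ : B → ℂ) ⊆ tsupport (φ : B → ℂ))
    (hT : IsFormalTranspose m A At) {L : List ((E → ℂ) × (ι → ℕ))} {K : ℕ}
    (hA : Q.IsOpList A L) (hL : ∀ x ∈ L, ContDiffOn ℝ ∞ x.1 Q.dom ∧ ∑ i, x.2 i ≤ K)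
    {f f' : B → ℂ} (hf' : LocallyIntegrableOn f' ((𝓡∂ (n + 1)).interior B) m)
    (h : ∀ φ : testFun n B, ∫ y, f' y * (φ : B → ℂ) y ∂m = ∫ y, f y * (At φ : B → ℂ) y ∂m)
    {g : (ι → ℕ) → E → ℂ} (hg : Q.IsFam K (f ∘ Q.κ) g) :
    f' ∘ Q.κ =ᵐ[volume.restrict Q.dom] Frame.comb L g := by
  have hLI : LocallyIntegrableOn (Q.ext (Frame.comb L g)) Q.reg m := by
    refine hρ.locallyIntegrableOn ?_
    refine (Frame.comb_locallyIntegrableOn hg hL).congr_restrict Q.isOpen_dom ?_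
    refine (ae_restrict_iff' Q.isOpen_dom.measurableSet).2 (ae_of_all _ fun z hz => ?_)
    exact (Patch.ext_κ _ hz).symm
  have hf'r : LocallyIntegrableOn f' Q.reg m := hf'.mono_set Q.image_sub
  -- By `integral_mul_transpose`, f' and the local combination give the same integrals against test
  -- functions supported in the patch; the fundamental lemma on the manifold makes them equal almost
  -- everywhere.
  have key := (Patch.isOpen_reg (Q := Q)).ae_eq_zero_of_integral_contMDiff_smul_eq_zero
    (𝓡∂ (n + 1)) (μ := m) (f := fun y => f' y - Q.ext (Frame.comb L g) y) (hf'r.sub hLI) ?_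
  · rw [← ae_restrict_iff' Patch.isOpen_reg.measurableSet, hρ.ae_reg] at key
    have hmem := ae_restrict_mem (μ := (volume : Measure E)) Q.isOpen_dom.measurableSet
    filter_upwards [key, hmem] with z hz hzd
    rw [Patch.ext_κ _ hzd] at hz
    exact sub_eq_zero.1 hz
  · intro η h1 h2 h3
    have hs : tsupport (fun y => (η y : ℂ)) = tsupport η := tsupport_ofReal η
    let φ : testFun n B := ⟨fun y => (η y : ℂ), h1.ofReal_comp,
      (isClosed_tsupport _).isCompact, hs ▸ h3.trans Q.image_sub⟩
    have hφ : tsupport (φ : B → ℂ) ⊆ Q.reg := hs ▸ h3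
    have e1 := h φ
    rw [← Patch.integral_mul_transpose hρ hT hloc hA hL hg hφ, ← sub_eq_zero, ← integral_sub
      (hf'r.integrable_mul_test φ.2.1.continuous φ.2.2.1 hφ)
      (hLI.integrable_mul_test φ.2.1.continuous φ.2.2.1 hφ)] at e1
    rw [← e1]
    congr 1
    funext y
    simp only [Complex.real_smul, φ]
    ring

end Glue

/-! ### Weighted norms of weak derivatives -/

namespace Frame

variable {E ι : Type*} [NormedAddCommGroup E] [NormedSpace ℝ E] [FiniteDimensional ℝ E]
  [MeasureSpace E] [BorelSpace E] [(volume : Measure E).IsAddHaarMeasure] [Fintype ι]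
  {P : Frame E ι}

theorem HasW.add {m : ι → ℕ} {f f' g g' : E → ℂ} (h : P.HasW m f g) (h' : P.HasW m f' g') :
    P.HasW m (fun z => f z + f' z) (fun z => g z + g' z) := by
  refine ⟨h.1.add h'.1, h.2.1.add h'.2.1, fun η hη => ?_⟩
  simp only [add_mul]
  rw [integral_add (integrable_mul_mul_q h.1 (D_test m hη))
    (integrable_mul_mul_q h'.1 (D_test m hη)), integral_add (integrable_mul_mul_q h.2.1 hη)
    (integrable_mul_mul_q h'.2.1 hη), h.2.2 η hη, h'.2.2 η hη, mul_add]

theorem HasW.const_mul {m : ι → ℕ} {f g : E → ℂ} (a : ℂ) (h : P.HasW m f g) :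
    P.HasW m (fun z => a * f z) (fun z => a * g z) := by
  refine ⟨h.1.smul a, h.2.1.smul a, fun η hη => ?_⟩
  simp only [mul_assoc]
  rw [integral_const_mul, integral_const_mul]
  have := h.2.2 η hη
  simp only [mul_assoc] at this
  rw [this]
  ring

theorem hasW_zero {f : E → ℂ} (hf : LocallyIntegrableOn f P.dom) : P.HasW 0 f f :=
  ⟨hf, hf, fun η _ => by simp [D_zero]⟩

variable (P) in
/-- The norm of `W * D^m f` in `L^p(ν)`. -/
def term (W : E → ℂ) (p : ℝ≥0∞) (ν : Measure E) (f : E → ℂ) (m : ι → ℕ) : ℝ≥0∞ :=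
  ⨅ (g) (_ : P.HasW m f g), eLpNorm (fun z => W z * g z) p ν

variable {W W' : E → ℂ} {p : ℝ≥0∞} {ν : Measure E} {f f' : E → ℂ} {m : ι → ℕ}

theorem term_le {g : E → ℂ} (h : P.HasW m f g) :
    P.term W p ν f m ≤ eLpNorm (fun z => W z * g z) p ν := iInf₂_le g h

/-- Weak derivatives are unique almost everywhere, so the infimum runs over at most one value. -/
theorem term_eq (hν : ν ≪ volume.restrict P.dom) {g : E → ℂ} (h : P.HasW m f g) :
    P.term W p ν f m = eLpNorm (fun z => W z * g z) p ν := by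
  refine le_antisymm (term_le h) (le_iInf₂ fun g' h' => le_of_eq (eLpNorm_congr_ae ?_))
  filter_upwards [hν.ae_le (h.unique h')] with z hz
  rw [hz]

theorem exists_hasW_of_term_lt (h : P.term W p ν f m < ⊤) : ∃ g, P.HasW m f g := by
  by_contra! hh
  have : P.term W p ν f m = ⊤ := by simp [term, hh]
  exact h.ne this

/-- The scalar must be nonzero: without a weak derivative the term is ⊤, and 0 · ⊤ = 0 would make
the bound false in general. -/
theorem term_const_mul_le (a : ℂ) (ha : a ≠ 0) (hν : ν ≪ volume.restrict P.dom) :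
    P.term W p ν (fun z => a * f z) m ≤ ‖a‖ₑ * P.term W p ν f m := by
  by_cases h : P.term W p ν f m < ⊤
  · obtain ⟨g, hg⟩ := exists_hasW_of_term_lt h
    refine (term_le (hg.const_mul a)).trans ?_
    rw [term_eq hν hg]
    have : (fun z => W z * (a * g z)) = a • fun z => W z * g z := by
      funext z; simp only [Pi.smul_apply, smul_eq_mul]; ring
    rw [this]
    exact eLpNorm_const_smul_le
  · rw [not_lt, top_le_iff] at h
    rw [h, ENNReal.mul_top (by simpa using ha)]
    exact le_top

theorem HasW.aestronglyMeasurable (h : P.HasW m f f') (hν : ν ≪ volume.restrict P.dom) :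
    AEStronglyMeasurable f' ν :=
  h.2.1.aestronglyMeasurable.mono_ac hν

theorem term_add_le (hp : 1 ≤ p) (hν : ν ≪ volume.restrict P.dom) (hW : AEStronglyMeasurable W ν) :
    P.term W p ν (fun z => f z + f' z) m ≤ P.term W p ν f m + P.term W p ν f' m := by
  by_cases h : P.term W p ν f m < ⊤
  · by_cases h' : P.term W p ν f' m < ⊤
    · obtain ⟨g, hg⟩ := exists_hasW_of_term_lt h
      obtain ⟨g', hg'⟩ := exists_hasW_of_term_lt h'
      refine (term_le (hg.add hg')).trans ?_
      rw [term_eq hν hg, term_eq hν hg']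
      have : (fun z => W z * (g z + g' z)) = (fun z => W z * g z) + fun z => W z * g' z := by
        funext z; simp only [Pi.add_apply]; ring
      rw [this]
      exact eLpNorm_add_le (hW.mul (hg.aestronglyMeasurable hν))
        (hW.mul (hg'.aestronglyMeasurable hν)) hp
    · rw [not_lt, top_le_iff] at h'
      simp [h']
  · rw [not_lt, top_le_iff] at h
    simp [h]

/-- A combination of weak derivatives has a norm which is controlled by the norms of the
derivatives. -/
theorem exists_eLpNorm_comb_le {Adm : (E → ℂ) → Prop} (hsm : ∀ c, Adm c → ContDiffOn ℝ ∞ c P.dom)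
    (hp : 1 ≤ p) (hν : ν ≪ volume.restrict P.dom) (hW : AEStronglyMeasurable W ν)
    (hb : ∀ c, Adm c → ∃ C : ℝ≥0, ∀ᵐ z ∂ν, ‖W z * c z‖₊ ≤ C * ‖W' z‖₊)
    (L : List ((E → ℂ) × (ι → ℕ))) (k : ℕ) (hL : ∀ x ∈ L, Adm x.1 ∧ ∑ i, x.2 i ≤ k) :
    ∃ C : ℝ≥0, ∀ f g, P.IsFam k f g → ∀ T : ℝ≥0∞,
      (∀ m, ∑ i, m i ≤ k → P.term W' p ν f m ≤ T) →
        AEStronglyMeasurable (fun z => W z * comb L g z) ν ∧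
        eLpNorm (fun z => W z * comb L g z) p ν ≤ C * T := by
  induction L with
  | nil =>
    refine ⟨0, fun f g _ T _ => ?_⟩
    have : (fun z => W z * comb [] g z) = fun _ => 0 := by funext z; simp [comb]
    rw [this]
    exact ⟨aestronglyMeasurable_const, by simp⟩
  | cons x L ih =>
    obtain ⟨C, hC⟩ := ih fun y hy => hL y (by simp [hy])
    obtain ⟨hx1, hx2⟩ := hL x (by simp)
    -- The weight `W` times the coefficient is dominated by the weight `W'`, so a bound with `W'`
    -- for the derivative suffices. The constant depends on the coefficient alone.
    obtain ⟨C', hC'⟩ := hb x.1 hx1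
    refine ⟨C' + C, fun f g hg T hT => ?_⟩
    obtain ⟨h1, h2⟩ := hC f g hg T hT
    have e : (fun z => W z * comb (x :: L) g z) =
        (fun z => W z * (x.1 z * g x.2 z)) + fun z => W z * comb L g z := by
      funext z; simp only [comb_cons, Pi.add_apply]; ring
    have m1 : AEStronglyMeasurable x.1 ν :=
      (((hsm _ hx1).continuousOn.locallyIntegrableOn
        P.isOpen_dom.measurableSet).aestronglyMeasurable).mono_ac hν
    have m2 : AEStronglyMeasurable (fun z => W z * (x.1 z * g x.2 z)) ν :=
      hW.mul (m1.mul ((hg _ hx2).aestronglyMeasurable hν))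
    have b : eLpNorm (fun z => W z * (x.1 z * g x.2 z)) p ν ≤ C' * T := by
      have := eLpNorm_le_nnreal_smul_eLpNorm_of_ae_le_mul (μ := ν) (c := C')
        (f := fun z => W z * (x.1 z * g x.2 z)) (g := fun z => W' z * g x.2 z) ?_ p
      · refine this.trans ?_
        rw [← term_eq hν (hg _ hx2)]
        exact mul_le_mul_right (hT _ hx2) _
      · filter_upwards [hC'] with z hz
        rw [← mul_assoc, nnnorm_mul, nnnorm_mul (W' z), ← mul_assoc]
        exact mul_le_mul_left hz _
    rw [e]
    refine ⟨m2.add h1, (eLpNorm_add_le m2 h1 hp).trans ?_⟩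
    rw [ENNReal.coe_add, add_mul]
    exact add_le_add b h2

/-- The norms of the weak derivatives of a combination of weak derivatives. -/
theorem exists_term_comb_le {Adm : (E → ℂ) → Prop} (hsm : ∀ c, Adm c → ContDiffOn ℝ ∞ c P.dom)
    (hX : ∀ i c, Adm c → Adm (P.X i c)) (hp : 1 ≤ p) (hν : ν ≪ volume.restrict P.dom)
    (hW : AEStronglyMeasurable W ν)
    (hb : ∀ c, Adm c → ∃ C : ℝ≥0, ∀ᵐ z ∂ν, ‖W z * c z‖₊ ≤ C * ‖W' z‖₊)
    (L : List ((E → ℂ) × (ι → ℕ))) (k N : ℕ) (hL : ∀ x ∈ L, Adm x.1 ∧ ∑ i, x.2 i ≤ k)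
    (m : ι → ℕ) (hm : ∑ i, m i ≤ N) :
    ∃ C : ℝ≥0, ∀ f f' g, P.IsFam (N + k) f g → f' =ᵐ[volume.restrict P.dom] comb L g →
      ∀ T : ℝ≥0∞, (∀ m, ∑ i, m i ≤ N + k → P.term W' p ν f m ≤ T) →
        P.term W p ν f' m ≤ C * T := by
  -- The list for the differentiated combination is fixed before f is introduced, which makes the
  -- constant independent of f.
  obtain ⟨L', hL', h⟩ := exists_comb_hasW hsm hX _ m rfl L k hL
  have hle : k + ∑ i, m i ≤ N + k := by omega
  obtain ⟨C, hC⟩ := exists_eLpNorm_comb_le hsm hp hν hW hb L' (N + k) fun x hx =>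
    ⟨(hL' x hx).1, (hL' x hx).2.trans hle⟩
  refine ⟨C, fun f f' g hg hf' T hT => ?_⟩
  have h1 := h f g fun m hm => hg m (hm.trans hle)
  have h2 := h1.congr hf'.symm (ae_eq_refl _)
  exact (term_le h2).trans (hC f g hg T hT).2

end Frame

/-! ### The norms of the cone Sobolev spaces -/

section Norms

variable {n : ℕ} {B X : Type*} [TopologicalSpace B] [T2Space B] [CompactSpace B]
  [ChartedSpace (EuclideanHalfSpace (n + 1)) B] [IsManifold (𝓡∂ (n + 1)) ∞ B]
  [TopologicalSpace X] [T2Space X] [CompactSpace X] [ChartedSpace (EuclideanSpace ℝ (Fin n)) X]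
  [IsManifold (𝓡 n) ∞ X] {c : Collar n B X}

/-- The measure of the interior terms. -/
def intMeas (D : NormData c) (i : Fin D.N) : Measure (EuclideanSpace ℝ (Fin (n + 1))) :=
  volume.restrict ((D.chart i).extend (𝓡∂ (n + 1)) '' D.piece i)

theorem piece_image_subset (D : NormData c) (i : Fin D.N) :
    (D.chart i).extend (𝓡∂ (n + 1)) '' D.piece i ⊆ chartDom (D.chart i) := by
  rintro _ ⟨y, hy, rfl⟩
  have := D.piece_subset i hy
  exact (mem_interior_iff_of_maximalAtlas (D.chart_mem i) this.1).1 this.2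

theorem isCompact_piece_image (D : NormData c) (i : Fin D.N) :
    IsCompact ((D.chart i).extend (𝓡∂ (n + 1)) '' D.piece i) := by
  refine (D.piece_compact i).image_of_continuousOn
    (((D.chart i).continuousOn_extend (I := 𝓡∂ (n + 1))).mono ?_)
  rw [OpenPartialHomeomorph.extend_source]
  exact fun y hy => (D.piece_subset i hy).1

theorem intMeas_ac (D : NormData c) (i : Fin D.N) :
    intMeas D i ≪ volume.restrict (chartDom (D.chart i)) :=
  Measure.absolutelyContinuous_of_le (Measure.restrict_mono_set _ (piece_image_subset D i))

theorem interiorTerm_eq (D : NormData c) (p : ℝ) (f : B → ℂ) (i : Fin D.N)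
    (α : Fin (n + 1) → ℕ) : interiorTerm D p f i α =
      (coordFrame (n + 1) _ (isOpen_chartDom (D.chart i))).term (fun _ => 1) (ENNReal.ofReal p)
        (intMeas D i) (inChart (D.chart i) f) α := by
  unfold interiorTerm Frame.term intMeas
  simp only [hasWeakD_iff (isOpen_chartDom (D.chart i)), one_mul]

/-- The measure of the collar terms. -/
def colMeas (D : NormData c) (j : Fin D.M) : Measure (ℝ × EuclideanSpace ℝ (Fin n)) :=
  (volume.restrict (Ioo 0 1 ×ˢ (D.xchart j '' D.xpiece j))).withDensity
    fun z => ENNReal.ofReal z.1⁻¹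

/-- The weight of the collar terms. -/
def colWeight (D : NormData c) (γ : ℝ) (z : ℝ × EuclideanSpace ℝ (Fin n)) : ℂ :=
  ((z.1 ^ (((n : ℝ) + 1) / 2 - γ) : ℝ) : ℂ) * (D.cutoff z.1 : ℂ)

theorem xpiece_image_subset (D : NormData c) (j : Fin D.M) :
    D.xchart j '' D.xpiece j ⊆ (D.xchart j).target := by
  rintro _ ⟨y, hy, rfl⟩
  exact (D.xchart j).map_source (D.xpiece_subset j hy)

theorem isCompact_xpiece_image (D : NormData c) (j : Fin D.M) :
    IsCompact (D.xchart j '' D.xpiece j) :=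
  (D.xpiece_compact j).image_of_continuousOn
    ((D.xchart j).continuousOn.mono (D.xpiece_subset j))

theorem measurableSet_col (D : NormData c) (j : Fin D.M) :
    MeasurableSet (Ioo (0 : ℝ) 1 ×ˢ (D.xchart j '' D.xpiece j)) :=
  measurableSet_Ioo.prod (isCompact_xpiece_image D j).measurableSet

theorem colMeas_ac' (D : NormData c) (j : Fin D.M) :
    colMeas D j ≪ volume.restrict (Ioo 0 1 ×ˢ (D.xchart j '' D.xpiece j)) :=
  withDensity_absolutelyContinuous _ _

theorem colMeas_ac (D : NormData c) (j : Fin D.M) :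
    colMeas D j ≪ volume.restrict (Ioo 0 1 ×ˢ (D.xchart j).target) :=
  (colMeas_ac' D j).trans (Measure.absolutelyContinuous_of_le
    (Measure.restrict_mono_set _ (prod_mono subset_rfl (xpiece_image_subset D j))))

theorem ae_colMeas_mem (D : NormData c) (j : Fin D.M) :
    ∀ᵐ z ∂colMeas D j, z ∈ Ioo (0 : ℝ) 1 ×ˢ (D.xchart j '' D.xpiece j) :=
  (colMeas_ac' D j).ae_le (ae_restrict_mem (measurableSet_col D j))

theorem measurable_colWeight (D : NormData c) (γ : ℝ) : Measurable (colWeight D γ) := by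
  unfold colWeight
  have h1 : Measurable fun z : ℝ × EuclideanSpace ℝ (Fin n) =>
      (z.1 ^ (((n : ℝ) + 1) / 2 - γ) : ℝ) := measurable_fst.pow_const _
  have h2 : Measurable fun z : ℝ × EuclideanSpace ℝ (Fin n) => D.cutoff z.1 :=
    D.cutoff_smooth.continuous.measurable.comp measurable_fst
  exact (Complex.measurable_ofReal.comp h1).mul (Complex.measurable_ofReal.comp h2)

theorem collarTerm_eq (D : NormData c) (γ p : ℝ) (f : B → ℂ) (j : Fin D.M)
    (m : Option (Fin n) → ℕ) : collarTerm D γ p f j (m none) (fun i => m (some i)) =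
      (coneFrame n _ (D.xchart j).open_target).term (colWeight D γ) (ENNReal.ofReal p)
        (colMeas D j) (f ∘ collarCoord c (D.xchart j)) m := by
  unfold collarTerm Frame.term colMeas colWeight
  simp only [hasWeakConeD_iff (D.xchart j).open_target]
  refine iInf_congr fun g => iInf_congr fun _ => ?_
  congr 1
  funext z
  ring

theorem interiorTerm_le_funNorm (D : NormData c) (k : ℕ) (γ p : ℝ) (f : B → ℂ) (i : Fin D.N)
    (α : Fin (n + 1) → ℕ) (hα : ∑ i, α i ≤ k) :
    interiorTerm D p f i α ≤ funNorm D k γ p f := by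
  unfold funNorm
  refine le_iInf fun _ => le_add_right ?_
  have h1 : interiorTerm D p f i α ≤ ∑ α ∈ multiIdx (n + 1) k, interiorTerm D p f i α :=
    Finset.single_le_sum (f := fun α => interiorTerm D p f i α) (fun _ _ => zero_le)
      (mem_multiIdx.2 hα)
  exact h1.trans (Finset.single_le_sum
    (f := fun i => ∑ α ∈ multiIdx (n + 1) k, interiorTerm D p f i α) (fun _ _ => zero_le)
    (Finset.mem_univ i))

theorem collarTerm_le_funNorm (D : NormData c) (k : ℕ) (γ p : ℝ) (f : B → ℂ) (j : Fin D.M)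
    (m : Option (Fin n) → ℕ) (hm : ∑ i, m i ≤ k) :
    collarTerm D γ p f j (m none) (fun i => m (some i)) ≤ funNorm D k γ p f := by
  rw [Fintype.sum_option] at hm
  unfold funNorm
  refine le_iInf fun _ => le_add_left ?_
  have h1 := Finset.single_le_sum (f := fun α => collarTerm D γ p f j (m none) α)
    (fun _ _ => zero_le) (mem_multiIdx.2 (show ∑ i, m (some i) ≤ k - m none by omega))
  have h2 := Finset.single_le_sum
    (f := fun l => ∑ α ∈ multiIdx n (k - l), collarTerm D γ p f j l α)
    (fun _ _ => zero_le) (Finset.mem_range.2 (show m none < k + 1 by omega))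
  exact (h1.trans h2).trans (Finset.single_le_sum
    (f := fun j => ∑ l ∈ Finset.range (k + 1), ∑ α ∈ multiIdx n (k - l), collarTerm D γ p f j l α)
    (fun _ _ => zero_le) (Finset.mem_univ j))

/-- Bounds for the terms give bounds for the norm. -/
theorem exists_funNorm_le (D : NormData c) (k : ℕ) (γ p : ℝ) (S : Set ((B → ℂ) × ℝ≥0∞))
    (h0 : ∀ x ∈ S, SobolevLoc n k p x.1)
    (h1 : ∀ i α, ∑ i, α i ≤ k → ∃ C : ℝ≥0, ∀ x ∈ S, interiorTerm D p x.1 i α ≤ C * x.2)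
    (h2 : ∀ j (m : Option (Fin n) → ℕ), ∑ i, m i ≤ k → ∃ C : ℝ≥0, ∀ x ∈ S,
      collarTerm D γ p x.1 j (m none) (fun i => m (some i)) ≤ C * x.2) :
    ∃ C : ℝ≥0, ∀ x ∈ S, funNorm D k γ p x.1 ≤ C * x.2 := by
  -- The elements of `S` are pairs of a function and a bound. The constant of each term is uniform
  -- over `S`, so the finitely many constants can be added.
  choose! C1 hC1 using h1
  choose! C2 hC2 using h2
  refine ⟨(∑ i, ∑ α ∈ multiIdx (n + 1) k, C1 i α) + ∑ j, ∑ l ∈ Finset.range (k + 1),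
    ∑ α ∈ multiIdx n (k - l), C2 j (fun o => o.elim l α), fun x hx => ?_⟩
  refine (iInf_le _ (h0 x hx)).trans ?_
  rw [ENNReal.coe_add, add_mul]
  push_cast
  simp only [Finset.sum_mul]
  refine add_le_add ?_ ?_
  · exact Finset.sum_le_sum fun i _ => Finset.sum_le_sum fun α hα =>
      hC1 i α (mem_multiIdx.1 hα) x hx
  · refine Finset.sum_le_sum fun j _ => Finset.sum_le_sum fun l hl => Finset.sum_le_sum
      fun α hα => ?_
    have := mem_multiIdx.1 hα
    have hl := Finset.mem_range.1 hl
    exact hC2 j (fun o => o.elim l α) (by rw [Fintype.sum_option]; simp only [Option.elim]; omega)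
      x hx

theorem SobolevLoc.const_mul {k : ℕ} {p : ℝ} {f : B → ℂ} (a : ℂ) (h : SobolevLoc n k p f) :
    SobolevLoc n k p (fun y => a * f y) := by
  intro e he α hα
  obtain ⟨g, hg, hg'⟩ := h e he α hα
  refine ⟨fun z => a * g z, ?_, fun K hK hKc => (hg' K hK hKc).const_mul a⟩
  rw [hasWeakD_iff (isOpen_chartDom e)] at hg ⊢
  exact hg.const_mul a

theorem SobolevLoc.add {k : ℕ} {p : ℝ} {f f' : B → ℂ} (h : SobolevLoc n k p f)
    (h' : SobolevLoc n k p f') : SobolevLoc n k p (fun y => f y + f' y) := by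
  intro e he α hα
  obtain ⟨g, hg, hg1⟩ := h e he α hα
  obtain ⟨g', hg', hg1'⟩ := h' e he α hα
  refine ⟨fun z => g z + g' z, ?_, fun K hK hKc => (hg1 K hK hKc).add (hg1' K hK hKc)⟩
  rw [hasWeakD_iff (isOpen_chartDom e)] at hg hg' ⊢
  exact hg.add hg'

theorem sobolevLoc_of_funNorm_lt {D : NormData c} {k : ℕ} {γ p : ℝ} {f : B → ℂ}
    (h : funNorm D k γ p f < ⊤) : SobolevLoc n k p f := by
  by_contra hh
  have : funNorm D k γ p f = ⊤ := by simp [funNorm, hh]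
  exact h.ne this

theorem funNorm_const_mul_le (D : NormData c) (k : ℕ) (γ p : ℝ) (f : B → ℂ) (a : ℂ) (ha : a ≠ 0) :
    funNorm D k γ p (fun y => a * f y) ≤ ‖a‖ₑ * funNorm D k γ p f := by
  by_cases h : SobolevLoc n k p f
  · have e1 : funNorm D k γ p f = (∑ i, ∑ α ∈ multiIdx (n + 1) k, interiorTerm D p f i α) +
        ∑ j, ∑ l ∈ Finset.range (k + 1), ∑ α ∈ multiIdx n (k - l), collarTerm D γ p f j l α := by
      unfold funNorm; simp [h]
    rw [e1]
    refine (iInf_le _ (h.const_mul a)).trans ?_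
    rw [mul_add]
    simp only [Finset.mul_sum]
    refine add_le_add ?_ ?_
    · refine Finset.sum_le_sum fun i _ => Finset.sum_le_sum fun α _ => ?_
      rw [interiorTerm_eq, interiorTerm_eq]
      exact Frame.term_const_mul_le a ha (intMeas_ac D i)
    · refine Finset.sum_le_sum fun j _ => Finset.sum_le_sum fun l _ => Finset.sum_le_sum
        fun α _ => ?_
      have e := fun f => collarTerm_eq D γ p f j (fun o => o.elim l α)
      simp only [Option.elim] at e
      rw [e, e]
      exact Frame.term_const_mul_le a ha (colMeas_ac D j)
  · have : funNorm D k γ p f = ⊤ := by simp [funNorm, h]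
    rw [this, ENNReal.mul_top (by simpa using ha)]
    exact le_top

theorem funNorm_add_le (D : NormData c) (k : ℕ) (γ : ℝ) {p : ℝ} (hp : 1 < p) (f f' : B → ℂ) :
    funNorm D k γ p (fun y => f y + f' y) ≤ funNorm D k γ p f + funNorm D k γ p f' := by
  have hp' : 1 ≤ ENNReal.ofReal p := by simpa using hp.le
  by_cases h : SobolevLoc n k p f
  · by_cases h' : SobolevLoc n k p f'
    · have e1 : ∀ f, SobolevLoc n k p f → funNorm D k γ p f =
          (∑ i, ∑ α ∈ multiIdx (n + 1) k, interiorTerm D p f i α) +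
          ∑ j, ∑ l ∈ Finset.range (k + 1), ∑ α ∈ multiIdx n (k - l),
            collarTerm D γ p f j l α := by
        intro f h; unfold funNorm; simp [h]
      rw [e1 f h, e1 f' h', e1 _ (h.add h'), add_add_add_comm]
      simp only [← Finset.sum_add_distrib]
      refine add_le_add ?_ ?_
      · refine Finset.sum_le_sum fun i _ => Finset.sum_le_sum fun α _ => ?_
        rw [interiorTerm_eq, interiorTerm_eq, interiorTerm_eq]
        exact Frame.term_add_le hp' (intMeas_ac D i) aestronglyMeasurable_const
      · refine Finset.sum_le_sum fun j _ => Finset.sum_le_sum fun l _ => Finset.sum_le_sum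
          fun α _ => ?_
        have e := fun f => collarTerm_eq D γ p f j (fun o => o.elim l α)
        simp only [Option.elim] at e
        rw [e, e, e]
        exact Frame.term_add_le hp' (colMeas_ac D j) (measurable_colWeight D γ).aestronglyMeasurable
    · have : funNorm D k γ p f' = ⊤ := by simp [funNorm, h']
      simp [this]
  · have : funNorm D k γ p f = ⊤ := by simp [funNorm, h]
    simp [this]

/-! ### Bounds for operators acting on functions -/

/-- In every patch, `f'` is obtained by applying `A` to `f`. -/
structure ActsAs (c : Collar n B X) (A : testFun n B →ₗ[ℂ] testFun n B) (K : ℕ)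
    (f f' : B → ℂ) : Prop where
  int : ∀ e (he : e ∈ IsManifold.maximalAtlas (𝓡∂ (n + 1)) ∞ B) L,
    (intPatch e he).IsOpList A L →
    (∀ x ∈ L, ContDiffOn ℝ ∞ x.1 (chartDom e) ∧ ∑ i, x.2 i ≤ K) → ∀ g,
    (intPatch e he).IsFam K (f ∘ (intPatch e he).κ) g →
    f' ∘ (intPatch e he).κ =ᵐ[volume.restrict (intPatch e he).dom] Frame.comb L g
  col : ∀ ψ (hψ : ψ ∈ IsManifold.maximalAtlas (𝓡 n) ∞ X) L,
    (colPatch c ψ hψ).IsOpList A L →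
    (∀ x ∈ L, ContDiffOn ℝ ∞ x.1 (Ioo 0 1 ×ˢ ψ.target) ∧ ∑ i, x.2 i ≤ K) → ∀ g,
    (colPatch c ψ hψ).IsFam K (f ∘ (colPatch c ψ hψ).κ) g →
    f' ∘ (colPatch c ψ hψ).κ =ᵐ[volume.restrict (colPatch c ψ hψ).dom] Frame.comb L g

theorem exists_bound_int (D : NormData c) (i : Fin D.N)
    (a : EuclideanSpace ℝ (Fin (n + 1)) → ℂ) (ha : ContDiffOn ℝ ∞ a (chartDom (D.chart i))) :
    ∃ C : ℝ≥0, ∀ᵐ z ∂intMeas D i, ‖(1 : ℂ) * a z‖₊ ≤ C * ‖(1 : ℂ)‖₊ := by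
  obtain ⟨C, hC⟩ := (isCompact_piece_image D i).exists_bound_of_continuousOn
    (ha.continuousOn.mono (piece_image_subset D i))
  refine ⟨C.toNNReal, ?_⟩
  filter_upwards [ae_restrict_mem (isCompact_piece_image D i).measurableSet] with z hz
  simp only [one_mul, nnnorm_one, mul_one]
  rw [← norm_toNNReal]
  exact Real.toNNReal_le_toNNReal (hC z hz)

/-- With t^w a = F one has t^{(n+1)/2−γ} a = F t^{(n+1)/2−(γ+w)}: the singularity of the coefficient
is absorbed by the shift of the weight. The cut-off vanishes for t ≥ R with R < 1, so only the bound
of F on the compact set [0,R] × (piece) enters. -/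
theorem exists_bound_col (D : NormData c) (j : Fin D.M) (γ : ℝ) (w : ℕ)
    (a : ℝ × EuclideanSpace ℝ (Fin n) → ℂ) (ha : ConeAdm (D.xchart j).target w a) :
    ∃ C : ℝ≥0, ∀ᵐ z ∂colMeas D j,
      ‖colWeight D γ z * a z‖₊ ≤ C * ‖colWeight D (γ + w) z‖₊ := by
  obtain ⟨F, hF, hFa⟩ := ha
  have hsub : Icc 0 D.R ×ˢ (D.xchart j '' D.xpiece j) ⊆ Ico (0 : ℝ) 1 ×ˢ (D.xchart j).target :=
    prod_mono (fun t ht => ⟨ht.1, ht.2.trans_lt D.R_lt_one⟩) (xpiece_image_subset D j)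
  obtain ⟨C, hC⟩ := (isCompact_Icc.prod (isCompact_xpiece_image D j)).exists_bound_of_continuousOn
    (hF.continuousOn.mono hsub)
  refine ⟨C.toNNReal, ?_⟩
  filter_upwards [ae_colMeas_mem D j] with z hz
  by_cases hR : D.R ≤ z.1
  · simp [colWeight, D.cutoff_zero _ hR]
  · push Not at hR
    have hz' : z ∈ Ioo (0 : ℝ) 1 ×ˢ (D.xchart j).target := ⟨hz.1, xpiece_image_subset D j hz.2⟩
    have hF1 := hC z ⟨⟨hz.1.1.le, hR.le⟩, hz.2⟩
    have hz0 : 0 < z.1 := hz.1.1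
    have e : colWeight D γ z * a z = F z * colWeight D (γ + w) z := by
      rw [← hFa z hz']
      unfold colWeight
      have : z.1 ^ (((n : ℝ) + 1) / 2 - γ) = z.1 ^ w * z.1 ^ (((n : ℝ) + 1) / 2 - (γ + w)) := by
        rw [← Real.rpow_natCast, ← Real.rpow_add hz0]
        congr 1
        ring
      rw [this]
      push_cast
      ring
    rw [e, nnnorm_mul]
    refine mul_le_mul_left ?_ _
    rw [← norm_toNNReal]
    exact Real.toNNReal_le_toNNReal hF1

/-- In every patch f' is a combination of weak derivatives of f of order ≤ μ, so its derivatives of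
order ≤ k are combinations of those of order ≤ k + μ. Coefficients are bounded on the compact
pieces, in the collar after the shift of the weight by w. -/
theorem exists_funNorm_le_of_actsAs (D : NormData c) (k μ w : ℕ) (γ : ℝ) {p : ℝ} (hp : 1 < p)
    {A : testFun n B →ₗ[ℂ] testFun n B} (hA : IsLocOp c μ w A) :
    ∃ C : ℝ≥0, ∀ f f', SobolevLoc n (k + μ) p f → ActsAs c A (k + μ) f f' →
      funNorm D k γ p f' ≤ C * funNorm D (k + μ) (γ + w) p f := by
  have hp' : 1 ≤ ENNReal.ofReal p := by simpa using hp.le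
  -- f' is paired with the norm of f. Finiteness is demanded because it supplies the weak
  -- derivatives in the collar; infinite norms are treated separately.
  have key := exists_funNorm_le D k γ p {x : (B → ℂ) × ℝ≥0∞ | ∃ f, SobolevLoc n (k + μ) p f ∧
    ActsAs c A (k + μ) f x.1 ∧ x.2 = funNorm D (k + μ) (γ + w) p f ∧ x.2 < ⊤} ?_ ?_ ?_
  · obtain ⟨C, hC⟩ := key
    -- The constant must be nonzero for the bound to be ⊤ when the norm of f is.
    refine ⟨C + 1, fun f f' hf hff' => ?_⟩
    by_cases hT : funNorm D (k + μ) (γ + w) p f < ⊤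
    · refine (hC (f', _) ⟨f, hf, hff', rfl, hT⟩).trans ?_
      exact mul_le_mul_left (by simp) _
    · rw [not_lt, top_le_iff] at hT
      rw [hT, ENNReal.mul_top (by simp)]
      exact le_top
  · rintro ⟨f', T⟩ ⟨f, hf, hff', -, -⟩ e he α hα
    obtain ⟨L, hL, hL'⟩ := hA.int e he
    obtain ⟨g, hg, hg'⟩ := hf.exists_fam he
    have hae := hff'.int e he L hL' (fun x hx => ⟨(hL x hx).1, by
      have := (hL x hx).2; omega⟩) g hg
    have hsum := mem_multiIdx.1 hα
    obtain ⟨L', hL1, hL2⟩ := Frame.exists_comb_hasW (P := (intPatch e he).toFrame)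
      (Adm := fun a => ContDiffOn ℝ ∞ a (chartDom e)) (fun _ h => h)
      (fun i a ha => Frame.X_smooth (P := (intPatch e he).toFrame) i ha) _ α rfl L μ hL
    -- This exhibits the weak derivative of f'. It is locally in L^p because each summand is an L^p
    -- function times a coefficient which is bounded on compact sets.
    have hw := (hL2 _ g fun m hm => hg m (by omega)).congr hae.symm (ae_eq_refl _)
    refine ⟨Frame.comb L' g, (hasWeakD_iff (isOpen_chartDom e) α _ _).2 hw, fun K hK hKc => ?_⟩
    clear hL2 hw
    induction L' with
    | nil => exact MemLp.zero
    | cons x L' ih =>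
      rw [Frame.comb_cons]
      refine MemLp.add (f := fun z => x.1 z * g x.2 z) ?_ (ih fun y hy => hL1 y (by simp [hy]))
      obtain ⟨h1, h2⟩ := hL1 x (by simp)
      have hm := hg' x.2 (by omega) K hK hKc
      obtain ⟨C, hC⟩ := hKc.exists_bound_of_continuousOn (h1.continuousOn.mono hK)
      refine hm.of_le_mul (c := C) (((h1.continuousOn.mono hK).aestronglyMeasurable
        hKc.measurableSet).mul hm.1) ?_
      filter_upwards [ae_restrict_mem hKc.measurableSet] with z hz
      rw [norm_mul]
      exact mul_le_mul_of_nonneg_right (hC z hz) (norm_nonneg _)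
  · intro i α hα
    obtain ⟨L, hL, hL'⟩ := hA.int _ (D.chart_mem i)
    obtain ⟨C, hC⟩ := Frame.exists_term_comb_le (P := (intPatch _ (D.chart_mem i)).toFrame)
      (Adm := fun a => ContDiffOn ℝ ∞ a (chartDom (D.chart i))) (fun _ h => h)
      (fun i' a ha => Frame.X_smooth (P := (intPatch _ (D.chart_mem i)).toFrame) i' ha)
      hp' (intMeas_ac D i) (W := fun _ => 1) (W' := fun _ => 1) aestronglyMeasurable_const
      (exists_bound_int D i) L μ k hL α hα
    refine ⟨C, ?_⟩
    rintro ⟨f', T⟩ ⟨f, hf, hff', hT, -⟩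
    obtain ⟨g, hg, -⟩ := hf.exists_fam (D.chart_mem i)
    have hae := hff'.int _ (D.chart_mem i) L hL' (fun x hx => ⟨(hL x hx).1, by
      have := (hL x hx).2; omega⟩) g hg
    rw [interiorTerm_eq]
    refine hC _ _ g hg hae T fun m hm => ?_
    simp only at hT
    rw [hT]
    have := interiorTerm_le_funNorm D (k + μ) (γ + w) p f i m hm
    rwa [interiorTerm_eq] at this
  · intro j m hm
    obtain ⟨L, hL, hL'⟩ := hA.col _ (D.xchart_mem j)
    obtain ⟨C, hC⟩ := Frame.exists_term_comb_le (P := (colPatch c _ (D.xchart_mem j)).toFrame)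
      (Adm := ConeAdm (D.xchart j).target w) (fun _ h => h.smooth)
      (fun i' a ha => ha.X (D.xchart j).open_target i')
      hp' (colMeas_ac D j) (W := colWeight D γ) (W' := colWeight D (γ + w))
      (measurable_colWeight D γ).aestronglyMeasurable
      (exists_bound_col D j γ w) L μ k hL m hm
    refine ⟨C, ?_⟩
    rintro ⟨f', T⟩ ⟨f, hf, hff', hT, hT'⟩
    have hb : ∀ m : Option (Fin n) → ℕ, ∑ i, m i ≤ k + μ →
        (coneFrame n _ (D.xchart j).open_target).term (colWeight D (γ + w)) (ENNReal.ofReal p)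
        (colMeas D j) (f ∘ collarCoord c (D.xchart j)) m ≤ T := by
      intro m hm
      simp only at hT
      rw [← collarTerm_eq, hT]
      exact collarTerm_le_funNorm D (k + μ) (γ + w) p f j m hm
    -- `SobolevLoc` speaks of interior charts only; the existence of derivatives along t∂_t and ∂_x
    -- is read off from the finiteness of the collar terms.
    have hg : ∀ m : Option (Fin n) → ℕ, ∑ i, m i ≤ k + μ → ∃ g,
        (coneFrame n _ (D.xchart j).open_target).HasW m (f ∘ collarCoord c (D.xchart j)) g :=
      fun m hm => Frame.exists_hasW_of_term_lt ((hb m hm).trans_lt hT')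
    choose! g hg using hg
    have hae := hff'.col _ (D.xchart_mem j) L hL' (fun x hx => ⟨(hL x hx).1.smooth, by
      have := (hL x hx).2; omega⟩) g hg
    rw [collarTerm_eq]
    exact hC _ _ g hg hae T hb

end Norms

/-! ### Integer orders: test functions, the duality pairing, operators of order at most one -/

theorem lintegral_enorm_mul_le_eLpNorm {α : Type*} [MeasurableSpace α] {ν : Measure α} {p : ℝ}
    (hp : 1 < p) {F G : α → ℂ} (hF : AEStronglyMeasurable F ν) (hG : AEStronglyMeasurable G ν) :
    ∫⁻ z, ‖F z‖ₑ * ‖G z‖ₑ ∂ν ≤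
      eLpNorm F (ENNReal.ofReal p) ν * eLpNorm G (ENNReal.ofReal p.conjExponent) ν := by
  have hc := Real.HolderConjugate.conjExponent hp
  rw [eLpNorm_eq_lintegral_rpow_enorm_toReal (by simpa using hc.pos) (by simp),
    eLpNorm_eq_lintegral_rpow_enorm_toReal (by simpa using hc.symm.pos) (by simp),
    ENNReal.toReal_ofReal hc.pos.le, ENNReal.toReal_ofReal hc.symm.pos.le]
  exact ENNReal.lintegral_mul_le_Lp_mul_Lq ν hc hF.enorm hG.enorm

section Bdd

variable {n : ℕ} {B X : Type*} [TopologicalSpace B] [T2Space B] [CompactSpace B]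
  [ChartedSpace (EuclideanHalfSpace (n + 1)) B] [IsManifold (𝓡∂ (n + 1)) ∞ B]
  [TopologicalSpace X] [T2Space X] [CompactSpace X] [ChartedSpace (EuclideanSpace ℝ (Fin n)) X]
  [IsManifold (𝓡 n) ∞ X] {c : Collar n B X}

/-! ### Test functions -/

/-- Any family of weak derivatives of a test function agrees almost everywhere with the classical
derivatives, and only finitely many of them occur in `L`. -/
theorem Patch.IsOpList.ae_eq {E ι : Type*} [NormedAddCommGroup E] [NormedSpace ℝ E]
    [FiniteDimensional ℝ E] [MeasureSpace E] [BorelSpace E]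
    [(volume : Measure E).IsAddHaarMeasure] [Fintype ι] {Q : Patch n B E ι}
    {A : testFun n B →ₗ[ℂ] testFun n B} {L : List ((E → ℂ) × (ι → ℕ))} (hA : Q.IsOpList A L)
    {K : ℕ} (hL : ∀ x ∈ L, ∑ i, x.2 i ≤ K) (φ : testFun n B) {g : (ι → ℕ) → E → ℂ}
    (hg : Q.IsFam K ((φ : B → ℂ) ∘ Q.κ) g) :
    (A φ : B → ℂ) ∘ Q.κ =ᵐ[volume.restrict Q.dom] Frame.comb L g := by
  have h1 : ∀ᵐ z ∂volume.restrict Q.dom, ∀ x ∈ L,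
      g x.2 z = Q.D x.2 ((φ : B → ℂ) ∘ Q.κ) z := by
    clear hA
    induction L with
    | nil => simp
    | cons x L ih =>
      have ih := ih fun y hy => hL y (by simp [hy])
      filter_upwards [ih, (hg x.2 (hL x (by simp))).unique
        (Frame.hasW_of_smooth x.2 (Patch.testFun_pull φ))] with z h1 h2
      intro y hy
      rcases List.mem_cons.1 hy with rfl | hy
      · exact h2
      · exact h1 y hy
  filter_upwards [h1, ae_restrict_mem Q.isOpen_dom.measurableSet] with z hz hzd
  rw [Function.comp_apply, hA φ z hzd]
  unfold Frame.comb
  congr 1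
  refine List.map_congr_left fun x hx => ?_
  rw [hz x hx]

theorem actsAs_testFun (A : testFun n B →ₗ[ℂ] testFun n B) (K : ℕ) (φ : testFun n B) :
    ActsAs c A K φ (A φ) :=
  ⟨fun _ _ _ hL hL' _ hg => hL.ae_eq (fun x hx => (hL' x hx).2) φ hg,
    fun _ _ _ hL hL' _ hg => hL.ae_eq (fun x hx => (hL' x hx).2) φ hg⟩

theorem sobolevLoc_testFun (k : ℕ) (p : ℝ) (φ : testFun n B) : SobolevLoc n k p (φ : B → ℂ) := by
  intro e he α _
  have hs := Patch.testFun_pull (Q := intPatch e he) φ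
  refine ⟨(intPatch e he).D α ((φ : B → ℂ) ∘ (intPatch e he).κ),
    (hasWeakD_iff (isOpen_chartDom e) α _ _).2
      (Frame.hasW_of_smooth (P := (intPatch e he).toFrame) α hs), fun S hS hSc => ?_⟩
  have hc := (Frame.D_smooth (P := (intPatch e he).toFrame) α hs).continuousOn.mono hS
  obtain ⟨C, hC⟩ := hSc.exists_bound_of_continuousOn hc
  have : IsFiniteMeasure (volume.restrict S) := ⟨by simpa using hSc.measure_lt_top⟩
  refine MemLp.of_bound (hc.aestronglyMeasurable hSc.measurableSet) C ?_
  filter_upwards [ae_restrict_mem hSc.measurableSet] with z hz using hC z hz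

/-! ### The pairing -/

variable [MeasurableSpace B] [BorelSpace B] {m : Measure B}

theorem NormData.r_lt_one (D : NormData c) : D.r < 1 := by
  refine lt_of_not_ge fun h => ?_
  have h1 := D.cutoff_one D.r ⟨D.r_pos.le, le_rfl⟩
  rw [D.cutoff_zero D.r (D.R_lt_one.le.trans h)] at h1
  exact zero_ne_one h1

theorem lintegral_piece_le (hm : IsConeMeasure c m) (D : NormData c) (γ γ' : ℝ) {p : ℝ}
    (hp : 1 < p) (i : Fin D.N) : ∃ C : ℝ≥0, ∀ f ψ : B → ℂ, SobolevLoc n 0 p f →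
      SobolevLoc n 0 p.conjExponent ψ →
      ∫⁻ y in D.piece i, ‖f y‖ₑ * ‖ψ y‖ₑ ∂m ≤
        C * (funNorm D 0 γ p f * funNorm D 0 γ' p.conjExponent ψ) := by
  obtain ⟨ρ, hρ⟩ := hm.exists_isDens_int (D.chart_mem i)
  set S := (D.chart i).extend (𝓡∂ (n + 1)) '' D.piece i with hS
  have hSd : S ⊆ (intPatch _ (D.chart_mem i)).dom := piece_image_subset D i
  have hSc : IsCompact S := isCompact_piece_image D i
  obtain ⟨C, hC⟩ := hSc.exists_bound_of_continuousOn (hρ.smooth.continuousOn.mono hSd)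
  have himg : D.piece i = (intPatch _ (D.chart_mem i)).κ '' S := by
    rw [hS, image_image]
    have : ∀ y ∈ D.piece i, (intPatch _ (D.chart_mem i)).κ ((D.chart i).extend (𝓡∂ (n + 1)) y) = y :=
      fun y hy => (D.chart i).extend_left_inv (D.piece_subset i hy).1
    rw [image_congr this, image_id']
  refine ⟨C.toNNReal, fun f ψ hf hψ => ?_⟩
  have key : ∀ (q δ : ℝ) (h : B → ℂ), SobolevLoc n 0 q h →
      AEStronglyMeasurable (h ∘ (intPatch _ (D.chart_mem i)).κ) (intMeas D i) ∧
      eLpNorm (h ∘ (intPatch _ (D.chart_mem i)).κ) (ENNReal.ofReal q) (intMeas D i) ≤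
        funNorm D 0 δ q h := by
    intro q δ h hh
    obtain ⟨g, hg, -⟩ := hh.exists_fam (D.chart_mem i)
    have h0 := Frame.hasW_zero (P := (intPatch _ (D.chart_mem i)).toFrame) (hg 0 (by simp)).1
    refine ⟨h0.aestronglyMeasurable (intMeas_ac D i), ?_⟩
    have := interiorTerm_le_funNorm D 0 δ q h i 0 (by simp)
    rw [interiorTerm_eq] at this
    have e := Frame.term_eq (P := (intPatch _ (D.chart_mem i)).toFrame) (W := fun _ => 1)
      (p := ENNReal.ofReal q) (intMeas_ac D i) h0
    simp only [one_mul] at e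
    exact e.symm.trans_le this
  obtain ⟨m1, b1⟩ := key p γ f hf
  obtain ⟨m2, b2⟩ := key _ γ' ψ hψ
  have e1 : ∫⁻ y in D.piece i, ‖f y‖ₑ * ‖ψ y‖ₑ ∂m = ∫⁻ z in S, ENNReal.ofReal (ρ z) *
      (‖(f ∘ (intPatch _ (D.chart_mem i)).κ) z‖ₑ *
        ‖(ψ ∘ (intPatch _ (D.chart_mem i)).κ) z‖ₑ) := by
    conv_lhs => rw [himg]
    exact hρ.lintegral_image hSc.measurableSet hSd _
  rw [e1]
  calc _ ≤ ∫⁻ z in S, (C.toNNReal : ℝ≥0∞) * (‖(f ∘ (intPatch _ (D.chart_mem i)).κ) z‖ₑ *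
        ‖(ψ ∘ (intPatch _ (D.chart_mem i)).κ) z‖ₑ) := by
        refine setLIntegral_mono' hSc.measurableSet fun z hz => ?_
        refine mul_le_mul_left ?_ _
        exact ENNReal.ofReal_le_ofReal ((Real.le_norm_self _).trans (hC z hz))
    _ = C.toNNReal * ∫⁻ z in S, (‖(f ∘ (intPatch _ (D.chart_mem i)).κ) z‖ₑ *
        ‖(ψ ∘ (intPatch _ (D.chart_mem i)).κ) z‖ₑ) := lintegral_const_mul' _ _ (by simp)
    _ ≤ _ := by
        refine mul_le_mul_right ?_ _
        exact (lintegral_enorm_mul_le_eLpNorm hp m1 m2).trans (mul_le_mul' b1 b2)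

/-- The exponents (n+1)/2 − γ and (n+1)/2 + γ add up to n + 1, and the measure dt/t uses one power,
which leaves exactly the t^n of m. Hölder's inequality for dt dx/t applies: for t < r the cut-off
equals 1, and ρ is bounded on [0,r] × (piece). -/
theorem lintegral_collar_le (hm : IsConeMeasure c m) (D : NormData c) (γ : ℝ) {p : ℝ}
    (hp : 1 < p) (j : Fin D.M) : ∃ C : ℝ≥0, ∀ f ψ : B → ℂ, funNorm D 0 γ p f < ⊤ →
      funNorm D 0 (-γ) p.conjExponent ψ < ⊤ →
      ∫⁻ y in collarCoord c (D.xchart j) '' (Ioo 0 D.r ×ˢ (D.xchart j '' D.xpiece j)),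
        ‖f y‖ₑ * ‖ψ y‖ₑ ∂m ≤
        C * (funNorm D 0 γ p f * funNorm D 0 (-γ) p.conjExponent ψ) := by
  obtain ⟨ρ, hρs, hρ0, hρ⟩ := hm.exists_isDens_col (D.xchart_mem j)
  set κ := (colPatch c _ (D.xchart_mem j)).κ with hκ
  set T := D.xchart j '' D.xpiece j with hT
  set S := Ioo 0 D.r ×ˢ T with hS
  have hTc : IsCompact T := isCompact_xpiece_image D j
  have hTt : T ⊆ (D.xchart j).target := xpiece_image_subset D j
  have hSm : MeasurableSet S := measurableSet_Ioo.prod hTc.measurableSet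
  have hS1 : S ⊆ Ioo 0 1 ×ˢ T := prod_mono (Ioo_subset_Ioo_right D.r_lt_one.le) subset_rfl
  have hSd : S ⊆ (colPatch c _ (D.xchart_mem j)).dom := hS1.trans (prod_mono subset_rfl hTt)
  have hsub : Icc 0 D.r ×ˢ T ⊆ Ico (0 : ℝ) 1 ×ˢ (D.xchart j).target :=
    prod_mono (fun t ht => ⟨ht.1, ht.2.trans_lt D.r_lt_one⟩) hTt
  obtain ⟨C, hC⟩ := (isCompact_Icc.prod hTc).exists_bound_of_continuousOn
    (hρs.continuousOn.mono hsub)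
  refine ⟨C.toNNReal, fun f ψ hf hψ => ?_⟩
  have key : ∀ (q δ : ℝ) (h : B → ℂ), funNorm D 0 δ q h < ⊤ →
      AEStronglyMeasurable (fun z => colWeight D δ z * (h ∘ κ) z) (colMeas D j) ∧
      eLpNorm (fun z => colWeight D δ z * (h ∘ κ) z) (ENNReal.ofReal q) (colMeas D j) ≤
        funNorm D 0 δ q h := by
    intro q δ h hh
    have := collarTerm_le_funNorm D 0 δ q h j 0 (by simp)
    have e0 := collarTerm_eq D δ q h j 0
    rw [e0] at this
    obtain ⟨g, hg⟩ := Frame.exists_hasW_of_term_lt (this.trans_lt hh)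
    have h0 := Frame.hasW_zero (P := (colPatch c _ (D.xchart_mem j)).toFrame) hg.1
    refine ⟨(measurable_colWeight D δ).aestronglyMeasurable.mul
      (h0.aestronglyMeasurable (colMeas_ac D j)), ?_⟩
    have e := Frame.term_eq (P := (colPatch c _ (D.xchart_mem j)).toFrame) (W := colWeight D δ)
      (p := ENNReal.ofReal q) (colMeas_ac D j) h0
    exact e.symm.trans_le this
  obtain ⟨m1, b1⟩ := key p γ f hf
  obtain ⟨m2, b2⟩ := key _ (-γ) ψ hψ
  have e1 := hρ.lintegral_image hSm hSd fun y => ‖f y‖ₑ * ‖ψ y‖ₑ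
  change ∫⁻ y in collarCoord c (D.xchart j) '' S, ‖f y‖ₑ * ‖ψ y‖ₑ ∂m = _ at e1
  rw [e1]
  set G : ℝ × EuclideanSpace ℝ (Fin n) → ℝ≥0∞ := fun z =>
    ‖colWeight D γ z * (f ∘ κ) z‖ₑ * ‖colWeight D (-γ) z * (ψ ∘ κ) z‖ₑ with hG
  calc _ ≤ ∫⁻ z in S, (C.toNNReal : ℝ≥0∞) * (ENNReal.ofReal z.1⁻¹ * G z) := by
        refine setLIntegral_mono' hSm fun z hz => ?_
        have hz0 : 0 < z.1 := hz.1.1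
        have hρz : 0 ≤ ρ z := (hρ0 z (hsub ⟨⟨hz0.le, hz.1.2.le⟩, hz.2⟩)).le
        have hw : ∀ δ : ℝ, ‖colWeight D δ z‖ₑ =
            ENNReal.ofReal (z.1 ^ (((n : ℝ) + 1) / 2 - δ)) := by
          intro δ
          rw [← ofReal_norm]
          congr 1
          unfold colWeight
          rw [D.cutoff_one z.1 ⟨hz0.le, hz.1.2.le⟩]
          simp only [Complex.ofReal_one, mul_one, Complex.norm_real]
          exact Real.norm_of_nonneg (Real.rpow_nonneg hz0.le _)
        have hpow : z.1 ^ n * ρ z = ρ z * (z.1⁻¹ * (z.1 ^ (((n : ℝ) + 1) / 2 - γ) *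
            z.1 ^ (((n : ℝ) + 1) / 2 - -γ))) := by
          rw [← Real.rpow_add hz0, show ((n : ℝ) + 1) / 2 - γ + (((n : ℝ) + 1) / 2 - -γ) =
            ((n + 1 : ℕ) : ℝ) by push_cast; ring, Real.rpow_natCast, pow_succ]
          field_simp
        have hG' : ENNReal.ofReal (z.1 ^ n * ρ z) * (‖f (κ z)‖ₑ * ‖ψ (κ z)‖ₑ) =
            ENNReal.ofReal (ρ z) * (ENNReal.ofReal z.1⁻¹ * G z) := by
          rw [hpow, ENNReal.ofReal_mul hρz, ENNReal.ofReal_mul (inv_nonneg.2 hz0.le),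
            ENNReal.ofReal_mul (Real.rpow_nonneg hz0.le _), ← hw, ← hw]
          simp only [hG, enorm_mul, Function.comp_apply]
          ring
        change ENNReal.ofReal (z.1 ^ n * ρ z) * (‖f (κ z)‖ₑ * ‖ψ (κ z)‖ₑ) ≤ _
        rw [hG']
        refine mul_le_mul_left ?_ _
        exact ENNReal.ofReal_le_ofReal
          ((Real.le_norm_self _).trans (hC z ⟨⟨hz0.le, hz.1.2.le⟩, hz.2⟩))
    _ ≤ ∫⁻ z in Ioo 0 1 ×ˢ T, (C.toNNReal : ℝ≥0∞) * (ENNReal.ofReal z.1⁻¹ * G z) :=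
        lintegral_mono_set hS1
    _ = C.toNNReal * ∫⁻ z in Ioo 0 1 ×ˢ T, ENNReal.ofReal z.1⁻¹ * G z :=
        lintegral_const_mul' _ _ (by simp)
    _ = C.toNNReal * ∫⁻ z, G z ∂(colMeas D j) := by
        congr 1
        unfold colMeas
        rw [lintegral_withDensity_eq_lintegral_mul_non_measurable₀ _
          (Measurable.ennreal_ofReal (f := fun z : ℝ × EuclideanSpace ℝ (Fin n) => z.1⁻¹)
            measurable_fst.inv).aemeasurable (ae_of_all _ fun _ => by simp)]
        rfl
    _ ≤ _ := by
        refine mul_le_mul_right ?_ _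
        exact (lintegral_enorm_mul_le_eLpNorm hp m1 m2).trans (mul_le_mul' b1 b2)

/-- The pairing of `H^{0,γ}_p` and `H^{0,-γ}_{p'}`. -/
theorem exists_enorm_integral_le (hm : IsConeMeasure c m) (D : NormData c) (γ : ℝ) {p : ℝ}
    (hp : 1 < p) : ∃ C : ℝ≥0, ∀ (f : B → ℂ) (ψ : testFun n B), funNorm D 0 γ p f < ⊤ →
      funNorm D 0 (-γ) p.conjExponent ψ < ⊤ →
      ‖∫ y, f y * (ψ : B → ℂ) y ∂m‖ₑ ≤
        C * (funNorm D 0 γ p f * funNorm D 0 (-γ) p.conjExponent ψ) := by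
  choose C1 hC1 using lintegral_piece_le hm D γ (-γ) hp
  choose C2 hC2 using lintegral_collar_le hm D γ hp
  refine ⟨∑ i, C1 i + ∑ j, C2 j, fun f ψ hf hψ => ?_⟩
  set F : B → ℝ≥0∞ := fun y => ‖f y‖ₑ * ‖(ψ : B → ℂ) y‖ₑ with hF
  set S1 : Set B := ⋃ i, D.piece i with hS1
  set S2 : Set B := ⋃ j, collarCoord c (D.xchart j) ''
    (Ioo 0 D.r ×ˢ (D.xchart j '' D.xpiece j)) with hS2
  -- The pieces and the collar up to r cover the manifold, and the sets in `S2` omit only t = 0. So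
  -- what remains consists of boundary points, where the test function vanishes.
  have h0 : ∀ y, y ∉ S1 ∪ S2 → F y = 0 := by
    intro y hy
    have hyi : y ∉ (𝓡∂ (n + 1)).interior B := by
      intro hi
      rcases D.piece_cover (mem_univ y) with h | ⟨⟨t, x⟩, ⟨ht, -⟩, rfl⟩
      · exact hy (Or.inl h)
      · have ht1 : t ∈ Ico (0 : ℝ) 1 := ⟨ht.1, ht.2.trans D.r_lt_one⟩
        have hpos := (c.mem_interior_iff (c.map_mem ht1 x)).1 hi
        rw [c.left_inv_apply ht1] at hpos
        obtain ⟨j, hj⟩ := mem_iUnion.1 (D.xpiece_cover.symm ▸ mem_univ x)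
        refine hy (Or.inr (mem_iUnion.2 ⟨j, (t, D.xchart j x), ⟨⟨hpos, ht.2⟩, ⟨x, hj, rfl⟩⟩, ?_⟩))
        simp [collarCoord, (D.xchart j).left_inv (D.xpiece_subset j hj)]
    simp [hF, testFun_eq_zero ψ hyi]
  have hsup : ∫⁻ y, F y ∂m ≤ ∫⁻ y in S1 ∪ S2, F y ∂m := by
    refine (lintegral_mono fun y => ?_).trans (lintegral_indicator_le F (S1 ∪ S2))
    by_cases hy : y ∈ S1 ∪ S2
    · rw [indicator_of_mem hy]
    · rw [h0 y hy]; exact zero_le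
  have hf' := sobolevLoc_of_funNorm_lt hf
  have hψ' := sobolevLoc_of_funNorm_lt hψ
  calc ‖∫ y, f y * (ψ : B → ℂ) y ∂m‖ₑ ≤ ∫⁻ y, ‖f y * (ψ : B → ℂ) y‖ₑ ∂m :=
        enorm_integral_le_lintegral_enorm _
    _ = ∫⁻ y, F y ∂m := by simp only [hF, enorm_mul]
    _ ≤ ∫⁻ y in S1 ∪ S2, F y ∂m := hsup
    _ ≤ ∫⁻ y in S1, F y ∂m + ∫⁻ y in S2, F y ∂m := lintegral_union_le _ _ _
    _ ≤ ∑ i, ∫⁻ y in D.piece i, F y ∂m + ∑ j, ∫⁻ y in collarCoord c (D.xchart j) ''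
          (Ioo 0 D.r ×ˢ (D.xchart j '' D.xpiece j)), F y ∂m := by
        refine add_le_add ?_ ?_
        · refine (lintegral_iUnion_le _ _).trans_eq (tsum_fintype _)
        · refine (lintegral_iUnion_le _ _).trans_eq (tsum_fintype _)
    _ ≤ _ := by
        rw [ENNReal.coe_add, add_mul]
        push_cast
        rw [Finset.sum_mul, Finset.sum_mul]
        exact add_le_add (Finset.sum_le_sum fun i _ => hC1 i f ψ hf' hψ')
          (Finset.sum_le_sum fun j _ => hC2 j f ψ hf hψ)

/-! ### Bounded operators -/

/-- For C = 0 the product with the infimum of an empty family would be 0 · ⊤ = 0; this is why the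
constants below are increased by 1. -/
theorem le_coe_mul_iInf {κ : Type*} {C : ℝ≥0} (hC : C ≠ 0) {x : ℝ≥0∞} {P : κ → Prop}
    {N : κ → ℝ≥0∞} (h : ∀ i, P i → x ≤ C * N i) : x ≤ C * ⨅ (i) (_ : P i), N i := by
  have h1 : (C : ℝ≥0∞) ≠ 0 := by simpa using hC
  rw [ENNReal.mul_iInf_of_ne h1 (by simp)]
  refine le_iInf fun i => ?_
  rw [ENNReal.mul_iInf_of_ne h1 (by simp)]
  exact le_iInf fun hi => h i hi

variable (m) in
/-- `A`, with formal transpose `At`, is bounded between the spaces of integer order, with loss of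
`μ` derivatives and of the weight `w`. -/
structure IsBddOp (D : NormData c) (μ w : ℕ) (A At : testFun n B →ₗ[ℂ] testFun n B) : Prop where
  transpose : IsFormalTranspose m A At
  bound : ∀ p : ℝ, 1 < p → ∀ (k : ℤ) (γ : ℝ), ∃ C : ℝ≥0, ∀ u : GenFun n B,
    intNorm m D k γ p (At.dualMap u) ≤ C * intNorm m D (k + μ) (γ + w) p u

/-- If u is given by f, then u ∘ `At` is given by the function f' of `exists_apply`, and the
estimate for functions applies to f and f'. -/
theorem exists_bound_of_nonneg (hm : IsConeMeasure c m) (D : NormData c) {μ w w' : ℕ}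
    {A At : testFun n B →ₗ[ℂ] testFun n B} (hA : IsLocOp c μ w A) (hAt : IsLocOp c μ w' At)
    (hT : IsFormalTranspose m A At) {p : ℝ} (hp : 1 < p) (k : ℕ) (γ : ℝ) :
    ∃ C : ℝ≥0, ∀ u : GenFun n B,
      intNorm m D k γ p (At.dualMap u) ≤ C * intNorm m D (k + μ) (γ + w) p u := by
  obtain ⟨C, hC⟩ := exists_funNorm_le_of_actsAs D k μ w γ hp hA
  refine ⟨C + 1, fun u => ?_⟩
  rw [← Nat.cast_add]
  refine le_coe_mul_iInf (by simp) fun f hf => ?_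
  by_cases hs : SobolevLoc n (k + μ) p f
  · obtain ⟨f', h1, h2⟩ := exists_apply hm (Nat.le_add_left μ k) hA hAt hT hs
    have hact : ActsAs c A (k + μ) f f' := by
      refine ⟨fun e he L hL hL' g hg => ?_, fun ψ hψ L hL hL' g hg => ?_⟩
      · obtain ⟨ρ, hρ⟩ := hm.exists_isDens_int he
        exact hρ.apply_ae_eq hAt.tsupport_subset hT hL hL' h1 h2 hg
      · obtain ⟨ρ, -, -, hρ⟩ := hm.exists_isDens_col hψ
        exact hρ.apply_ae_eq hAt.tsupport_subset hT hL hL' h1 h2 hg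
    have hgiven : IsGivenBy m (At.dualMap u) f' := fun φ => by
      rw [h2 φ]; exact hf (At φ)
    refine (iInf₂_le f' hgiven).trans ((hC f f' hs hact).trans ?_)
    exact mul_le_mul_left (by simp) _
  · have : funNorm D (k + μ) (γ + w) p f = ⊤ := by simp [funNorm, hs]
    rw [this, ENNReal.mul_top (by simp)]
    exact le_top

/-- Duality: `At` maps the unit ball of order k + 1 + μ, weight −γ, exponent p' into a multiple of
the unit ball of order k + 1 and weight −(γ + w), since the weight drops by w from −γ. Note that
`Int.negSucc k` is −(k + 1). -/
theorem exists_bound_of_neg (D : NormData c) {μ w : ℕ}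
    {At : testFun n B →ₗ[ℂ] testFun n B} (hAt : IsLocOp c μ w At) {p : ℝ} (hp : 1 < p) (k : ℕ)
    (γ : ℝ) : ∃ C : ℝ≥0, ∀ u : GenFun n B,
      intNorm m D (Int.negSucc (k + μ)) γ p (At.dualMap u) ≤
        C * intNorm m D (Int.negSucc k) (γ + w) p u := by
  obtain ⟨C, hC⟩ := exists_funNorm_le_of_actsAs D (k + 1) μ w (-(γ + w))
    (Real.HolderConjugate.conjExponent hp).symm.lt hAt
  refine ⟨C + 1, fun u => iSup₂_le fun φ hφ => ?_⟩
  have h1 := hC φ (At φ) (sobolevLoc_testFun _ _ φ) (actsAs_testFun At _ φ)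
  rw [show -(γ + w) + (w : ℝ) = -γ by ring, show k + 1 + μ = k + μ + 1 by ring] at h1
  have hC0 : (0 : ℝ) < C + 1 := by positivity
  -- Division by C + 1, which unlike C cannot vanish, puts `At φ` into the unit ball over which the
  -- dual norm is a supremum.
  set a : ℂ := (((C : ℝ) + 1 : ℝ) : ℂ) with ha
  have ha0 : a ≠ 0 := Complex.ofReal_ne_zero.2 hC0.ne'
  have hna : ‖a‖ₑ = ((C + 1 : ℝ≥0) : ℝ≥0∞) := by
    rw [← ofReal_norm, ha, Complex.norm_real, Real.norm_of_nonneg hC0.le]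
    exact ENNReal.ofReal_coe_nnreal (p := C + 1)
  have h2 : funNorm D (k + 1) (-(γ + w)) p.conjExponent
      ((a⁻¹ • At φ : testFun n B) : B → ℂ) ≤ 1 := by
    refine (funNorm_const_mul_le D _ _ _ (At φ : B → ℂ) a⁻¹ (inv_ne_zero ha0)).trans ?_
    rw [enorm_inv ha0, hna, mul_comm, ← div_eq_mul_inv]
    refine ENNReal.div_le_of_le_mul ?_
    rw [one_mul]
    refine h1.trans ((mul_le_mul_right hφ _).trans ?_)
    simp
  have h3 : ‖u (a⁻¹ • At φ)‖ₑ ≤ intNorm m D (Int.negSucc k) (γ + w) p u :=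
    le_iSup₂ (f := fun (φ : testFun n B)
      (_ : funNorm D (k + 1) (-(γ + w)) p.conjExponent φ ≤ 1) => ‖u φ‖ₑ) _ h2
  have h4 : ‖(At.dualMap u) φ‖ₑ = ‖a‖ₑ * ‖u (a⁻¹ • At φ)‖ₑ := by
    rw [map_smul, smul_eq_mul, ← enorm_mul, mul_inv_cancel_left₀ ha0]
    rfl
  rw [h4, hna]
  exact mul_le_mul_right h3 _

/-- The boundary case between the two previous ones: the target has a dual norm and the source a
function norm of order 0. `At φ` lies in the space of order 0 with weight −(γ + w) and exponent p',
where it is paired with f by Hölder's inequality. -/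
theorem exists_bound_of_add_eq_zero (hm : IsConeMeasure c m) (D : NormData c) {μ w : ℕ}
    {At : testFun n B →ₗ[ℂ] testFun n B} (hAt : IsLocOp c (μ + 1) w At) {p : ℝ} (hp : 1 < p)
    (γ : ℝ) : ∃ C : ℝ≥0, ∀ u : GenFun n B,
      intNorm m D (Int.negSucc μ) γ p (At.dualMap u) ≤ C * intNorm m D (0 : ℕ) (γ + w) p u := by
  obtain ⟨C, hC⟩ := exists_funNorm_le_of_actsAs D 0 (μ + 1) w (-(γ + w))
    (Real.HolderConjugate.conjExponent hp).symm.lt hAt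
  obtain ⟨C', hC'⟩ := exists_enorm_integral_le hm D (γ + w) hp
  refine ⟨C' * C + 1, fun u => le_coe_mul_iInf (by simp) fun f hf => iSup₂_le fun φ hφ => ?_⟩
  have h1 := hC φ (At φ) (sobolevLoc_testFun _ _ φ) (actsAs_testFun At _ φ)
  rw [show -(γ + w) + (w : ℝ) = -γ by ring, show 0 + (μ + 1) = μ + 1 by ring] at h1
  have h2 : funNorm D 0 (-(γ + w)) p.conjExponent (At φ : B → ℂ) ≤ C :=
    h1.trans ((mul_le_mul_right hφ _).trans (by simp))
  by_cases hT : funNorm D 0 (γ + w) p f < ⊤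
  · have h3 := hC' f (At φ) hT (h2.trans_lt (by simp))
    rw [← hf (At φ)] at h3
    refine h3.trans ?_
    calc (C' : ℝ≥0∞) * (funNorm D 0 (γ + w) p f *
          funNorm D 0 (-(γ + w)) p.conjExponent (At φ : B → ℂ))
        ≤ C' * (funNorm D 0 (γ + w) p f * C) := by gcongr
      _ = (C' * C : ℝ≥0) * funNorm D 0 (γ + w) p f := by push_cast; ring
      _ ≤ _ := mul_le_mul_left (by simp) _
  · rw [not_lt, top_le_iff] at hT
    rw [hT, ENNReal.mul_top (by simp)]
    exact le_top

/-- Operators of order at most one are bounded. -/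
theorem isBddOp_of_isLocOp (hm : IsConeMeasure c m) (D : NormData c) {μ w : ℕ} (hμ : μ ≤ 1)
    {A At : testFun n B →ₗ[ℂ] testFun n B} (hA : IsLocOp c μ w A) (hAt : IsLocOp c μ w At)
    (hT : IsFormalTranspose m A At) : IsBddOp m D μ w A At := by
  refine ⟨hT, fun p hp k γ => ?_⟩
  -- For k < 0 and order at most one, either k + μ is still negative, or k = −1 and μ = 1, so that k
  -- + μ = 0. The range k < 0 < k + μ does not occur.
  rcases k with k | k
  · exact exists_bound_of_nonneg hm D hA hAt hT hp k γ
  · by_cases hk : μ ≤ k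
    · obtain ⟨l, rfl⟩ : ∃ l, k = l + μ := ⟨k - μ, by omega⟩
      have := exists_bound_of_neg (m := m) D hAt hp l γ
      rwa [show Int.negSucc l = Int.negSucc (l + μ) + μ by
        rw [Int.negSucc_eq, Int.negSucc_eq]; push_cast; ring] at this
    · obtain rfl : k = 0 := by omega
      obtain rfl : μ = 1 := by omega
      have := exists_bound_of_add_eq_zero hm D (μ := 0) hAt hp γ
      rwa [show ((0 : ℕ) : ℤ) = Int.negSucc 0 + (1 : ℕ) by rfl] at this

end Bdd

section Algebra

variable {n : ℕ} {B X : Type*} [TopologicalSpace B] [T2Space B] [CompactSpace B]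
  [ChartedSpace (EuclideanHalfSpace (n + 1)) B] [IsManifold (𝓡∂ (n + 1)) ∞ B]
  [TopologicalSpace X] [T2Space X] [CompactSpace X] [ChartedSpace (EuclideanSpace ℝ (Fin n)) X]
  [IsManifold (𝓡 n) ∞ X] {c : Collar n B X}

/-! ### The algebra of local operators -/

theorem IsLocOp.mono {μ μ' w : ℕ} (h : μ ≤ μ') {A : testFun n B →ₗ[ℂ] testFun n B}
    (hA : IsLocOp c μ w A) : IsLocOp c μ' w A := by
  refine ⟨fun e he => ?_, fun ψ hψ => ?_⟩
  · obtain ⟨L, h1, h2⟩ := hA.int e he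
    exact ⟨L, fun x hx => ⟨(h1 x hx).1, (h1 x hx).2.trans h⟩, h2⟩
  · obtain ⟨L, h1, h2⟩ := hA.col ψ hψ
    exact ⟨L, fun x hx => ⟨(h1 x hx).1, (h1 x hx).2.trans h⟩, h2⟩

theorem Patch.IsOpList.add {E ι : Type*} [NormedAddCommGroup E] [NormedSpace ℝ E]
    {Q : Patch n B E ι} {A A' : testFun n B →ₗ[ℂ] testFun n B} {L L' : List ((E → ℂ) × (ι → ℕ))}
    (h : Q.IsOpList A L) (h' : Q.IsOpList A' L') : Q.IsOpList (A + A') (L ++ L') := by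
  intro φ z hz
  have e : ((A + A') φ : B → ℂ) (Q.κ z) = (A φ : B → ℂ) (Q.κ z) + (A' φ : B → ℂ) (Q.κ z) := rfl
  rw [e, h φ z hz, h' φ z hz]
  simp [Frame.comb]

theorem IsLocOp.add {μ w : ℕ} {A A' : testFun n B →ₗ[ℂ] testFun n B}
    (hA : IsLocOp c μ w A) (hA' : IsLocOp c μ w A') : IsLocOp c μ w (A + A') := by
  refine ⟨fun e he => ?_, fun ψ hψ => ?_⟩
  · obtain ⟨L, h1, h2⟩ := hA.int e he
    obtain ⟨L', h1', h2'⟩ := hA'.int e he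
    exact ⟨L ++ L', fun x hx => (List.mem_append.1 hx).elim (h1 x) (h1' x), h2.add h2'⟩
  · obtain ⟨L, h1, h2⟩ := hA.col ψ hψ
    obtain ⟨L', h1', h2'⟩ := hA'.col ψ hψ
    exact ⟨L ++ L', fun x hx => (List.mem_append.1 hx).elim (h1 x) (h1' x), h2.add h2'⟩

theorem Patch.IsOpList.neg {E ι : Type*} [NormedAddCommGroup E] [NormedSpace ℝ E]
    {Q : Patch n B E ι} {A : testFun n B →ₗ[ℂ] testFun n B} {L : List ((E → ℂ) × (ι → ℕ))}
    (h : Q.IsOpList A L) : Q.IsOpList (-A) (L.map fun x => (fun z => -x.1 z, x.2)) := by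
  intro φ z hz
  have e : ((-A) φ : B → ℂ) (Q.κ z) = -(A φ : B → ℂ) (Q.κ z) := rfl
  rw [e, h φ z hz]
  clear h e
  induction L with
  | nil => simp [Frame.comb]
  | cons x L ih =>
    have key : ∀ (x : (E → ℂ) × (ι → ℕ)) L g,
        Frame.comb (x :: L) g z = x.1 z * g x.2 z + Frame.comb L g z := by simp [Frame.comb]
    rw [List.map_cons, key, key, ← ih]
    ring

theorem ConeAdm.neg {U : Set (EuclideanSpace ℝ (Fin n))} {w : ℕ}
    {a : ℝ × EuclideanSpace ℝ (Fin n) → ℂ} (h : ConeAdm U w a) : ConeAdm U w fun z => -a z := by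
  obtain ⟨F, hF, h⟩ := h
  exact ⟨fun z => -F z, hF.neg, fun z hz => by simp only [← h z hz]; ring⟩

theorem IsLocOp.neg {μ w : ℕ} {A : testFun n B →ₗ[ℂ] testFun n B}
    (hA : IsLocOp c μ w A) : IsLocOp c μ w (-A) := by
  refine ⟨fun e he => ?_, fun ψ hψ => ?_⟩
  · obtain ⟨L, h1, h2⟩ := hA.int e he
    refine ⟨_, fun x hx => ?_, h2.neg⟩
    obtain ⟨y, hy, rfl⟩ := List.mem_map.1 hx
    exact ⟨(h1 y hy).1.neg, (h1 y hy).2⟩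
  · obtain ⟨L, h1, h2⟩ := hA.col ψ hψ
    refine ⟨_, fun x hx => ?_, h2.neg⟩
    obtain ⟨y, hy, rfl⟩ := List.mem_map.1 hx
    exact ⟨(h1 y hy).1.neg, (h1 y hy).2⟩

/-- Multiplication operators. -/
theorem isLocOp_mulOp {w : ℕ} {a : B → ℂ}
    (ha : ContMDiffOn (𝓡∂ (n + 1)) 𝓘(ℝ, ℂ) ∞ a ((𝓡∂ (n + 1)).interior B))
    (hc : ∀ ψ ∈ IsManifold.maximalAtlas (𝓡 n) ∞ X, ConeAdm ψ.target w (a ∘ collarCoord c ψ)) :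
    IsLocOp c 0 w (mulOp a ha) := by
  refine ⟨fun e he => ⟨[(a ∘ (intPatch e he).κ, 0)], ?_, ?_⟩,
    fun ψ hψ => ⟨[(a ∘ (colPatch c ψ hψ).κ, 0)], ?_, ?_⟩⟩
  · intro x hx
    rw [List.mem_singleton.1 hx]
    exact ⟨Patch.pull_smooth (Q := intPatch e he) (ha.mono (intPatch e he).image_sub), by simp⟩
  · intro φ z _
    simp [Frame.comb, mulOp_apply, Frame.D_zero]
  · intro x hx
    rw [List.mem_singleton.1 hx]
    exact ⟨hc ψ hψ, by simp⟩
  · intro φ z _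
    simp [Frame.comb, mulOp_apply, Frame.D_zero]

/-- Functions which are smooth up to the boundary have smooth coordinate expressions. -/
theorem coneAdm_of_contMDiff {G : B → ℂ} (hG : ContMDiff (𝓡∂ (n + 1)) 𝓘(ℝ, ℂ) ∞ G) (w : ℕ)
    {ψ : OpenPartialHomeomorph X (EuclideanSpace ℝ (Fin n))}
    (hψ : ψ ∈ IsManifold.maximalAtlas (𝓡 n) ∞ X) : ConeAdm ψ.target w (G ∘ collarCoord c ψ) :=
  ⟨fun z => (z.1 : ℂ) ^ w * (G ∘ collarCoord c ψ) z,
    (contDiff_fst_pow w).contDiffOn.mul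
      (hG.comp_contMDiffOn (contMDiffOn_collarCoord c hψ)).contDiffOn, fun _ _ => rfl⟩

theorem isLocOp_mulOp_of_contMDiff {G : B → ℂ} (hG : ContMDiff (𝓡∂ (n + 1)) 𝓘(ℝ, ℂ) ∞ G)
    (w : ℕ) : IsLocOp c 0 w (mulOp G hG.contMDiffOn) :=
  isLocOp_mulOp _ fun _ hψ => coneAdm_of_contMDiff hG w hψ

theorem mulOp_one : mulOp (fun _ : B => (1 : ℂ)) (contMDiff_const.contMDiffOn) =
    (LinearMap.id : testFun n B →ₗ[ℂ] testFun n B) := by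
  ext φ
  simp [mulOp_apply]

theorem mulOp_zero : mulOp (fun _ : B => (0 : ℂ)) (contMDiff_const.contMDiffOn) =
    (0 : testFun n B →ₗ[ℂ] testFun n B) := by
  ext φ
  simp [mulOp_apply]

variable [MeasurableSpace B] [BorelSpace B] {m : Measure B}

theorem isFormalTranspose_mulOp (a : B → ℂ) (ha) :
    IsFormalTranspose m (mulOp a ha) (mulOp (n := n) a ha) := by
  intro φ ψ
  congr 1
  funext y
  simp only [mulOp_apply]
  ring

/-! ### The algebra of bounded operators -/

theorem intNorm_add_le (hm : IsConeMeasure c m) (D : NormData c) (k : ℤ) (γ : ℝ) {p : ℝ}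
    (hp : 1 < p) (u v : GenFun n B) :
    intNorm m D k γ p (u + v) ≤ intNorm m D k γ p u + intNorm m D k γ p v := by
  rcases k with k | k
  · change _ ≤ (⨅ (f : B → ℂ) (_ : IsGivenBy m u f), funNorm D k γ p f) +
      ⨅ (f : B → ℂ) (_ : IsGivenBy m v f), funNorm D k γ p f
    simp only [ENNReal.iInf_add, ENNReal.add_iInf]
    refine le_iInf fun f => le_iInf fun hf => le_iInf fun f' => le_iInf fun hf' => ?_
    -- If a representative is not locally Sobolev, its norm is ⊤. Otherwise both are locally
    -- integrable, so that the sum of the representatives represents u + v.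
    by_cases h : SobolevLoc n k p f
    · by_cases h' : SobolevLoc n k p f'
      · refine (iInf₂_le (fun y => f y + f' y) fun φ => ?_).trans ((funNorm_add_le D k γ hp f f').trans_eq
          (add_comm _ _))
        simp only [add_mul]
        rw [integral_add (integrable_mul_testFun (h.locallyIntegrableOn hm) φ)
          (integrable_mul_testFun (h'.locallyIntegrableOn hm) φ), ← hf φ, ← hf' φ, add_comm (v φ)]
        rfl
      · have : funNorm D k γ p f' = ⊤ := by simp [funNorm, h']
        simp [this]
    · have : funNorm D k γ p f = ⊤ := by simp [funNorm, h]
      simp [this]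
  · refine iSup₂_le fun φ hφ => ?_
    refine (enorm_add_le (u φ) (v φ)).trans (add_le_add ?_ ?_)
    · exact le_iSup₂ (f := fun (φ : testFun n B)
        (_ : funNorm D (k + 1) (-γ) p.conjExponent φ ≤ 1) => ‖u φ‖ₑ) φ hφ
    · exact le_iSup₂ (f := fun (φ : testFun n B)
        (_ : funNorm D (k + 1) (-γ) p.conjExponent φ ≤ 1) => ‖v φ‖ₑ) φ hφ

/-- The space in the middle has order k + μ and weight γ + w. The transposes compose in the reverse
order. -/
theorem IsBddOp.comp {D : NormData c} {μ w μ' w' : ℕ} {A At A' At' : testFun n B →ₗ[ℂ] testFun n B}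
    (h : IsBddOp m D μ w A At) (h' : IsBddOp m D μ' w' A' At') :
    IsBddOp m D (μ + μ') (w + w') (A ∘ₗ A') (At' ∘ₗ At) := by
  refine ⟨fun φ ψ => (h.transpose (A' φ) ψ).trans (h'.transpose φ (At ψ)), fun p hp k γ => ?_⟩
  obtain ⟨C, hC⟩ := h.bound p hp k γ
  obtain ⟨C', hC'⟩ := h'.bound p hp (k + μ) (γ + w)
  refine ⟨C * C', fun u => ?_⟩
  have e : (At' ∘ₗ At).dualMap u = At.dualMap (At'.dualMap u) := rfl
  rw [e]
  refine (hC _).trans ?_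
  rw [ENNReal.coe_mul, mul_assoc]
  refine mul_le_mul_right ?_ _
  have := hC' u
  rwa [add_assoc, add_assoc, ← Nat.cast_add, ← Nat.cast_add] at this

theorem IsFormalTranspose.add {A At A' At' : testFun n B →ₗ[ℂ] testFun n B}
    (hm : IsConeMeasure c m) (h : IsFormalTranspose m A At) (h' : IsFormalTranspose m A' At') :
    IsFormalTranspose m (A + A') (At + At') := by
  have hi : ∀ φ ψ : testFun n B, Integrable (fun y => (φ : B → ℂ) y * (ψ : B → ℂ) y) m :=
    fun φ ψ => integrable_mul_testFun
      ((sobolevLoc_testFun 0 2 φ).locallyIntegrableOn hm) ψ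
  intro φ ψ
  have e1 : ∀ y, ((A + A') φ : B → ℂ) y * (ψ : B → ℂ) y =
      (A φ : B → ℂ) y * (ψ : B → ℂ) y + (A' φ : B → ℂ) y * (ψ : B → ℂ) y := fun y => add_mul _ _ _
  have e2 : ∀ y, (φ : B → ℂ) y * ((At + At') ψ : B → ℂ) y =
      (φ : B → ℂ) y * (At ψ : B → ℂ) y + (φ : B → ℂ) y * (At' ψ : B → ℂ) y :=
    fun y => mul_add _ _ _
  simp_rw [e1, e2]
  rw [integral_add (hi _ _) (hi _ _), integral_add (hi _ _) (hi _ _), h, h']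

theorem IsBddOp.add (hm : IsConeMeasure c m) {D : NormData c} {μ w : ℕ}
    {A At A' At' : testFun n B →ₗ[ℂ] testFun n B}
    (h : IsBddOp m D μ w A At) (h' : IsBddOp m D μ w A' At') :
    IsBddOp m D μ w (A + A') (At + At') := by
  refine ⟨h.transpose.add hm h'.transpose, fun p hp k γ => ?_⟩
  obtain ⟨C, hC⟩ := h.bound p hp k γ
  obtain ⟨C', hC'⟩ := h'.bound p hp k γ
  refine ⟨C + C', fun u => ?_⟩
  have e : (At + At').dualMap u = At.dualMap u + At'.dualMap u := by
    ext φ; exact map_add u _ _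
  rw [e, ENNReal.coe_add, add_mul]
  exact (intNorm_add_le hm D k γ hp _ _).trans (add_le_add (hC u) (hC' u))

variable (m) in
/-- `A` has a formal transpose and is bounded. -/
def HasBdd (D : NormData c) (μ w : ℕ) (A : testFun n B →ₗ[ℂ] testFun n B) : Prop :=
  ∃ At, IsBddOp m D μ w A At

theorem hasBdd_mulOp (hm : IsConeMeasure c m) (D : NormData c) {w : ℕ} {a : B → ℂ}
    (ha : ContMDiffOn (𝓡∂ (n + 1)) 𝓘(ℝ, ℂ) ∞ a ((𝓡∂ (n + 1)).interior B))
    (hc : ∀ ψ ∈ IsManifold.maximalAtlas (𝓡 n) ∞ X, ConeAdm ψ.target w (a ∘ collarCoord c ψ)) :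
    HasBdd m D 0 w (mulOp a ha) :=
  ⟨_, isBddOp_of_isLocOp hm D zero_le_one (isLocOp_mulOp ha hc) (isLocOp_mulOp ha hc)
    (isFormalTranspose_mulOp a ha)⟩

/-- Read as an operator of order μ ≤ 1 and weight w, the identity expresses the embeddings between
spaces of neighbouring order. -/
theorem hasBdd_id (hm : IsConeMeasure c m) (D : NormData c) {μ : ℕ} (hμ : μ ≤ 1) (w : ℕ) :
    HasBdd m D μ w LinearMap.id := by
  have h := (isLocOp_mulOp_of_contMDiff (c := c) (G := fun _ : B => (1 : ℂ))
    contMDiff_const w).mono (Nat.zero_le μ)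
  have ht := isFormalTranspose_mulOp (m := m) (n := n) (fun _ : B => (1 : ℂ))
    contMDiff_const.contMDiffOn
  rw [mulOp_one] at h ht
  exact ⟨_, isBddOp_of_isLocOp hm D hμ h h ht⟩

theorem hasBdd_zero (hm : IsConeMeasure c m) (D : NormData c) (w : ℕ) :
    HasBdd m D 0 w 0 := by
  rw [← mulOp_zero]
  exact hasBdd_mulOp hm D _ fun _ hψ => coneAdm_of_contMDiff contMDiff_const w hψ

theorem HasBdd.comp {D : NormData c} {μ w μ' w' : ℕ} {A A' : testFun n B →ₗ[ℂ] testFun n B}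
    (h : HasBdd m D μ w A) (h' : HasBdd m D μ' w' A') :
    HasBdd m D (μ + μ') (w + w') (A ∘ₗ A') := by
  obtain ⟨At, h⟩ := h
  obtain ⟨At', h'⟩ := h'
  exact ⟨_, h.comp h'⟩

/-- The order is raised one step at a time by composing with the identity regarded as an operator of
order one. -/
theorem HasBdd.mono (hm : IsConeMeasure c m) {D : NormData c} {μ μ' w : ℕ} (hμ : μ ≤ μ')
    {A : testFun n B →ₗ[ℂ] testFun n B} (h : HasBdd m D μ w A) : HasBdd m D μ' w A := by
  induction μ', hμ using Nat.le_induction with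
  | base => exact h
  | succ k hk ih => exact ih.comp (hasBdd_id hm D le_rfl 0)

theorem HasBdd.add (hm : IsConeMeasure c m) {D : NormData c} {μ w : ℕ}
    {A A' : testFun n B →ₗ[ℂ] testFun n B} (h : HasBdd m D μ w A) (h' : HasBdd m D μ w A') :
    HasBdd m D μ w (A + A') := by
  obtain ⟨At, h⟩ := h
  obtain ⟨At', h'⟩ := h'
  exact ⟨_, h.add hm h'⟩

theorem HasBdd.sum (hm : IsConeMeasure c m) {D : NormData c} {μ w : ℕ} {κ : Type*} (s : Finset κ)
    {A : κ → testFun n B →ₗ[ℂ] testFun n B} (h : ∀ i ∈ s, HasBdd m D μ w (A i)) :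
    HasBdd m D μ w (∑ i ∈ s, A i) := by
  classical
  induction s using Finset.induction_on with
  | empty => exact (hasBdd_zero hm D w).mono hm (Nat.zero_le μ)
  | insert i s hi ih =>
    rw [Finset.sum_insert hi]
    exact (h i (by simp)).add hm (ih fun j hj => h j (by simp [hj]))

end Algebra

/-! ### Vector fields with a cut-off -/

theorem Frame.X_eq_zero {E ι : Type*} [NormedAddCommGroup E] [NormedSpace ℝ E] (P : Frame E ι)
    (i : ι) {f : E → ℂ} {z : E} (h : f =ᶠ[𝓝 z] fun _ => 0) : P.X i f z = 0 := by
  simp [Frame.X, h.fderiv_eq]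

open Classical in
-- Near points mapped into U the product is smooth; near all others χ ∘ κ vanishes. The set S need
-- not be open, so that S = [0,1) × U, with smoothness up to t = 0, is allowed.
theorem ContDiffOn.ite_mul {B E : Type*} [TopologicalSpace B] [NormedAddCommGroup E]
    [NormedSpace ℝ E] {S : Set E} {κ : E → B} {χ : B → ℂ} {U : Set B} {g : E → ℂ}
    (hκ : ContinuousOn κ S) (hχ : ContDiffOn ℝ ∞ (χ ∘ κ) S) (hU : IsOpen U)
    (hs : ∀ z ∈ S, κ z ∈ tsupport χ → κ z ∈ U) (hg : ContDiffOn ℝ ∞ g (S ∩ κ ⁻¹' U)) :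
    ContDiffOn ℝ ∞ (fun z => if κ z ∈ U then χ (κ z) * g z else 0) S := by
  intro z hz
  by_cases h : κ z ∈ U
  · have hn : S ∩ κ ⁻¹' U ∈ 𝓝[S] z :=
      inter_mem self_mem_nhdsWithin ((hκ z hz).preimage_mem_nhdsWithin (hU.mem_nhds h))
    refine (ContDiffWithinAt.mul (hχ z hz)
      ((hg z ⟨hz, h⟩).mono_of_mem_nhdsWithin hn)).congr_of_eventuallyEq ?_ ?_
    · filter_upwards [hn] with w hw
      exact if_pos hw.2
    · exact if_pos h
  · have hn : κ ⁻¹' (tsupport χ)ᶜ ∈ 𝓝[S] z := (hκ z hz).preimage_mem_nhdsWithin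
      ((isClosed_tsupport χ).isOpen_compl.mem_nhds fun hh => h (hs z hz hh))
    refine contDiffWithinAt_const (c := (0 : ℂ)).congr_of_eventuallyEq ?_ ?_
    · filter_upwards [hn] with w hw
      rw [image_eq_zero_of_notMem_tsupport hw]
      simp
    · exact if_neg h

namespace Patch

variable {n : ℕ} {B E ι : Type*} [TopologicalSpace B] [T2Space B] [CompactSpace B]
  [ChartedSpace (EuclideanHalfSpace (n + 1)) B] [IsManifold (𝓡∂ (n + 1)) ∞ B]
  [NormedAddCommGroup E] [NormedSpace ℝ E]

/-- The `i`-th vector field of the patch `Q`, multiplied by the cut-off function `χ`. -/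
def fieldOp (Q : Patch n B E ι) (i : ι) (χ : B → ℂ)
    (hχ : ContMDiff (𝓡∂ (n + 1)) 𝓘(ℝ, ℂ) ∞ χ)
    (hs : tsupport χ ∩ (𝓡∂ (n + 1)).interior B ⊆ Q.reg) : testFun n B →ₗ[ℂ] testFun n B where
  toFun φ := mkTest (fun y => χ y * Q.ext (Q.X i ((φ : B → ℂ) ∘ Q.κ)) y) Q.reg
    -- The cut-off may be nonzero on the boundary of B, which no patch reaches. Intersecting with
    -- the support of φ gives a closed set inside the patch.
    (tsupport χ ∩ tsupport (φ : B → ℂ)) isOpen_reg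
    ((isClosed_tsupport _).inter (isClosed_tsupport _))
    (fun y hy => hs ⟨hy.1, φ.2.2.2 hy.2⟩) (inter_subset_right.trans φ.2.2.2)
    (hχ.contMDiffOn.mul_complex (ext_smooth (Frame.X_smooth i (testFun_pull φ))))
    (by
      intro y hy
      by_cases h1 : y ∈ tsupport χ
      · have h2 : y ∉ tsupport (φ : B → ℂ) := fun h => hy ⟨h1, h⟩
        by_cases h3 : y ∈ Q.reg
        · rw [ext_of_mem _ h3, Frame.X_eq_zero, mul_zero]
          have hO : IsOpen (Q.dom ∩ Q.κ ⁻¹' (tsupport (φ : B → ℂ))ᶜ) :=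
            Q.smooth.continuousOn.isOpen_inter_preimage Q.isOpen_dom
              (isClosed_tsupport _).isOpen_compl
          filter_upwards [hO.mem_nhds ⟨inv_mem h3, by
            change Q.κ (Q.inv y) ∉ _; rwa [right_inv h3]⟩] with w hw
          exact image_eq_zero_of_notMem_tsupport (f := (φ : B → ℂ)) hw.2
        · rw [ext_of_notMem _ h3, mul_zero]
      · rw [image_eq_zero_of_notMem_tsupport h1, zero_mul])
  map_add' φ ψ := by
    apply Subtype.ext; funext y
    change χ y * Q.ext (Q.X i ((φ : B → ℂ) ∘ Q.κ + (ψ : B → ℂ) ∘ Q.κ)) y =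
      χ y * Q.ext (Q.X i ((φ : B → ℂ) ∘ Q.κ)) y + χ y * Q.ext (Q.X i ((ψ : B → ℂ) ∘ Q.κ)) y
    by_cases h : y ∈ Q.reg
    · have hd : ∀ φ : testFun n B, DifferentiableAt ℝ ((φ : B → ℂ) ∘ Q.κ) (Q.inv y) := fun φ =>
        ((testFun_pull φ).contDiffAt (Q.isOpen_dom.mem_nhds (inv_mem h))).differentiableAt
          (by simp)
      simp only [ext_of_mem _ h, Frame.X, fderiv_add (hd φ) (hd ψ)]
      simp only [add_apply]
      ring
    · simp [ext_of_notMem _ h]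
  map_smul' r φ := by
    apply Subtype.ext; funext y
    change χ y * Q.ext (Q.X i (fun z => r * ((φ : B → ℂ) ∘ Q.κ) z)) y =
      r * (χ y * Q.ext (Q.X i ((φ : B → ℂ) ∘ Q.κ)) y)
    by_cases h : y ∈ Q.reg
    · have hd : DifferentiableAt ℝ ((φ : B → ℂ) ∘ Q.κ) (Q.inv y) :=
        ((testFun_pull φ).contDiffAt (Q.isOpen_dom.mem_nhds (inv_mem h))).differentiableAt
          (by simp)
      simp only [ext_of_mem _ h, Frame.X, fderiv_const_mul hd]
      simp only [smul_apply, smul_eq_mul]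
      ring
    · simp [ext_of_notMem _ h]

variable {Q : Patch n B E ι} {i : ι} {χ : B → ℂ}
  {hχ : ContMDiff (𝓡∂ (n + 1)) 𝓘(ℝ, ℂ) ∞ χ}
  {hs : tsupport χ ∩ (𝓡∂ (n + 1)).interior B ⊆ Q.reg}

theorem fieldOp_apply (φ : testFun n B) (y : B) : (Q.fieldOp i χ hχ hs φ : B → ℂ) y =
    χ y * Q.ext (Q.X i ((φ : B → ℂ) ∘ Q.κ)) y := rfl

theorem fieldOp_κ (φ : testFun n B) {z : E} (hz : z ∈ Q.dom) :
    (Q.fieldOp i χ hχ hs φ : B → ℂ) (Q.κ z) = χ (Q.κ z) * Q.X i ((φ : B → ℂ) ∘ Q.κ) z := by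
  rw [fieldOp_apply, ext_κ _ hz]

theorem fieldOp_of_notMem (φ : testFun n B) {y : B} (hy : y ∉ Q.reg) :
    (Q.fieldOp i χ hχ hs φ : B → ℂ) y = 0 := by
  rw [fieldOp_apply, ext_of_notMem _ hy, mul_zero]

/-! ### Vector fields in other patches -/

section Transition

variable {E' ι' : Type*} [NormedAddCommGroup E'] [NormedSpace ℝ E'] {P : Patch n B E' ι'}

variable (Q P i) in
/-- The `i`-th vector of the patch `Q` in the coordinates of the patch `P`. -/
def transVec (z : E') : E' := fderiv ℝ (P.inv ∘ Q.κ) (Q.inv (P.κ z)) (Q.vec i)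

theorem isOpen_overlap : IsOpen (P.dom ∩ P.κ ⁻¹' Q.reg) :=
  P.smooth.continuousOn.isOpen_inter_preimage P.isOpen_dom isOpen_reg

theorem trans_smooth : ContDiffOn ℝ ∞ (P.inv ∘ Q.κ) (Q.dom ∩ Q.κ ⁻¹' P.reg) :=
  (P.smooth_inv.comp (Q.smooth.mono inter_subset_left) fun _ hz => hz.2).contDiffOn

theorem inv_κ_mem {z : E'} (hz : z ∈ P.dom ∩ P.κ ⁻¹' Q.reg) :
    Q.inv (P.κ z) ∈ Q.dom ∩ Q.κ ⁻¹' P.reg := by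
  refine ⟨inv_mem hz.2, ?_⟩
  change Q.κ (Q.inv (P.κ z)) ∈ P.reg
  rw [right_inv hz.2]
  exact κ_mem hz.1

theorem transVec_smooth : ContDiffOn ℝ ∞ (Q.transVec i P) (P.dom ∩ P.κ ⁻¹' Q.reg) := by
  have h1 : ContDiffOn ℝ ∞ (fun z => fderiv ℝ (P.inv ∘ Q.κ) z (Q.vec i))
      (Q.dom ∩ Q.κ ⁻¹' P.reg) :=
    (trans_smooth.fderiv_of_isOpen isOpen_overlap (by simp)).clm_apply contDiffOn_const
  exact h1.comp (trans_smooth (Q := P) (P := Q)) fun z hz => inv_κ_mem hz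

/-- The chain rule for the transition map `P.inv ∘ Q.κ`. -/
theorem X_pull_eq (φ : testFun n B) {z : E'} (hz : z ∈ P.dom ∩ P.κ ⁻¹' Q.reg) :
    Q.X i ((φ : B → ℂ) ∘ Q.κ) (Q.inv (P.κ z)) =
      Q.wt i (Q.inv (P.κ z)) * fderiv ℝ ((φ : B → ℂ) ∘ P.κ) z (Q.transVec i P z) := by
  have hw := inv_κ_mem hz
  have hO : IsOpen (Q.dom ∩ Q.κ ⁻¹' P.reg) := isOpen_overlap
  have he : (φ : B → ℂ) ∘ Q.κ =ᶠ[𝓝 (Q.inv (P.κ z))] ((φ : B → ℂ) ∘ P.κ) ∘ (P.inv ∘ Q.κ) := by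
    filter_upwards [hO.mem_nhds hw] with w hw
    simp only [Function.comp_apply]
    rw [right_inv hw.2]
  have hz' : (P.inv ∘ Q.κ) (Q.inv (P.κ z)) = z := by
    simp only [Function.comp_apply]
    rw [right_inv hz.2, P.left_inv z hz.1]
  have h1 : DifferentiableAt ℝ (P.inv ∘ Q.κ) (Q.inv (P.κ z)) :=
    (trans_smooth.contDiffAt (hO.mem_nhds hw)).differentiableAt (by simp)
  have h2 : DifferentiableAt ℝ ((φ : B → ℂ) ∘ P.κ) ((P.inv ∘ Q.κ) (Q.inv (P.κ z))) := by
    rw [hz']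
    exact ((testFun_pull φ).contDiffAt (P.isOpen_dom.mem_nhds hz.1)).differentiableAt (by simp)
  unfold Frame.X transVec
  rw [he.fderiv_eq, fderiv_comp _ h2 h1, hz']
  rfl

open Classical in
variable (Q P i χ) in
/-- The coefficients of a vector field of the patch `Q` in the patch `P`, where `co z v` are
the coefficients of the vector `v` with respect to the frame of `P`. -/
def fieldCoef (co : E' → E' → ι' → ℂ) (l : ι') (z : E') : ℂ :=
  if P.κ z ∈ Q.reg then
    χ (P.κ z) * (Q.wt i (Q.inv (P.κ z)) * co z (Q.transVec i P z) l) else 0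

/-- The transported vector is expanded in the frame of `P`, which leaves one term of order one for
each field of that frame. -/
theorem isOpList_fieldOp [Fintype ι'] [DecidableEq ι'] {co : E' → E' → ι' → ℂ}
    (hco : ∀ z ∈ P.dom, ∀ v f, fderiv ℝ f z v = ∑ l, co z v l * P.X l f z) :
    P.IsOpList (Q.fieldOp i χ hχ hs) ((Finset.univ : Finset ι').toList.map fun l =>
      (Q.fieldCoef i χ P co l, Pi.single l 1)) := by
  intro φ z hz
  have hD : ∀ l, P.D (Pi.single l 1) ((φ : B → ℂ) ∘ P.κ) z = P.X l ((φ : B → ℂ) ∘ P.κ) z := by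
    intro l
    have := Frame.D_succ (P := P.toFrame) 0 l (testFun_pull φ) hz
    rwa [zero_add, Frame.D_zero] at this
  unfold Frame.comb
  rw [List.map_map, Finset.sum_map_toList]
  simp only [Function.comp_apply, hD]
  by_cases h : P.κ z ∈ Q.reg
  · rw [fieldOp_apply, ext_of_mem _ h, X_pull_eq φ ⟨hz, h⟩, hco z hz, Finset.mul_sum,
      Finset.mul_sum]
    refine Finset.sum_congr rfl fun l _ => ?_
    simp only [fieldCoef, if_pos h]
    ring
  · rw [fieldOp_of_notMem _ h]
    simp [fieldCoef, h]

theorem fieldCoef_smooth (hχ : ContMDiff (𝓡∂ (n + 1)) 𝓘(ℝ, ℂ) ∞ χ)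
    (hs : tsupport χ ∩ (𝓡∂ (n + 1)).interior B ⊆ Q.reg) {co : E' → E' → ι' → ℂ}
    (hco : ∀ l, ContDiffOn ℝ ∞ (fun z => co z (Q.transVec i P z) l) (P.dom ∩ P.κ ⁻¹' Q.reg))
    (l : ι') : ContDiffOn ℝ ∞ (Q.fieldCoef i χ P co l) P.dom := by
  refine ContDiffOn.ite_mul P.smooth.continuousOn (pull_smooth hχ.contMDiffOn) isOpen_reg
    (fun z hz h => hs ⟨h, P.image_sub (κ_mem hz)⟩) (ContDiffOn.mul ?_ (hco l))
  exact (Q.wt_smooth i).comp_contDiffOn (trans_smooth (Q := P) (P := Q))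

end Transition

/-! ### The transpose of a vector field -/

section Transpose

variable [MeasurableSpace B] [BorelSpace B] [FiniteDimensional ℝ E] [MeasureSpace E] [BorelSpace E]
  [(volume : Measure E).IsAddHaarMeasure] {m : Measure B} {ρ : E → ℝ}

/-- In coordinates dm = (ρ/q) q dz, so with h = (ρ/q) χψ antisymmetry gives −∫ φ · Xh · q dz. Here
Xh = (ρ/q)(χ Xψ + bψ), where b (ρ/q) = X((ρ/q) χ) is the divergence of the cut-off field with
respect to m. -/
theorem isFormalTranspose_fieldOp (hρ : Q.IsDens m ρ) {b : B → ℂ}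
    (hb : ContMDiffOn (𝓡∂ (n + 1)) 𝓘(ℝ, ℂ) ∞ b ((𝓡∂ (n + 1)).interior B))
    (hb0 : ∀ y ∈ (𝓡∂ (n + 1)).interior B, y ∉ Q.reg → b y = 0)
    (hbρ : ∀ z ∈ Q.dom, b (Q.κ z) * (ρ z * (Q.q z)⁻¹) =
      Q.X i (fun z => (ρ z * (Q.q z)⁻¹) * χ (Q.κ z)) z) :
    IsFormalTranspose m (Q.fieldOp i χ hχ hs) (-(Q.fieldOp i χ hχ hs + mulOp b hb)) := by
  intro φ ψ
  have hρs : ContDiffOn ℝ ∞ (fun z => (ρ z : ℂ) * (Q.q z)⁻¹) Q.dom :=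
    (Complex.ofRealCLM.contDiff.comp_contDiffOn hρ.smooth).mul (Q.q_smooth.inv Q.q_ne)
  have hχs : ContDiffOn ℝ ∞ (χ ∘ Q.κ) Q.dom := pull_smooth hχ.contMDiffOn
  have hφs := testFun_pull (Q := Q) φ
  have hψs := testFun_pull (Q := Q) ψ
  have hsup : tsupport (mulOp χ hχ.contMDiffOn ψ : B → ℂ) ⊆ Q.reg := fun y hy =>
    hs ⟨tsupport_mulOp_left _ _ _ hy, ψ.2.2.2 (tsupport_mulOp_right _ _ _ hy)⟩
  set θ := Q.dom.indicator ((mulOp χ hχ.contMDiffOn ψ : B → ℂ) ∘ Q.κ) with hθ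
  have tθ : IsTest Q.dom θ := pull_test hsup
  set h : E → ℂ := fun z => (ρ z * (Q.q z)⁻¹) * θ z with hh
  have th : IsTest Q.dom h := tθ.mul_left Q.isOpen_dom hρs
  have hhd : EqOn h (fun z => ((ρ z * (Q.q z)⁻¹) * χ (Q.κ z)) * ((ψ : B → ℂ) ∘ Q.κ) z) Q.dom := by
    intro z hz
    simp only [hh, hθ, indicator_of_mem hz, Function.comp_apply, mulOp_apply]
    ring
  have hXh : ∀ z ∈ Q.dom, Q.X i h z = b (Q.κ z) * (ρ z * (Q.q z)⁻¹) * (ψ : B → ℂ) (Q.κ z) +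
      (ρ z * (Q.q z)⁻¹) * χ (Q.κ z) * Q.X i ((ψ : B → ℂ) ∘ Q.κ) z := by
    intro z hz
    rw [Frame.X_congr (P := Q.toFrame) i Q.isOpen_dom hhd hz,
      Frame.X_mul (P := Q.toFrame) i (f := fun z => (ρ z * (Q.q z)⁻¹) * χ (Q.κ z))
      (hρs.mul hχs) hψs hz, hbρ z hz]
    simp only [Function.comp_apply]
  have e1 : ∫ y, (Q.fieldOp i χ hχ hs φ : B → ℂ) y * (ψ : B → ℂ) y ∂m =
      ∫ z, Q.X i ((φ : B → ℂ) ∘ Q.κ) z * h z * Q.q z := by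
    rw [← integral_eq_setIntegral_reg (Q := Q) fun y hy => by rw [fieldOp_of_notMem _ hy, zero_mul],
      hρ.setIntegral_reg]
    refine Eq.trans ?_ (setIntegral_eq_integral_of_forall_compl_eq_zero (s := Q.dom)
      fun z hz => by rw [th.eq_zero hz]; ring)
    refine setIntegral_congr_fun Q.isOpen_dom.measurableSet fun z hz => ?_
    have := Q.q_ne z hz
    simp only [fieldOp_κ φ hz, hhd hz, Function.comp_apply]
    field_simp
  have e2 : ∫ y, (φ : B → ℂ) y * ((-(Q.fieldOp i χ hχ hs + mulOp b hb)) ψ : B → ℂ) y ∂m =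
      - ∫ z, ((φ : B → ℂ) ∘ Q.κ) z * Q.X i h z * Q.q z := by
    have e3 : ∀ y, ((-(Q.fieldOp i χ hχ hs + mulOp b hb)) ψ : B → ℂ) y =
        -((Q.fieldOp i χ hχ hs ψ : B → ℂ) y + b y * (ψ : B → ℂ) y) := fun y => rfl
    simp_rw [e3]
    rw [← integral_eq_setIntegral_reg (Q := Q) fun y hy => ?_, hρ.setIntegral_reg,
      ← integral_neg]
    · refine Eq.trans ?_ (setIntegral_eq_integral_of_forall_compl_eq_zero (s := Q.dom)
        fun z hz => by rw [(Frame.X_test i th).eq_zero hz]; ring)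
      refine setIntegral_congr_fun Q.isOpen_dom.measurableSet fun z hz => ?_
      have := Q.q_ne z hz
      simp only [fieldOp_κ ψ hz, hXh z hz, Function.comp_apply]
      field_simp
      ring
    · rw [fieldOp_of_notMem _ hy]
      by_cases hy' : y ∈ (𝓡∂ (n + 1)).interior B
      · rw [hb0 y hy' hy]; ring
      · rw [testFun_eq_zero ψ hy']; ring
  rw [e1, e2]
  rw [Frame.integral_mul_X (P := Q.toFrame) i hφs th, neg_neg]

end Transpose

end Patch

section Fields

variable {n : ℕ} {B X : Type*} [TopologicalSpace B] [T2Space B] [CompactSpace B]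
  [ChartedSpace (EuclideanHalfSpace (n + 1)) B] [IsManifold (𝓡∂ (n + 1)) ∞ B]
  [TopologicalSpace X] [T2Space X] [CompactSpace X] [ChartedSpace (EuclideanSpace ℝ (Fin n)) X]
  [IsManifold (𝓡 n) ∞ X] {c : Collar n B X}

/-! ### Coefficients with respect to the frames -/

theorem coordFrame_coef {d : ℕ} {U : Set (EuclideanSpace ℝ (Fin d))} (hU : IsOpen U)
    (z v : EuclideanSpace ℝ (Fin d)) (f : EuclideanSpace ℝ (Fin d) → ℂ) :
    fderiv ℝ f z v = ∑ l, (v l : ℂ) * (coordFrame d U hU).X l f z := by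
  have hv : v = ∑ l, v l • EuclideanSpace.single l (1 : ℝ) := by
    ext j
    simp [Finset.sum_apply, Pi.single_apply]
  conv_lhs => rw [hv, map_sum]
  refine Finset.sum_congr rfl fun l _ => ?_
  rw [map_smul, Complex.real_smul]
  simp [Frame.X, coordFrame]

/-- The coefficients of a vector with respect to the frame `t ∂_t`, `∂_x`. -/
def coneCoef (z v : ℝ × EuclideanSpace ℝ (Fin n)) (o : Option (Fin n)) : ℂ :=
  o.elim ((v.1 : ℂ) * (z.1 : ℂ)⁻¹) fun l => (v.2 l : ℂ)

theorem coneFrame_coef {U : Set (EuclideanSpace ℝ (Fin n))} (hU : IsOpen U)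
    {z : ℝ × EuclideanSpace ℝ (Fin n)} (hz : z ∈ Ioo (0 : ℝ) 1 ×ˢ U)
    (v : ℝ × EuclideanSpace ℝ (Fin n)) (f : ℝ × EuclideanSpace ℝ (Fin n) → ℂ) :
    fderiv ℝ f z v = ∑ l, coneCoef z v l * (coneFrame n U hU).X l f z := by
  have hz0 := fst_ne_zero hz
  have hv : v = v.1 • ((1 : ℝ), (0 : EuclideanSpace ℝ (Fin n))) +
      ∑ l, v.2 l • ((0 : ℝ), EuclideanSpace.single l (1 : ℝ)) := by
    ext j
    · simp [Prod.fst_sum]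
    · simp [Prod.snd_sum, Finset.sum_apply, Pi.single_apply]
  conv_lhs => rw [hv, map_add, map_sum]
  rw [Fintype.sum_option]
  congr 1
  · rw [map_smul, Complex.real_smul]
    simp only [coneCoef, Frame.X, coneFrame, Option.elim]
    field_simp
  · refine Finset.sum_congr rfl fun l _ => ?_
    rw [map_smul, Complex.real_smul]
    simp [coneCoef, Frame.X, coneFrame]

theorem contDiffOn_coord {E : Type*} [NormedAddCommGroup E] [NormedSpace ℝ E] {d : ℕ} {S : Set E}
    {J : E → EuclideanSpace ℝ (Fin d)} (hJ : ContDiffOn ℝ ∞ J S) (l : Fin d) :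
    ContDiffOn ℝ ∞ (fun z => ((J z l : ℝ) : ℂ)) S :=
  Complex.ofRealCLM.contDiff.comp_contDiffOn
    ((EuclideanSpace.proj l : EuclideanSpace ℝ (Fin d) →L[ℝ] ℝ).contDiff.comp_contDiffOn hJ)

/-! ### Cut-off vector fields as local operators with a transpose -/

section General

variable {E ι : Type*} [NormedAddCommGroup E] [NormedSpace ℝ E] {Q : Patch n B E ι} {i : ι}
  {χ : B → ℂ} {hχ : ContMDiff (𝓡∂ (n + 1)) 𝓘(ℝ, ℂ) ∞ χ}
  {hs : tsupport χ ∩ (𝓡∂ (n + 1)).interior B ⊆ Q.reg}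

theorem sum_single_one {ι' : Type*} [Fintype ι'] [DecidableEq ι'] (l : ι') :
    ∑ j, (Pi.single l 1 : ι' → ℕ) j = 1 := by simp

/-- A vector field with a cut-off is a local operator, if its coefficients in the collar are smooth
up to the boundary. -/
theorem isLocOp_fieldOp (h : ∀ ψ (hψ : ψ ∈ IsManifold.maximalAtlas (𝓡 n) ∞ X) l,
      ConeAdm ψ.target 0 (Q.fieldCoef i χ (colPatch c ψ hψ) coneCoef l)) :
    IsLocOp c 1 0 (Q.fieldOp i χ hχ hs) := by
  classical
  refine ⟨fun e he => ⟨_, ?_, Patch.isOpList_fieldOp (P := intPatch e he)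
      (co := fun _ v l => (v l : ℂ)) fun z _ v f => coordFrame_coef (isOpen_chartDom e) z v f⟩,
    fun ψ hψ => ⟨_, ?_, Patch.isOpList_fieldOp (P := colPatch c ψ hψ)
      (co := coneCoef) fun z hz v f => coneFrame_coef ψ.open_target hz v f⟩⟩
  · intro x hx
    obtain ⟨l, -, rfl⟩ := List.mem_map.1 hx
    exact ⟨Patch.fieldCoef_smooth (P := intPatch e he) (co := fun _ v l => (v l : ℂ)) hχ hs
      (fun l => contDiffOn_coord Patch.transVec_smooth l) l, (sum_single_one l).le⟩
  · intro x hx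
    obtain ⟨l, -, rfl⟩ := List.mem_map.1 hx
    exact ⟨h ψ hψ l, (sum_single_one l).le⟩

theorem coneCoef_smooth {S : Set (ℝ × EuclideanSpace ℝ (Fin n))}
    {J : ℝ × EuclideanSpace ℝ (Fin n) → ℝ × EuclideanSpace ℝ (Fin n)}
    (h0 : ∀ z ∈ S, z.1 ≠ 0) (hJ : ContDiffOn ℝ ∞ J S) (l : Option (Fin n)) :
    ContDiffOn ℝ ∞ (fun z => coneCoef z (J z) l) S := by
  rcases l with _ | l
  · exact (Complex.ofRealCLM.contDiff.comp_contDiffOn (contDiff_fst.comp_contDiffOn hJ)).mul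
      ((Complex.ofRealCLM.contDiff.comp contDiff_fst).contDiffOn.inv fun z hz =>
        Complex.ofReal_ne_zero.2 (h0 z hz))
  · exact contDiffOn_coord (contDiff_snd.comp_contDiffOn hJ) l

/-- Vector fields with compact support in the interior. -/
theorem isLocOp_fieldOp_of_interior (hs' : tsupport χ ⊆ Q.reg) :
    IsLocOp c 1 0 (Q.fieldOp i χ hχ hs) := by
  refine isLocOp_fieldOp fun ψ hψ l => ⟨_, ?_, fun z _ => by rw [pow_zero, one_mul]⟩
  -- The region of a patch lies in the interior, hence meets the collar only where t > 0; the
  -- division by t in `coneCoef` is harmless there.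
  have hreg : ∀ z ∈ Ico (0 : ℝ) 1 ×ˢ ψ.target, collarCoord c ψ z ∈ Q.reg →
      z ∈ (colPatch c ψ hψ).dom := by
    intro z hz h
    have := (c.mem_interior_iff (c.map_mem hz.1 _)).1 (Q.image_sub h)
    rw [c.left_inv_apply hz.1] at this
    exact ⟨⟨this, hz.1.2⟩, hz.2⟩
  have hsm : ContDiffOn ℝ ∞ (χ ∘ collarCoord c ψ) (Ico (0 : ℝ) 1 ×ˢ ψ.target) :=
    (hχ.comp_contMDiffOn (contMDiffOn_collarCoord c hψ)).contDiffOn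
  refine ContDiffOn.ite_mul (contMDiffOn_collarCoord c hψ).continuousOn hsm Patch.isOpen_reg
    (fun z _ h => hs' h) ?_
  have hsub : (Ico (0 : ℝ) 1 ×ˢ ψ.target) ∩ collarCoord c ψ ⁻¹' Q.reg ⊆
      (colPatch c ψ hψ).dom ∩ (colPatch c ψ hψ).κ ⁻¹' Q.reg := fun z hz =>
    ⟨hreg z hz.1 hz.2, hz.2⟩
  refine ContDiffOn.mono ?_ hsub
  refine ContDiffOn.mul ?_ (coneCoef_smooth (fun z hz => ne_of_gt hz.1.1.1)
    Patch.transVec_smooth l)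
  exact (Q.wt_smooth i).comp_contDiffOn (Patch.trans_smooth (Q := colPatch c ψ hψ) (P := Q))

variable [MeasurableSpace B] [BorelSpace B] {m : Measure B}

/-- The divergence term is supported in the support of χ, inside the patch, and so extends by zero
to a smooth function on all of B. The field and its transpose are thus local operators of order one
and weight zero. -/
theorem hasBdd_fieldOp_of_interior (hm : IsConeMeasure c m) (D : NormData c)
    [FiniteDimensional ℝ E] [MeasureSpace E] [BorelSpace E]
    [(volume : Measure E).IsAddHaarMeasure] {ρ : E → ℝ} (hρ : Q.IsDens m ρ)
    (hs' : tsupport χ ⊆ Q.reg) : HasBdd m D 1 0 (Q.fieldOp i χ hχ hs) := by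
  have hρs : ContDiffOn ℝ ∞ (fun z => (ρ z : ℂ) * (Q.q z)⁻¹) Q.dom :=
    (Complex.ofRealCLM.contDiff.comp_contDiffOn hρ.smooth).mul (Q.q_smooth.inv Q.q_ne)
  have hρ0 : ∀ z ∈ Q.dom, (ρ z : ℂ) * (Q.q z)⁻¹ ≠ 0 := fun z hz =>
    mul_ne_zero (Complex.ofReal_ne_zero.2 (hρ.pos z hz).ne') (inv_ne_zero (Q.q_ne z hz))
  -- The solution of b (ρ/q) = X((ρ/q) χ) in coordinates; the factor ρ/q has no zeros.
  set g : E → ℂ := fun z => Q.X i (fun z => (ρ z * (Q.q z)⁻¹) * χ (Q.κ z)) z *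
    (ρ z * (Q.q z)⁻¹)⁻¹ with hg
  have hgs : ContDiffOn ℝ ∞ g Q.dom :=
    (Frame.X_smooth i (hρs.mul (Patch.pull_smooth hχ.contMDiffOn))).mul (hρs.inv hρ0)
  have hb : ContMDiff (𝓡∂ (n + 1)) 𝓘(ℝ, ℂ) ∞ (Q.ext g) := by
    refine contMDiff_of_region Patch.isOpen_reg (isClosed_tsupport χ) hs' (Patch.ext_smooth hgs) ?_
    intro y hy
    by_cases h : y ∈ Q.reg
    · rw [Patch.ext_of_mem _ h, hg]
      simp only
      rw [Frame.X_eq_zero, zero_mul]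
      have hO : IsOpen (Q.dom ∩ Q.κ ⁻¹' (tsupport χ)ᶜ) :=
        Q.smooth.continuousOn.isOpen_inter_preimage Q.isOpen_dom
          (isClosed_tsupport _).isOpen_compl
      filter_upwards [hO.mem_nhds ⟨Patch.inv_mem h, by
        change Q.κ (Q.inv y) ∉ _; rwa [Patch.right_inv h]⟩] with w hw
      rw [image_eq_zero_of_notMem_tsupport (f := χ) hw.2, mul_zero]
    · exact Patch.ext_of_notMem _ h
  have hT := Patch.isFormalTranspose_fieldOp (i := i) (hχ := hχ) (hs := hs) hρ hb.contMDiffOn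
    (fun y _ hy => Patch.ext_of_notMem _ hy) (fun z hz => by
      rw [Patch.ext_κ _ hz]
      simp only [hg]
      rw [mul_assoc, inv_mul_cancel₀ (hρ0 z hz), mul_one])
  have hA : IsLocOp c 1 0 (Q.fieldOp i χ hχ hs) := isLocOp_fieldOp_of_interior hs'
  exact ⟨_, isBddOp_of_isLocOp hm D le_rfl hA
    (hA.add ((isLocOp_mulOp_of_contMDiff hb 0).mono zero_le_one)).neg hT⟩

end General

/-! ### Vector fields in the collar -/

section ColField

variable {ψ ψ' : OpenPartialHomeomorph X (EuclideanSpace ℝ (Fin n))}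

theorem interior_collarReg : collarReg c ψ (Iio 1) ∩ (𝓡∂ (n + 1)).interior B ⊆
    collarReg c ψ (Ioo 0 1) := by
  rintro y ⟨hy, hi⟩
  exact ⟨hy.1, ⟨(c.mem_interior_iff hy.1).1 hi, hy.2.1⟩, hy.2.2⟩

theorem mem_collarReg_iff {z : ℝ × EuclideanSpace ℝ (Fin n)} (hz : z ∈ Ico (0 : ℝ) 1 ×ˢ ψ'.target)
    {J : Set ℝ} : collarCoord c ψ' z ∈ collarReg c ψ J ↔ z.1 ∈ J ∧ ψ'.symm z.2 ∈ ψ.source := by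
  unfold collarReg collarCoord
  simp only [mem_inter_iff, mem_preimage, c.left_inv_apply hz.1, mem_prod]
  exact and_iff_right (c.map_mem hz.1 _)

/-- The change of coordinates of the cross-section. -/
def crossTrans (ψ ψ' : OpenPartialHomeomorph X (EuclideanSpace ℝ (Fin n))) :
    EuclideanSpace ℝ (Fin n) → EuclideanSpace ℝ (Fin n) := fun x => ψ' (ψ.symm x)

theorem isOpen_crossDom : IsOpen (ψ.target ∩ ψ.symm ⁻¹' ψ'.source) :=
  ψ.symm.isOpen_inter_preimage ψ'.open_source

theorem crossTrans_smooth (hψ : ψ ∈ IsManifold.maximalAtlas (𝓡 n) ∞ X)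
    (hψ' : ψ' ∈ IsManifold.maximalAtlas (𝓡 n) ∞ X) :
    ContDiffOn ℝ ∞ (crossTrans ψ ψ') (ψ.target ∩ ψ.symm ⁻¹' ψ'.source) :=
  ((contMDiffOn_of_mem_maximalAtlas hψ').comp
    ((contMDiffOn_symm_of_mem_maximalAtlas hψ).mono inter_subset_left)
    fun _ hz => hz.2).contDiffOn

theorem collarInv_collarCoord {z : ℝ × EuclideanSpace ℝ (Fin n)} (hz : z.1 ∈ Ico (0 : ℝ) 1) :
    collarInv c ψ' (collarCoord c ψ z) = (z.1, crossTrans ψ ψ' z.2) := by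
  unfold collarInv collarCoord crossTrans
  rw [c.left_inv_apply hz]

/-- Two collar patches have the same t, and their transition map is the identity in t times the
coordinate change of the cross-section. Hence ∂_t is preserved and ∂_{x_k} goes to a combination of
the ∂_{x_l}. -/
theorem transVec_colPatch (hψ : ψ ∈ IsManifold.maximalAtlas (𝓡 n) ∞ X)
    (hψ' : ψ' ∈ IsManifold.maximalAtlas (𝓡 n) ∞ X) (i : Option (Fin n))
    {z : ℝ × EuclideanSpace ℝ (Fin n)} (hz : z ∈ Ioo (0 : ℝ) 1 ×ˢ ψ'.target)
    (h : ψ'.symm z.2 ∈ ψ.source) :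
    (colPatch c ψ hψ).transVec i (colPatch c ψ' hψ') z =
      (((colPatch c ψ hψ).vec i).1,
        fderiv ℝ (crossTrans ψ ψ') (crossTrans ψ' ψ z.2) ((colPatch c ψ hψ).vec i).2) := by
  unfold Patch.transVec
  have hz1 : z.1 ∈ Ico (0 : ℝ) 1 := Ioo_subset_Ico_self hz.1
  have e0 : (colPatch c ψ hψ).inv ((colPatch c ψ' hψ').κ z) = (z.1, crossTrans ψ' ψ z.2) :=
    collarInv_collarCoord hz1
  have hx : crossTrans ψ' ψ z.2 ∈ ψ.target ∩ ψ.symm ⁻¹' ψ'.source := by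
    refine ⟨ψ.map_source h, ?_⟩
    simp only [crossTrans, mem_preimage, ψ.left_inv h]
    exact ψ'.map_target hz.2
  have e1 : (colPatch c ψ' hψ').inv ∘ (colPatch c ψ hψ).κ =ᶠ[𝓝 (z.1, crossTrans ψ' ψ z.2)]
      Prod.map id (crossTrans ψ ψ') := by
    filter_upwards [(isOpen_Ioo.prod isOpen_univ).mem_nhds
      (show (z.1, crossTrans ψ' ψ z.2) ∈ Ioo (0 : ℝ) 1 ×ˢ univ from ⟨hz.1, mem_univ _⟩)] with w hw
    exact collarInv_collarCoord (Ioo_subset_Ico_self hw.1)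
  have hd : DifferentiableAt ℝ (crossTrans ψ ψ') (crossTrans ψ' ψ z.2) :=
    ((crossTrans_smooth hψ hψ').contDiffAt (isOpen_crossDom.mem_nhds hx)).differentiableAt (by simp)
  rw [e0, e1.fderiv_eq, ((hasFDerivAt_id (𝕜 := ℝ) z.1).prodMap (p := (z.1, crossTrans ψ' ψ z.2))
    hd.hasFDerivAt).fderiv]
  rfl

variable {i : Option (Fin n)} {χ : B → ℂ}

/-- In another collar patch the frame coefficients, before the cut-off, are 0, 1 or entries of a
Jacobian matrix of the cross-section, all independent of t. They therefore extend smoothly to t = 0.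
-/
theorem coneAdm_fieldCoef (hψ : ψ ∈ IsManifold.maximalAtlas (𝓡 n) ∞ X)
    (hψ' : ψ' ∈ IsManifold.maximalAtlas (𝓡 n) ∞ X)
    (hχ : ContMDiff (𝓡∂ (n + 1)) 𝓘(ℝ, ℂ) ∞ χ) (hs : tsupport χ ⊆ collarReg c ψ (Iio 1))
    (l : Option (Fin n)) :
    ConeAdm ψ'.target 0 ((colPatch c ψ hψ).fieldCoef i χ (colPatch c ψ' hψ') coneCoef l) := by
  classical
  -- The entry 1 arises since the factor t of t∂_t cancels the t^{-1} in `coneCoef`.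
  set G : Option (Fin n) → Option (Fin n) → ℝ × EuclideanSpace ℝ (Fin n) → ℂ := fun i l z =>
    i.elim (l.elim 1 fun _ => 0) fun k => l.elim 0 fun l =>
      ((fderiv ℝ (crossTrans ψ ψ') (crossTrans ψ' ψ z.2) (EuclideanSpace.single k 1) l : ℝ) : ℂ)
    with hG
  set F : ℝ × EuclideanSpace ℝ (Fin n) → ℂ := fun z =>
    if collarCoord c ψ' z ∈ collarReg c ψ (Iio 1) then χ (collarCoord c ψ' z) * G i l z else 0
    with hF
  have hsm : ContDiffOn ℝ ∞ (χ ∘ collarCoord c ψ') (Ico (0 : ℝ) 1 ×ˢ ψ'.target) :=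
    (hχ.comp_contMDiffOn (contMDiffOn_collarCoord c hψ')).contDiffOn
  refine ⟨F, ?_, fun z hz => ?_⟩
  · refine ContDiffOn.ite_mul (contMDiffOn_collarCoord c hψ').continuousOn hsm
      (isOpen_collarReg c ψ isOpen_Iio) (fun z _ h => hs h) ?_
    rcases i with _ | k
    · rcases l with _ | l <;> exact contDiffOn_const
    · rcases l with _ | l
      · exact contDiffOn_const
      · simp only [hG, Option.elim]
        refine contDiffOn_coord ?_ l
        have h1 : ContDiffOn ℝ ∞ (fun x => fderiv ℝ (crossTrans ψ ψ') x (EuclideanSpace.single k 1))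
            (ψ.target ∩ ψ.symm ⁻¹' ψ'.source) :=
          ((crossTrans_smooth hψ hψ').fderiv_of_isOpen isOpen_crossDom (by simp)).clm_apply
            contDiffOn_const
        refine h1.comp ((crossTrans_smooth hψ' hψ).comp contDiff_snd.contDiffOn
          (t := ψ'.target ∩ ψ'.symm ⁻¹' ψ.source) ?_) ?_
        · intro z hz
          exact ⟨hz.1.2, ((mem_collarReg_iff hz.1).1 hz.2).2⟩
        · intro z hz
          have h := ((mem_collarReg_iff hz.1).1 hz.2).2
          refine ⟨ψ.map_source h, ?_⟩
          simp only [crossTrans, mem_preimage, ψ.left_inv h]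
          exact ψ'.map_target hz.1.2
  · have hz' := prod_Ioo_subset _ hz
    have hz0 := fst_ne_zero hz
    simp only [pow_zero, one_mul, Patch.fieldCoef, hF]
    rw [reg_colPatch]
    change (if collarCoord c ψ' z ∈ collarReg c ψ (Ioo 0 1) then _ else _) = _
    by_cases h : ψ'.symm z.2 ∈ ψ.source
    · rw [if_pos ((mem_collarReg_iff hz').2 ⟨hz.1, h⟩),
        if_pos ((mem_collarReg_iff hz').2 ⟨hz.1.2, h⟩), transVec_colPatch hψ hψ' i hz h]
      have e0 : (colPatch c ψ hψ).inv ((colPatch c ψ' hψ').κ z) = (z.1, crossTrans ψ' ψ z.2) :=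
        collarInv_collarCoord hz'.1
      rw [e0]
      change χ (collarCoord c ψ' z) * _ = _
      congr 1
      rcases i with _ | k
      · rcases l with _ | l
        · simp [hG, colPatch, coneFrame, coneCoef, hz0]
        · simp [hG, colPatch, coneFrame, coneCoef]
      · rcases l with _ | l
        · simp [hG, colPatch, coneFrame, coneCoef]
        · simp [hG, colPatch, coneFrame, coneCoef]
    · rw [if_neg fun hh => h ((mem_collarReg_iff hz').1 hh).2,
        if_neg fun hh => h ((mem_collarReg_iff hz').1 hh).2]

variable {hψ : ψ ∈ IsManifold.maximalAtlas (𝓡 n) ∞ X}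
  {hχ : ContMDiff (𝓡∂ (n + 1)) 𝓘(ℝ, ℂ) ∞ χ}
  {hs : tsupport χ ∩ (𝓡∂ (n + 1)).interior B ⊆ (colPatch c ψ hψ).reg}

open Classical in
/-- A function on the collar which is given in the coordinates over a chart of the cross-section,
extended by zero. -/
def collarExt (c : Collar n B X) (ψ : OpenPartialHomeomorph X (EuclideanSpace ℝ (Fin n)))
    (g : ℝ × EuclideanSpace ℝ (Fin n) → ℂ) (y : B) : ℂ :=
  if y ∈ collarReg c ψ (Iio 1) then g (collarInv c ψ y) else 0

theorem collarInv_mem {y : B} {J : Set ℝ} (hy : y ∈ collarReg c ψ J) :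
    collarInv c ψ y ∈ (J ∩ Ico (0 : ℝ) 1) ×ˢ ψ.target :=
  ⟨⟨hy.2.1, c.inv_mem hy.1⟩, ψ.map_source hy.2.2⟩

theorem collarExt_coord (g : ℝ × EuclideanSpace ℝ (Fin n) → ℂ)
    {z : ℝ × EuclideanSpace ℝ (Fin n)} (hz : z ∈ Ico (0 : ℝ) 1 ×ˢ ψ.target) :
    collarExt c ψ g (collarCoord c ψ z) = g z := by
  unfold collarExt
  rw [if_pos ((mem_collarReg_iff hz).2 ⟨hz.1.2, ψ.map_target hz.2⟩), collarInv_coord c ψ hz]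

theorem collarExt_smooth (hψ : ψ ∈ IsManifold.maximalAtlas (𝓡 n) ∞ X) {ε : ℝ} (hε : ε ≤ 1)
    {g : ℝ × EuclideanSpace ℝ (Fin n) → ℂ} (hg : ContDiffOn ℝ ∞ g (Ico 0 ε ×ˢ ψ.target))
    {K : Set B} (hK : IsClosed K) (hKs : K ⊆ collarReg c ψ (Iio ε))
    (h0 : ∀ y ∈ collarReg c ψ (Iio 1), y ∉ K → g (collarInv c ψ y) = 0) :
    ContMDiff (𝓡∂ (n + 1)) 𝓘(ℝ, ℂ) ∞ (collarExt c ψ g) := by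
  refine contMDiff_of_region (isOpen_collarReg c ψ isOpen_Iio) hK hKs ?_ fun y hy => ?_
  · refine (hg.contMDiffOn.comp (contMDiffOn_collarInv c hψ (Iio ε)) fun y hy => ?_).congr
      fun y hy => ?_
    · have := collarInv_mem hy
      exact ⟨⟨this.1.2.1, this.1.1⟩, this.2⟩
    · unfold collarExt
      rw [if_pos ⟨hy.1, lt_of_lt_of_le hy.2.1 hε, hy.2.2⟩]
      rfl
  · unfold collarExt
    split_ifs with h
    · exact h0 y h hy
    · rfl

variable [MeasurableSpace B] [BorelSpace B] {m : Measure B}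

/-- Although the cut-off reaches the boundary, the divergence term stays smooth there: the density
relative to the frame is t^{n+1} ρ, and t^{n+1} drops out because it is an eigenfunction of the
field. -/
theorem hasBdd_fieldOp_col (hm : IsConeMeasure c m) (D : NormData c)
    (hs' : tsupport χ ⊆ collarReg c ψ (Iio 1)) :
    HasBdd m D 1 0 ((colPatch c ψ hψ).fieldOp i χ hχ hs) := by
  obtain ⟨ρ, hρs, hρ0, hρ⟩ := hm.exists_isDens_col hψ
  set Q := colPatch c ψ hψ with hQ
  set S := Ico (0 : ℝ) 1 ×ˢ ψ.target with hS
  -- The power n + 1 collects t^n from the measure and t from the inverse of q = 1/t.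
  obtain ⟨r, hr⟩ := coneFrame_X_pow ψ.open_target (n + 1) i
  have hχs : ContDiffOn ℝ ∞ (χ ∘ collarCoord c ψ) S :=
    (hχ.comp_contMDiffOn (contMDiffOn_collarCoord c hψ)).contDiffOn
  have hρc : ContDiffOn ℝ ∞ (fun z => (ρ z : ℂ)) S :=
    Complex.ofRealCLM.contDiff.comp_contDiffOn hρs
  have hρ0' : ∀ z ∈ S, (ρ z : ℂ) ≠ 0 := fun z hz => Complex.ofReal_ne_zero.2 (hρ0 z hz).ne'
  set f : ℝ × EuclideanSpace ℝ (Fin n) → ℂ := fun z => ρ z * (χ ∘ collarCoord c ψ) z with hf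
  have hfs : ContDiffOn ℝ ∞ f S := hρc.mul hχs
  have hu : UniqueDiffOn ℝ S := (uniqueDiffOn_Ico 0 1).prod ψ.open_target.uniqueDiffOn
  -- The quotient X(t^{n+1} ρχ) / (t^{n+1} ρ) = rχ + X(ρχ)/ρ. The derivative within [0,1) × ψ.target
  -- makes it meaningful and smooth at t = 0.
  set g : ℝ × EuclideanSpace ℝ (Fin n) → ℂ := fun z => r * (χ ∘ collarCoord c ψ) z +
    Q.wt i z * fderivWithin ℝ f S z (Q.vec i) * (ρ z : ℂ)⁻¹ with hg
  have hgs : ContDiffOn ℝ ∞ g S := by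
    refine (contDiffOn_const.mul hχs).add (ContDiffOn.mul ?_ (hρc.inv hρ0'))
    exact (Q.wt_smooth i).contDiffOn.mul
      ((hfs.fderivWithin hu (by simp)).clm_apply contDiffOn_const)
  have hb : ContMDiff (𝓡∂ (n + 1)) 𝓘(ℝ, ℂ) ∞ (collarExt c ψ g) := by
    refine collarExt_smooth hψ le_rfl hgs (isClosed_tsupport χ) hs' fun y hy hyK => ?_
    have hz := collarInv_mem hy
    have hzS : collarInv c ψ y ∈ S := ⟨hz.1.2, hz.2⟩
    have hn : collarCoord c ψ ⁻¹' (tsupport χ)ᶜ ∈ 𝓝[S] (collarInv c ψ y) := by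
      refine ((contMDiffOn_collarCoord c hψ).continuousOn _ hzS).preimage_mem_nhdsWithin ?_
      rw [collarCoord_inv c ψ hy]
      exact (isClosed_tsupport χ).isOpen_compl.mem_nhds hyK
    have h0 : f =ᶠ[𝓝[S] (collarInv c ψ y)] fun _ => 0 := by
      filter_upwards [hn] with w hw
      simp only [hf, Function.comp_apply]
      rw [image_eq_zero_of_notMem_tsupport hw, mul_zero]
    have h1 : (χ ∘ collarCoord c ψ) (collarInv c ψ y) = 0 := by
      simp only [Function.comp_apply]
      rw [collarCoord_inv c ψ hy, image_eq_zero_of_notMem_tsupport hyK]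
    simp only [hg]
    rw [h1, h0.fderivWithin_eq (by simp only [hf]; rw [h1, mul_zero])]
    simp
  have hO : IsOpen (Ioo (0 : ℝ) 1 ×ˢ ψ.target) := isOpen_Ioo.prod ψ.open_target
  have hT := Patch.isFormalTranspose_fieldOp (i := i) (hχ := hχ) (hs := hs) hρ hb.contMDiffOn
    (fun y hyi hy => by
      rw [reg_colPatch] at hy
      unfold collarExt
      rw [if_neg fun h => hy (interior_collarReg ⟨h, hyi⟩)]) (fun z hz => by
      have hzS : z ∈ S := prod_Ioo_subset _ hz
      have hz0 := fst_ne_zero hz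
      have e1 : collarExt c ψ g (Q.κ z) = g z := collarExt_coord g hzS
      have e2 : ∀ z, (Q.q z)⁻¹ = (z.1 : ℂ) := fun z => inv_inv _
      have e3 : (fun z : ℝ × EuclideanSpace ℝ (Fin n) =>
          (((z.1 ^ n * ρ z : ℝ) : ℂ) * (Q.q z)⁻¹) * χ (Q.κ z)) =
          fun z => (z.1 : ℂ) ^ (n + 1) * f z := by
        funext z
        rw [e2]
        simp only [hf, Function.comp_apply]
        push_cast
        change _ * χ (collarCoord c ψ z) = _
        ring
      rw [e1, e3, Frame.X_mul (P := Q.toFrame) i (contDiff_fst_pow (n + 1)).contDiffOn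
        (hfs.mono (prod_Ioo_subset _)) hz, e2]
      have e4 : Q.X i (fun z => (z.1 : ℂ) ^ (n + 1)) z = r * (z.1 : ℂ) ^ (n + 1) := hr z
      have e5 : Q.X i f z = Q.wt i z * fderivWithin ℝ f S z (Q.vec i) := by
        rw [fderivWithin_of_mem_nhds (mem_of_superset (hO.mem_nhds hz) (prod_Ioo_subset _))]
        rfl
      rw [e4, e5]
      have := hρ0' z hzS
      simp only [hg, hf]
      push_cast
      field_simp
      ring)
  have hA : IsLocOp c 1 0 (Q.fieldOp i χ hχ hs) :=
    isLocOp_fieldOp fun ψ' hψ' l => coneAdm_fieldCoef hψ hψ' hχ hs' l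
  exact ⟨_, isBddOp_of_isLocOp hm D le_rfl hA
    (hA.add ((isLocOp_mulOp_of_contMDiff hb 0).mono zero_le_one)).neg hT⟩

end ColField

end Fields

section Decomposition

variable {n : ℕ} {B X : Type*} [TopologicalSpace B] [T2Space B] [CompactSpace B]
  [ChartedSpace (EuclideanHalfSpace (n + 1)) B] [IsManifold (𝓡∂ (n + 1)) ∞ B]

/-! ### Cut-off functions -/

theorem exists_complex_cutoff {K U : Set B} (hK : IsClosed K) (hU : IsOpen U) (hKU : K ⊆ U) :
    ∃ (χ : B → ℂ) (W : Set B), ContMDiff (𝓡∂ (n + 1)) 𝓘(ℝ, ℂ) ∞ χ ∧ IsOpen W ∧ K ⊆ W ∧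
      (∀ y ∈ W, χ y = 1) ∧ tsupport χ ⊆ U := by
  obtain ⟨f, h0, h1, -⟩ := exists_contMDiffMap_zero_one_nhds_of_isClosed (𝓡∂ (n + 1)) (n := ⊤)
    hU.isClosed_compl hK (by rwa [← subset_compl_iff_disjoint_left, compl_compl])
  obtain ⟨V, hV, hUV, hV0⟩ := mem_nhdsSet_iff_exists.1 h0
  obtain ⟨W, hW, hKW, hW1⟩ := mem_nhdsSet_iff_exists.1 h1
  refine ⟨fun y => (f y : ℂ), W, f.contMDiff.ofReal_comp, hW, hKW, fun y hy => ?_, ?_⟩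
  · have : f y = 1 := hW1 hy
    simp only [this, Complex.ofReal_one]
  · refine (Patch.tsupport_subset_of hV.isClosed_compl fun y hy => ?_).trans
      (compl_subset_comm.1 hUV)
    have : f y = 0 := hV0 (not_not.1 hy)
    simp only [this, Complex.ofReal_zero]

theorem exists_complex_partition {V : B → Set B} (hV : ∀ y, IsOpen (V y)) (hmem : ∀ y, y ∈ V y) :
    ∃ (t : Finset B) (χ : t → B → ℂ), (∀ i, ContMDiff (𝓡∂ (n + 1)) 𝓘(ℝ, ℂ) ∞ (χ i)) ∧
      (∀ i, tsupport (χ i) ⊆ V i) ∧ ∀ x, ∑ i, χ i x = 1 := by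
  obtain ⟨t, ht⟩ := isCompact_univ.elim_finite_subcover V hV
    (fun x _ => mem_iUnion.2 ⟨x, hmem x⟩)
  obtain ⟨f, hf⟩ := SmoothPartitionOfUnity.exists_isSubordinate (𝓡∂ (n + 1)) isClosed_univ
    (fun i : t => V i) (fun i => hV _) (by
      intro x hx
      obtain ⟨i, hi, hx⟩ := mem_iUnion₂.1 (ht hx)
      exact mem_iUnion.2 ⟨⟨i, hi⟩, hx⟩)
  refine ⟨t, fun i y => (f i y : ℂ), fun i => (f i).contMDiff.ofReal_comp, fun i => ?_, fun x => ?_⟩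
  · rw [tsupport_ofReal]
    exact hf i
  · have := f.sum_eq_one (mem_univ x)
    rw [finsum_eq_sum_of_fintype] at this
    rw [← Complex.ofReal_sum, this, Complex.ofReal_one]

variable [TopologicalSpace X] [T2Space X] [CompactSpace X]
  [ChartedSpace (EuclideanSpace ℝ (Fin n)) X] [IsManifold (𝓡 n) ∞ X] {c : Collar n B X}
  [MeasurableSpace B] [BorelSpace B] {m : Measure B}

/-- Iterated derivatives, localised by cut-off functions, are bounded operators. -/
theorem exists_derivOp (hm : IsConeMeasure c m) (D : NormData c) {E ι : Type*}
    [NormedAddCommGroup E] [NormedSpace ℝ E] [Fintype ι] {Q : Patch n B E ι} {K U : Set B}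
    (hK : IsClosed K) (hU : IsOpen U) (hKU : K ⊆ U)
    (hUQ : U ∩ (𝓡∂ (n + 1)).interior B ⊆ Q.reg)
    (H : ∀ (χ : B → ℂ) (hχ : ContMDiff (𝓡∂ (n + 1)) 𝓘(ℝ, ℂ) ∞ χ)
      (hs : tsupport χ ∩ (𝓡∂ (n + 1)).interior B ⊆ Q.reg) (i : ι), tsupport χ ⊆ U →
        HasBdd m D 1 0 (Q.fieldOp i χ hχ hs)) :
    ∃ W, IsOpen W ∧ K ⊆ W ∧ ∀ k : ι → ℕ, ∃ P : testFun n B →ₗ[ℂ] testFun n B,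
      HasBdd m D (∑ i, k i) 0 P ∧ ∀ φ, ∀ z ∈ Q.dom, Q.κ z ∈ W →
        (P φ : B → ℂ) (Q.κ z) = Q.D k ((φ : B → ℂ) ∘ Q.κ) z := by
  classical
  -- One cut-off serves for all factors. It equals 1 on the open set W, where the product of cut-off
  -- fields thus agrees with the genuine iterated derivative.
  obtain ⟨χ, W, hχ, hW, hKW, hW1, hs⟩ := exists_complex_cutoff (n := n) hK hU hKU
  have hs' : tsupport χ ∩ (𝓡∂ (n + 1)).interior B ⊆ Q.reg :=
    (inter_subset_inter_left _ hs).trans hUQ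
  refine ⟨W, hW, hKW, fun k => ?_⟩
  obtain ⟨N, hN⟩ : ∃ N, ∑ i, k i = N := ⟨_, rfl⟩
  rw [hN]
  induction N generalizing k with
  | zero =>
    have hk : k = 0 := by
      funext i
      exact Finset.sum_eq_zero_iff.1 hN i (Finset.mem_univ i)
    subst hk
    exact ⟨LinearMap.id, hasBdd_id hm D zero_le_one 0, fun φ z _ _ => by
      rw [Frame.D_zero]; rfl⟩
  | succ N ih =>
    obtain ⟨i, k', rfl, hk'⟩ := Frame.exists_eq_add_single hN
    obtain ⟨P, hP, hP'⟩ := ih k' hk'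
    refine ⟨Q.fieldOp i χ hχ hs' ∘ₗ P, ?_, fun φ z hz hzW => ?_⟩
    · have := (H χ hχ hs' i hs).comp hP
      rwa [add_comm 1 N] at this
    -- Openness of W allows the equality of `P φ` and the derivative of order k' on W to be
    -- differentiated once more.
    · have hO : IsOpen (Q.dom ∩ Q.κ ⁻¹' W) :=
        Q.smooth.continuousOn.isOpen_inter_preimage Q.isOpen_dom hW
      rw [LinearMap.comp_apply, Patch.fieldOp_κ _ hz, hW1 _ hzW, one_mul,
        Frame.D_succ (P := Q.toFrame) k' i (Patch.testFun_pull φ) hz]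
      exact Frame.X_congr (P := Q.toFrame) i hO (fun w hw => hP' φ w hw.1 hw.2) ⟨hz, hzW⟩

/-! ### Cone differential operators are bounded -/

/-- χA is the sum of the operators (χ a_α) ∘ P_α, where P_α agrees with D^α near the support of χ.
Each χ a_α, extended by zero, is smooth on all of B, so its multiplication operator may be assigned
any weight, in particular μ. -/
theorem hasBdd_localized_int (hm : IsConeMeasure c m) (D : NormData c) {μ : ℕ}
    {A : testFun n B →ₗ[ℂ] testFun n B} (hA : IsConeDiffOp c μ A)
    {e : OpenPartialHomeomorph B (EuclideanHalfSpace (n + 1))}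
    (he : e ∈ IsManifold.maximalAtlas (𝓡∂ (n + 1)) ∞ B) {χ : B → ℂ}
    (hχ : ContMDiff (𝓡∂ (n + 1)) 𝓘(ℝ, ℂ) ∞ χ)
    (hs : tsupport χ ⊆ e.source ∩ (𝓡∂ (n + 1)).interior B) :
    HasBdd m D μ μ (mulOp χ hχ.contMDiffOn ∘ₗ A) := by
  rw [← reg_intPatch he] at hs
  obtain ⟨a, ha, hA⟩ := hA.interior e he
  obtain ⟨ρ, hρ⟩ := hm.exists_isDens_int he
  set Q := intPatch e he with hQ
  obtain ⟨W, hW, hKW, hP⟩ := exists_derivOp hm D (Q := Q) (isClosed_tsupport χ) Patch.isOpen_reg hs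
    inter_subset_left fun χ hχ hs i hχU => hasBdd_fieldOp_of_interior hm D hρ hχU
  choose P hP hP' using hP
  have hG : ∀ α ∈ multiIdx (n + 1) μ, ContMDiff (𝓡∂ (n + 1)) 𝓘(ℝ, ℂ) ∞
      (Q.ext fun z => χ (Q.κ z) * a α z) := by
    intro α hα
    refine contMDiff_of_region Patch.isOpen_reg (isClosed_tsupport χ) hs
      (Patch.ext_smooth ((Patch.pull_smooth hχ.contMDiffOn).mul (ha α hα))) fun y hy => ?_
    by_cases h : y ∈ Q.reg
    · rw [Patch.ext_of_mem _ h, Patch.right_inv h, image_eq_zero_of_notMem_tsupport hy, zero_mul]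
    · exact Patch.ext_of_notMem _ h
  have hsum : mulOp χ hχ.contMDiffOn ∘ₗ A = ∑ α ∈ (multiIdx (n + 1) μ).attach,
      mulOp _ (hG α α.2).contMDiffOn ∘ₗ P α := by
    refine LinearMap.ext fun φ => Subtype.ext (funext fun y => ?_)
    rw [LinearMap.sum_apply, testFun_sum_apply]
    simp only [LinearMap.comp_apply, mulOp_apply]
    by_cases hy : y ∈ tsupport χ
    · obtain ⟨z, hz, rfl⟩ := hs hy
      have h1 := hA φ z hz
      change (A φ : B → ℂ) (Q.κ z) = _ at h1
      rw [h1, Finset.mul_sum, ← Finset.sum_attach]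
      refine Finset.sum_congr rfl fun α _ => ?_
      rw [Patch.ext_κ _ hz, hP' _ _ _ hz (hKW hy)]
      have : Q.D α ((φ : B → ℂ) ∘ Q.κ) = iterD α (inChart e φ) :=
        coordFrame_D (isOpen_chartDom e) _ _
      rw [this]
      ring
    · rw [image_eq_zero_of_notMem_tsupport hy, zero_mul]
      refine (Finset.sum_eq_zero fun α _ => ?_).symm
      have : Q.ext (fun z => χ (Q.κ z) * a α z) y = 0 := by
        by_cases h : y ∈ Q.reg
        · rw [Patch.ext_of_mem _ h, Patch.right_inv h, image_eq_zero_of_notMem_tsupport hy,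
            zero_mul]
        · exact Patch.ext_of_notMem _ h
      rw [this, zero_mul]
  rw [hsum]
  refine HasBdd.sum hm _ fun α _ => HasBdd.mono hm ?_
    ((hasBdd_mulOp hm D (w := μ) _ fun _ hψ => coneAdm_of_contMDiff (hG α α.2) μ hψ).comp (hP α))
  have := mem_multiIdx.1 α.2
  omega

/-- The same factorisation near the boundary. The whole factor t^{-μ} goes into the multiplication
operators, which are bounded with order 0 and weight μ; the products of t∂_t and ∂_x use order j +
|α| ≤ μ and no weight. -/
theorem hasBdd_localized_col (hm : IsConeMeasure c m) (D : NormData c) {μ : ℕ}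
    {A : testFun n B →ₗ[ℂ] testFun n B} {ε : ℝ} (hε : ε ≤ 1)
    {ψ : OpenPartialHomeomorph X (EuclideanSpace ℝ (Fin n))}
    (hψ : ψ ∈ IsManifold.maximalAtlas (𝓡 n) ∞ X)
    {a : ℕ → (Fin n → ℕ) → ℝ × EuclideanSpace ℝ (Fin n) → ℂ}
    (ha : ∀ j ≤ μ, ∀ α ∈ multiIdx n (μ - j), ContDiffOn ℝ ∞ (a j α) (Ico 0 ε ×ˢ ψ.target))
    (hA : ∀ φ : testFun n B, ∀ z ∈ Ioo 0 ε ×ˢ ψ.target,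
        (A φ : B → ℂ) (collarCoord c ψ z) = ((z.1 : ℂ) ^ μ)⁻¹ *
          ∑ j ∈ Finset.range (μ + 1), ∑ α ∈ multiIdx n (μ - j),
            a j α z * ((-1) ^ j * coneD j α ((φ : B → ℂ) ∘ collarCoord c ψ) z))
    {χ : B → ℂ} (hχ : ContMDiff (𝓡∂ (n + 1)) 𝓘(ℝ, ℂ) ∞ χ)
    (hs : tsupport χ ⊆ collarReg c ψ (Iio ε)) :
    HasBdd m D μ μ (mulOp χ hχ.contMDiffOn ∘ₗ A) := by
  set Q := colPatch c ψ hψ with hQ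
  have hs1 : tsupport χ ⊆ collarReg c ψ (Iio 1) := fun y hy =>
    ⟨(hs hy).1, lt_of_lt_of_le (hs hy).2.1 hε, (hs hy).2.2⟩
  have hUQ : collarReg c ψ (Iio 1) ∩ (𝓡∂ (n + 1)).interior B ⊆ Q.reg := by
    rw [hQ, reg_colPatch]; exact interior_collarReg
  obtain ⟨W, hW, hKW, hP⟩ := exists_derivOp hm D (Q := Q) (isClosed_tsupport χ)
    (isOpen_collarReg c ψ isOpen_Iio) hs1 hUQ fun χ hχ hs i hχU => hasBdd_fieldOp_col hm D hχU
  choose P hP hP' using hP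
  set T : Finset ((_ : ℕ) × (Fin n → ℕ)) := (Finset.range (μ + 1)).sigma fun j =>
    multiIdx n (μ - j) with hT
  have hTmem : ∀ x ∈ T, x.1 ≤ μ ∧ x.2 ∈ multiIdx n (μ - x.1) := fun x hx => by
    obtain ⟨h1, h2⟩ := Finset.mem_sigma.1 hx
    exact ⟨Nat.lt_succ_iff.1 (Finset.mem_range.1 h1), h2⟩
  set g : ((_ : ℕ) × (Fin n → ℕ)) → ℝ × EuclideanSpace ℝ (Fin n) → ℂ := fun x z =>
    (χ ∘ collarCoord c ψ) z * ((-1) ^ x.1 * a x.1 x.2 z) with hg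
  -- The sign (−1)^j of (−t∂_t)^j is part of g. The function b is smooth in the interior only, while
  -- t^μ b is smooth up to the boundary.
  set b : ((_ : ℕ) × (Fin n → ℕ)) → B → ℂ := fun x =>
    collarExt c ψ fun z => ((z.1 : ℂ) ^ μ)⁻¹ * g x z with hb
  have hzero : ∀ y ∈ collarReg c ψ (Iio 1), y ∉ tsupport χ → ∀ x, g x (collarInv c ψ y) = 0 := by
    intro y hy hyK x
    simp only [hg, Function.comp_apply]
    rw [collarCoord_inv c ψ hy, image_eq_zero_of_notMem_tsupport hyK, zero_mul]
  have hbzero : ∀ y ∉ tsupport χ, ∀ x, b x y = 0 := by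
    intro y hy x
    simp only [hb, collarExt]
    split_ifs with h
    · rw [hzero y h hy, mul_zero]
    · rfl
  have hgs : ∀ x ∈ T, ContDiffOn ℝ ∞ (g x) (Ico 0 ε ×ˢ ψ.target) := by
    intro x hx
    refine ContDiffOn.mul ?_ (contDiffOn_const.mul (ha _ (hTmem x hx).1 _ (hTmem x hx).2))
    exact (hχ.comp_contMDiffOn (contMDiffOn_collarCoord c hψ)).contDiffOn.mono
      (prod_mono (Ico_subset_Ico_right hε) subset_rfl)
  have hG : ∀ x ∈ T, ContMDiff (𝓡∂ (n + 1)) 𝓘(ℝ, ℂ) ∞ (collarExt c ψ (g x)) := fun x hx =>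
    collarExt_smooth hψ hε (hgs x hx) (isClosed_tsupport χ) hs fun y hy hyK => hzero y hy hyK x
  have hbs : ∀ x ∈ T, ContMDiffOn (𝓡∂ (n + 1)) 𝓘(ℝ, ℂ) ∞ (b x) ((𝓡∂ (n + 1)).interior B) := by
    intro x hx y hy
    refine ContMDiffAt.contMDiffWithinAt ?_
    by_cases hyK : y ∈ tsupport χ
    · have hyr : y ∈ collarReg c ψ (Ioo 0 ε) :=
        ⟨(hs hyK).1, ⟨(c.mem_interior_iff (hs hyK).1).1 hy, (hs hyK).2.1⟩, (hs hyK).2.2⟩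
      refine ContMDiffOn.contMDiffAt (s := collarReg c ψ (Ioo 0 ε)) ?_
        ((isOpen_collarReg c ψ isOpen_Ioo).mem_nhds hyr)
      have h1 : ContDiffOn ℝ ∞ (fun z => ((z.1 : ℂ) ^ μ)⁻¹ * g x z) (Ioo 0 ε ×ˢ ψ.target) := by
        refine ContDiffOn.mul ((contDiff_fst_pow μ).contDiffOn.inv fun z hz => ?_)
          ((hgs x hx).mono (prod_mono Ioo_subset_Ico_self subset_rfl))
        exact pow_ne_zero _ (Complex.ofReal_ne_zero.2 (ne_of_gt hz.1.1))
      refine (h1.contMDiffOn.comp (contMDiffOn_collarInv c hψ (Ioo 0 ε)) fun w hw => ?_).congr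
        fun w hw => ?_
      · exact ⟨(collarInv_mem hw).1.1, (collarInv_mem hw).2⟩
      · simp only [hb, collarExt]
        rw [if_pos ⟨hw.1, lt_of_lt_of_le hw.2.1.2 hε, hw.2.2⟩]
        rfl
    · have : b x =ᶠ[𝓝 y] fun _ => 0 := by
        filter_upwards [(isClosed_tsupport χ).isOpen_compl.mem_nhds hyK] with w hw
        exact hbzero w hw x
      exact contMDiffAt_const.congr_of_eventuallyEq this
  -- All collar charts share the coordinate t, so in each of them t^μ cancels the singular factor
  -- and leaves the extension of g.
  have hbc : ∀ x ∈ T, ∀ ψ' ∈ IsManifold.maximalAtlas (𝓡 n) ∞ X,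
      ConeAdm ψ'.target μ (b x ∘ collarCoord c ψ') := by
    intro x hx ψ' hψ'
    refine ⟨collarExt c ψ (g x) ∘ collarCoord c ψ',
      ((hG x hx).comp_contMDiffOn (contMDiffOn_collarCoord c hψ')).contDiffOn, fun z hz => ?_⟩
    have hz0 := pow_ne_zero μ (fst_ne_zero hz)
    simp only [hb, collarExt, Function.comp_apply]
    split_ifs with h
    · have e : (collarInv c ψ (collarCoord c ψ' z)).1 = z.1 := by
        rw [collarInv_collarCoord (Ioo_subset_Ico_self hz.1)]
      rw [e, mul_inv_cancel_left₀ hz0]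
    · rw [mul_zero]
  set ix : ((_ : ℕ) × (Fin n → ℕ)) → Option (Fin n) → ℕ := fun x o => o.elim x.1 x.2 with hix
  have hsum : mulOp χ hχ.contMDiffOn ∘ₗ A = ∑ x ∈ T.attach,
      mulOp (b x) (hbs x x.2) ∘ₗ P (ix x) := by
    refine LinearMap.ext fun φ => Subtype.ext (funext fun y => ?_)
    rw [LinearMap.sum_apply, testFun_sum_apply]
    simp only [LinearMap.comp_apply, mulOp_apply]
    by_cases hy : y ∈ tsupport χ
    · by_cases hyi : y ∈ (𝓡∂ (n + 1)).interior B
      · have hyr : y ∈ collarReg c ψ (Ioo 0 ε) :=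
          ⟨(hs hy).1, ⟨(c.mem_interior_iff (hs hy).1).1 hyi, (hs hy).2.1⟩, (hs hy).2.2⟩
        obtain ⟨z, hz, rfl⟩ : ∃ z ∈ Ioo 0 ε ×ˢ ψ.target, collarCoord c ψ z = y :=
          ⟨collarInv c ψ y, ⟨(collarInv_mem hyr).1.1, (collarInv_mem hyr).2⟩,
            collarCoord_inv c ψ hyr⟩
        have hzd : z ∈ Q.dom := ⟨⟨hz.1.1, lt_of_lt_of_le hz.1.2 hε⟩, hz.2⟩
        rw [hA φ z hz, Finset.sum_sigma', Finset.mul_sum, Finset.mul_sum, ← Finset.sum_attach]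
        refine Finset.sum_congr rfl fun x _ => ?_
        have e1 : b x (collarCoord c ψ z) = ((z.1 : ℂ) ^ μ)⁻¹ * g x z :=
          collarExt_coord _ (prod_Ioo_subset _ hzd)
        have e2 : (P (ix x) φ : B → ℂ) (collarCoord c ψ z) =
            Q.D (ix x) ((φ : B → ℂ) ∘ collarCoord c ψ) z := hP' _ φ z hzd (hKW hy)
        have e3 : Q.D (ix x) ((φ : B → ℂ) ∘ collarCoord c ψ) =
            coneD (x : (_ : ℕ) × (Fin n → ℕ)).1 (x : (_ : ℕ) × (Fin n → ℕ)).2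
              ((φ : B → ℂ) ∘ collarCoord c ψ) := coneFrame_D ψ.open_target _ _
        rw [e1, e2, e3]
        simp only [hg, Function.comp_apply]
        ring
      · rw [testFun_eq_zero _ hyi, mul_zero]
        exact (Finset.sum_eq_zero fun x _ => by rw [testFun_eq_zero _ hyi, mul_zero]).symm
    · rw [image_eq_zero_of_notMem_tsupport hy, zero_mul]
      exact (Finset.sum_eq_zero fun x _ => by rw [hbzero y hy, zero_mul]).symm
  rw [hsum]
  -- Terms of order below μ are raised to order μ by the embeddings.
  refine HasBdd.sum hm _ fun x _ => HasBdd.mono hm ?_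
    ((hasBdd_mulOp hm D (hbs x x.2) (hbc x x.2)).comp (hP (ix x)))
  have h1 := (hTmem x x.2).1
  have h2 := mem_multiIdx.1 (hTmem x x.2).2
  rw [Fintype.sum_option]
  simp only [hix, Option.elim]
  omega

/-- Cone differential operators are bounded between the spaces of integer order. -/
theorem hasBdd_of_isConeDiffOp (hm : IsConeMeasure c m) (D : NormData c) {μ : ℕ}
    {A : testFun n B →ₗ[ℂ] testFun n B} (hA : IsConeDiffOp c μ A) : HasBdd m D μ μ A := by
  have hloc : ∀ y : B, ∃ V, IsOpen V ∧ y ∈ V ∧ ∀ (χ : B → ℂ)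
      (hχ : ContMDiff (𝓡∂ (n + 1)) 𝓘(ℝ, ℂ) ∞ χ), tsupport χ ⊆ V →
        HasBdd m D μ μ (mulOp χ hχ.contMDiffOn ∘ₗ A) := by
    intro y
    by_cases hy : y ∈ (𝓡∂ (n + 1)).interior B
    · have hc := IsManifold.chart_mem_maximalAtlas (I := 𝓡∂ (n + 1)) (n := ∞) y
      exact ⟨_, (chartAt (EuclideanHalfSpace (n + 1)) y).open_source.inter isOpen_interior_manifold,
        ⟨mem_chart_source _ y, hy⟩, fun χ hχ hs => hasBdd_localized_int hm D hA hc hχ hs⟩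
    · obtain ⟨ε, hε0, hε1, hA'⟩ := hA.collar
      have hb : y ∈ (𝓡∂ (n + 1)).boundary B := by
        rw [← (𝓡∂ (n + 1)).compl_interior]; exact hy
      rw [← c.image_zero] at hb
      obtain ⟨⟨t, x⟩, ⟨ht, -⟩, rfl⟩ := hb
      obtain rfl : t = 0 := ht
      have hc := IsManifold.chart_mem_maximalAtlas (I := 𝓡 n) (n := ∞) x
      obtain ⟨a, ha, hA''⟩ := hA' _ hc
      refine ⟨_, isOpen_collarReg c (chartAt (EuclideanSpace ℝ (Fin n)) x) (isOpen_Iio (a := ε)),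
        ⟨c.map_mem (by simp) x, ?_⟩, fun χ hχ hs => hasBdd_localized_col hm D hε1 hc ha hA'' hχ hs⟩
      change c.invFun (c.toFun (0, x)) ∈ Iio ε ×ˢ (chartAt (EuclideanSpace ℝ (Fin n)) x).source
      rw [c.left_inv_apply (by simp)]
      exact ⟨hε0, mem_chart_source _ x⟩
  choose V hV hmem hloc using hloc
  -- A = ∑ χ_i A with finitely many localised summands, each bounded and with a transpose; the sum
  -- of these transposes is the transpose of A.
  obtain ⟨t, χ, hχ1, hχ2, hχ3⟩ := exists_complex_partition (n := n) hV hmem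
  have hsum : A = ∑ i, mulOp (χ i) (hχ1 i).contMDiffOn ∘ₗ A := by
    refine LinearMap.ext fun φ => Subtype.ext (funext fun y => ?_)
    rw [LinearMap.sum_apply, testFun_sum_apply]
    simp only [LinearMap.comp_apply, mulOp_apply]
    rw [← Finset.sum_mul, hχ3, one_mul]
  rw [hsum]
  exact HasBdd.sum hm _ fun i _ => hloc _ _ (hχ1 i) (hχ2 i)

end Decomposition

/-! ### Interpolation -/

section Interpolation

variable {V W : Type*} [AddCommGroup V] [Module ℂ V] [AddCommGroup W] [Module ℂ W]
  {M₀ M₁ : V → ℝ≥0∞} {N₀ N₁ : W → ℝ≥0∞} {T : V →ₗ[ℂ] W} {C : ℝ≥0}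

theorem sumNorm_map_le (hC : C ≠ 0) (h₀ : ∀ v, N₀ (T v) ≤ C * M₀ v)
    (h₁ : ∀ v, N₁ (T v) ≤ C * M₁ v) (v : V) :
    sumNorm N₀ N₁ (T v) ≤ C * sumNorm M₀ M₁ v := by
  unfold sumNorm
  rw [ENNReal.mul_iInf_of_ne (by simpa using hC) (by simp)]
  refine le_iInf fun a => (iInf_le _ (T a)).trans ?_
  rw [← map_sub, mul_add]
  exact add_le_add (h₀ a) (h₁ _)

theorem tendsto_zero_of_le_coe_mul {α : Type*} {l : Filter α} {f g : α → ℝ≥0∞}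
    (h : ∀ x, f x ≤ C * g x) (hg : Tendsto g l (𝓝 0)) : Tendsto f l (𝓝 0) := by
  have := ENNReal.Tendsto.const_mul (a := (C : ℝ≥0∞)) hg (Or.inr (by simp))
  rw [mul_zero] at this
  exact tendsto_of_tendsto_of_tendsto_of_le_of_le tendsto_const_nhds this (fun _ => zero_le) h

/-- Each requirement is the finiteness or convergence to zero of a norm of values, differences or
difference quotients. A linear T commutes with these operations and changes the norms by at most the
factor C. -/
theorem CalderonFun.map (hC : C ≠ 0) (h₀ : ∀ v, N₀ (T v) ≤ C * M₀ v)
    (h₁ : ∀ v, N₁ (T v) ≤ C * M₁ v) {F : ℂ → V} (hF : CalderonFun M₀ M₁ F) :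
    CalderonFun N₀ N₁ fun z => T (F z) where
  bounded := by
    obtain ⟨K, hK⟩ := hF.bounded
    refine ⟨C * K, fun z h0 h1 => (sumNorm_map_le hC h₀ h₁ _).trans ?_⟩
    rw [ENNReal.coe_mul]
    exact mul_le_mul_right (hK z h0 h1) _
  continuous z h0 h1 := tendsto_zero_of_le_coe_mul (C := C)
    (fun w => by rw [← map_sub]; exact sumNorm_map_le hC h₀ h₁ _) (hF.continuous z h0 h1)
  holomorphic z h0 h1 := by
    obtain ⟨F', h2, h3⟩ := hF.holomorphic z h0 h1
    refine ⟨T F', (sumNorm_map_le hC h₀ h₁ _).trans_lt (ENNReal.mul_lt_top (by simp) h2),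
      tendsto_zero_of_le_coe_mul (C := C) (fun w => ?_) h3⟩
    rw [← map_sub, ← map_smul, ← map_sub]
    exact sumNorm_map_le hC h₀ h₁ _
  left_mem y := (h₀ _).trans_lt (ENNReal.mul_lt_top (by simp) (hF.left_mem y))
  left_continuous y := tendsto_zero_of_le_coe_mul (C := C)
    (fun y' => by rw [← map_sub]; exact h₀ _) (hF.left_continuous y)
  left_decay := tendsto_zero_of_le_coe_mul (C := C) (fun y => h₀ _) hF.left_decay
  right_mem y := (h₁ _).trans_lt (ENNReal.mul_lt_top (by simp) (hF.right_mem y))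
  right_continuous y := tendsto_zero_of_le_coe_mul (C := C)
    (fun y' => by rw [← map_sub]; exact h₁ _) (hF.right_continuous y)
  right_decay := tendsto_zero_of_le_coe_mul (C := C) (fun y => h₁ _) hF.right_decay

/-- The interpolation property of the complex method. -/
theorem interpNorm_map_le (hC : C ≠ 0) (h₀ : ∀ v, N₀ (T v) ≤ C * M₀ v)
    (h₁ : ∀ v, N₁ (T v) ≤ C * M₁ v) (θ : ℝ) (v : V) :
    interpNorm N₀ N₁ θ (T v) ≤ C * interpNorm M₀ M₁ θ v := by
  have hC' : (C : ℝ≥0∞) ≠ 0 := by simpa using hC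
  unfold interpNorm
  -- The infimum may be over an empty family and equal to ⊤, hence the need for C ≠ 0.
  rw [ENNReal.mul_iInf_of_ne hC' (by simp)]
  refine le_iInf fun F => ?_
  rw [ENNReal.mul_iInf_of_ne hC' (by simp)]
  refine le_iInf fun hF => ?_
  rw [ENNReal.mul_iInf_of_ne hC' (by simp)]
  refine le_iInf fun hv => ?_
  refine (iInf_le _ fun z => T (F z)).trans ((iInf₂_le (hF.map hC h₀ h₁) (congrArg T hv)).trans ?_)
  refine max_le (iSup_le fun y => ?_) (iSup_le fun y => ?_)
  · exact (h₀ _).trans (mul_le_mul_right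
      ((le_iSup (fun y : ℝ => M₀ (F (y * Complex.I))) y).trans (le_max_left _ _)) _)
  · exact (h₁ _).trans (mul_le_mul_right
      ((le_iSup (fun y : ℝ => M₁ (F (1 + y * Complex.I))) y).trans (le_max_right _ _)) _)

end Interpolation

/-- Adding the integer μ changes the floor but not the fractional part, so source and target are
interpolated with the same parameter between spaces for which the bounds at ⌊s⌋ and ⌊s⌋ + 1 are
available. -/
theorem IsBddOp.exists_sobNorm_le {n : ℕ} {B X : Type*} [TopologicalSpace B] [T2Space B]
    [CompactSpace B] [ChartedSpace (EuclideanHalfSpace (n + 1)) B] [IsManifold (𝓡∂ (n + 1)) ∞ B]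
    [MeasurableSpace B] [BorelSpace B] [TopologicalSpace X] [T2Space X] [CompactSpace X]
    [ChartedSpace (EuclideanSpace ℝ (Fin n)) X] [IsManifold (𝓡 n) ∞ X]
    {c : Collar n B X} {m : Measure B} {D : NormData c} {μ w : ℕ}
    {A At : testFun n B →ₗ[ℂ] testFun n B} (h : IsBddOp m D μ w A At) {p : ℝ} (hp : 1 < p)
    (s γ : ℝ) : ∃ C : ℝ≥0, ∀ u : GenFun n B,
      sobNorm m D s γ p (At.dualMap u) ≤ C * sobNorm m D (s + μ) (γ + w) p u := by
  obtain ⟨C₀, h₀⟩ := h.bound p hp ⌊s⌋ γ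
  obtain ⟨C₁, h₁⟩ := h.bound p hp (⌊s⌋ + 1) γ
  -- A common nonzero constant for both endpoints, as required by `interpNorm_map_le`.
  refine ⟨C₀ + C₁ + 1, fun u => ?_⟩
  unfold sobNorm
  rw [Int.fract_add_natCast, Int.floor_add_natCast]
  have hC₀ : C₀ ≤ C₀ + C₁ + 1 := by rw [add_assoc]; exact le_self_add
  have hC₁ : C₁ ≤ C₀ + C₁ + 1 := le_self_add.trans' le_add_self
  have e₀ : ∀ u, intNorm m D ⌊s⌋ γ p (At.dualMap u) ≤
      ((C₀ + C₁ + 1 : ℝ≥0) : ℝ≥0∞) * intNorm m D (⌊s⌋ + μ) (γ + w) p u := fun u =>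
    (h₀ u).trans (mul_le_mul_left (ENNReal.coe_le_coe.2 hC₀) _)
  have e₁ : ∀ u, intNorm m D (⌊s⌋ + 1) γ p (At.dualMap u) ≤
      ((C₀ + C₁ + 1 : ℝ≥0) : ℝ≥0∞) * intNorm m D (⌊s⌋ + μ + 1) (γ + w) p u := fun u => by
    have e : ⌊s⌋ + (μ : ℤ) + 1 = ⌊s⌋ + 1 + μ := by ring
    rw [e]
    exact (h₁ u).trans (mul_le_mul_left (ENNReal.coe_le_coe.2 hC₁) _)
  split_ifs with hs
  · exact e₀ u
  · exact interpNorm_map_le (by positivity) e₀ e₁ _ u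

end

/-! ### The theorem -/

theorem theorem5p4 {n : ℕ} {B X : Type*} [TopologicalSpace B] [T2Space B] [CompactSpace B]
    [ChartedSpace (EuclideanHalfSpace (n + 1)) B] [IsManifold (𝓡∂ (n + 1)) ∞ B]
    [MeasurableSpace B] [BorelSpace B]
    [TopologicalSpace X] [T2Space X] [CompactSpace X]
    [ChartedSpace (EuclideanSpace ℝ (Fin n)) X] [IsManifold (𝓡 n) ∞ X]
    (c : Collar n B X) (m : Measure B) (hm : IsConeMeasure c m) (D : NormData c)
    (μ : ℕ) (A : testFun n B →ₗ[ℂ] testFun n B) (hA : IsConeDiffOp c μ A) :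
    ∃ At : testFun n B →ₗ[ℂ] testFun n B, IsFormalTranspose m A At ∧
      ∀ p : ℝ, 1 < p → ∀ s γ : ℝ, ∃ C : ℝ≥0,
        ∀ u ∈ coneSobolev m D (s + μ) (γ + μ) p,
          At.dualMap u ∈ coneSobolev m D s γ p ∧
            sobNorm m D s γ p (At.dualMap u) ≤ C * sobNorm m D (s + μ) (γ + μ) p u := by
  obtain ⟨At, hAt⟩ := hasBdd_of_isConeDiffOp hm D hA
  refine ⟨At, hAt.transpose, fun p hp s γ => ?_⟩
  obtain ⟨C, hC⟩ := hAt.exists_sobNorm_le hp s γ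
  exact ⟨C, fun u hu => ⟨(hC u).trans_lt (ENNReal.mul_lt_top (by simp) hu), hC u⟩⟩
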